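/- Let $n\ge 1$, let $\mathbb B^n$ and $\mathbb S^n$ be the open unit ball and the unit sphere of $\mathbb C^n$, let $\langle z,w\rangle=\sum_j z_j\overline{w_j}$, let $\sigma$ be the rotation-invariant Borel probability measure on $\mathbb S^n$, and put $\mathbb 1=(1,0,\dots,0)$. For $u,v\in\mathbb S^n$ let $d(u,v)=|1-\langle u,v\rangle|$. A nonisotropic ball is a set $Q=\{z\in\mathbb S^n: d(z,\zeta)\le r\}$ with $\zeta\in\mathbb S^n$ and $r\ge 0$; we write $l(Q)=r$ for its radius. For $f\in L^1(\sigma)$ let $\nu(f,Q)=\inf_{a\in\mathbb C}\frac1{\sigma(Q)}\int_Q|f-a|\,d\sigma$ (read as $0$ when $\sigma(Q)=0$, i.e. $r=0$). A function $f$ on $\mathbb B^n$, extended to $\sigma$-almost all of $\mathbb S^n$ by its radial limits $f(\xi)=\lim_{r\to1^-}f(r\xi)$ (assumed to exist almost everywhere), is called outer if $f\ne 0$ $\sigma$-a.e. on $\mathbb S^n$, $\log|f|\in L^1(\sigma)$, and for all $z\in\mathbb B^n$ $$f(z)=\exp\Big[\int_{\mathbb S^n}\Big(\frac{2}{(1-\langle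 z,\xi\rangle)^{n}}-1\Big)\log|f(\xi)|\,d\sigma(\xi)\Big].$$ Let $\alpha\in(0,1)$ and let $C_0,B$ be real numbers. There is a constant $C>0$, depending only on $n,\alpha,C_0$ and $B$, such that the following holds. Let $p>1$, let $q$ be its conjugate exponent, $1/p+1/q=1$, and let $f$ be an outer function on $\mathbb B^n$ such that $\phi=|f|$ (the boundary values of $f$ being fixed at every point of $\mathbb S^n$, suitably on the exceptional null set) satisfies $$|\phi(t)-\phi(\mathbb 1)|\le C_0\,d(t,\mathbb 1)^\alpha\quad\text{for all }t\in\mathbb S^n,\qquad \int_{\mathbb S^n}|\log\phi|^p\,d\sigma\le B.$$ Then $f\in L^1(\sigma)$, and for every nonisotropic ball $Q$ containing $\mathbb 1$ $$\nu(f,Q)\le C\,l(Q)^{\frac{\alpha}{n+1-n/q}}=C\,l(Q)^{\frac{\alpha p}{p+n}}.$$ -/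

import Mathlib

open MeasureTheory Filter Topology

noncomputable section

namespace BallOuter

/-- The complex Euclidean space `ℂⁿ`. -/
abbrev Cn (n : ℕ) : Type := EuclideanSpace ℂ (Fin n)

/-- The unit sphere of `ℂⁿ`. -/
abbrev Sph (n : ℕ) : Type := Metric.sphere (0 : Cn n) 1

/-- The rotation-invariant Borel probability measure on the unit sphere of `ℂⁿ`:
normalized surface measure. -/
def sigma (n : ℕ) : Measure (Sph n) :=
  ((volume : Measure (Cn n)).toSphere Set.univ)⁻¹ • (volume : Measure (Cn n)).toSphere

instance sigma.instIsProbabilityMeasure (n : ℕ) [NeZero n] : IsProbabilityMeasure (sigma n) := by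
  constructor
  have h0 : (volume : Measure (Cn n)).toSphere Set.univ ≠ 0 := by
    have h := Measure.toSphere_ne_zero (volume : Measure (Cn n))
    exact fun h0 => h (Measure.measure_univ_eq_zero.mp h0)
  have h1 : (volume : Measure (Cn n)).toSphere Set.univ ≠ ⊤ := measure_ne_top _ _
  simp only [sigma, Measure.smul_apply, smul_eq_mul]
  exact ENNReal.inv_mul_cancel h0 h1

/-- The point `(1, 0, …, 0)` of the unit sphere. -/
def one (n : ℕ) [NeZero n] : Sph n :=
  ⟨EuclideanSpace.single 0 1, by simp⟩

/-- The Cauchy kernel `C(z, ξ) = (1 - ⟨z, ξ⟩)⁻ⁿ`, where `⟨z, ξ⟩ = ∑ zⱼ conj ξⱼ`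
(Mathlib's inner product is conjugate-linear in its first argument). -/
def cauchyKernel {n : ℕ} (z ξ : Cn n) : ℂ := ((1 - inner ℂ ξ z) ^ n)⁻¹

/-- Outer functions in the unit ball. Only the values of `f` on the closed unit ball matter.
On the sphere `f` is given by its boundary values (radial limits almost everywhere),
`log |f|` is finite a.e. and integrable there, and `f` is recovered in the open ball from
`Re (log f) = log |f|` on the sphere. -/
structure IsOuter {n : ℕ} (f : Cn n → ℂ) : Prop where
  boundary : ∀ᵐ ξ : Sph n ∂(sigma n),
    Tendsto (fun r : ℝ => f (r • (ξ : Cn n))) (𝓝[<] 1) (𝓝 (f ξ))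
  ne_zero : ∀ᵐ ξ : Sph n ∂(sigma n), f ξ ≠ 0
  integrable_log : Integrable (fun ξ : Sph n => Real.log ‖f ξ‖) (sigma n)
  eq_exp : ∀ z ∈ Metric.ball (0 : Cn n) 1,
    f z = Complex.exp (∫ ξ : Sph n,
      (2 * cauchyKernel z (ξ : Cn n) - 1) * (Real.log ‖f ξ‖ : ℂ) ∂(sigma n))

/-- The nonisotropic quasimetric `d(u, v) = |1 - ⟨u, v⟩|` on the unit sphere. -/
def qdist {n : ℕ} (u v : Sph n) : ℝ := ‖1 - inner ℂ (v : Cn n) (u : Cn n)‖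

/-- The nonisotropic ball with center `ζ` and radius `r`. -/
def qball {n : ℕ} (ζ : Sph n) (r : ℝ) : Set (Sph n) := {z | qdist z ζ ≤ r}

/-- The mean oscillation `ν(f, Q) = inf_a (1 / |Q|) ∫_Q |f - a| dσ`. -/
def meanOsc {n : ℕ} (f : Sph n → ℂ) (Q : Set (Sph n)) : ℝ :=
  ⨅ a : ℂ, ((sigma n).real Q)⁻¹ * ∫ z in Q, ‖f z - a‖ ∂(sigma n)

end BallOuter

end

noncomputable section

namespace BallOuter

variable {n : ℕ}

/-! Write `u = log |f|`, `s = 1 + n/p`, `x` for the modulus of `f` at the distinguished point, and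
`d` for the quasidistance to that point. After enlarging `C₀` and `B` to at least 1, the target is
`r ^ (α/s)`. If `x ≤ 2 C r ^ (α/s)`, the Hölder condition already makes `|f|` itself of that size on
the ball. Otherwise the oscillation is measured in `L²` against a nonnegative kernel `W` of mass one
living at scale `r`, and Chebyshev-type arguments return to `L¹` (`exists_variance_bound`,
`meanOsc_le_of_sq`).

The argument of `f` never has to be estimated. The Poisson–Szegő kernel reproduces the bounded
function `f`, and `|f(z)| = exp P[u](z)`. If `W` is one kernel `P`, then `∫ W |f - f(z)|² =
P[|f|²](z) - exp (2 P[u](z))`, which involves only the modulus. Expanding around `x`, the part of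
`|f|² - x²` that is linear in `log |f| - log x` cancels, and second-order quantities remain
(`weighted_variance_le`).

The modulus is controlled at the scale `R = min 1 ((x/2C) ^ (1/α))`. Inside it `|f| ≥ x/2` and the
Hölder condition applies to the logarithm. Outside it only the `Lᵖ` bound on `u` is available, and
it contributes `r R ^ (-s)`. Since `x ≤ M R ^ α` and `R ≥ r ^ (1/s)`, the product `x r R ^ (-s)` is
at most `M r ^ (α/s)`, which is where the exponent comes from (`exists_scale`,
`integral_tail_kernel_le`, `mul_scale_le`). The tail also enters the variance to first order, so `W`
must decay like `r² d ^ (-n-2)`. One Poisson kernel does this for `n ≥ 2`; for `n = 1` a signed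
combination of two kernels is needed (`exists_kernel`).

The kernel `2 (1 - ⟨z,ξ⟩)⁻ⁿ - 1` in the definition of an outer function does not have the
Poisson–Szegő kernel as real part when `n > 1`, so `|f| = exp P[u]` needs a proof
(`re_outerLog_eq_poisson`). The real part of the exponent has radial limits `u` almost everywhere
because `|f|` does. It is also uniformly integrable over the spheres, because the Cauchy integral
maps `Lᵖ` to weak `Lᵖ` uniformly in the radius; this follows from an `L²` contraction and a
Calderón–Zygmund decomposition. These bounds are used only qualitatively, so the final constant does
not depend on `p`. -/

/-! ### Geometry of the nonisotropic quasimetric -/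

lemma norm_sph (z : Sph n) : ‖(z : Cn n)‖ = 1 := by simp

lemma norm_inner_sph_le (z w : Sph n) : ‖inner ℂ (w : Cn n) (z : Cn n)‖ ≤ 1 := by
  have := norm_inner_le_norm (𝕜 := ℂ) (w : Cn n) (z : Cn n)
  simpa [norm_sph] using this

lemma qdist_nonneg (u v : Sph n) : 0 ≤ qdist u v := norm_nonneg _

lemma qdist_comm (u v : Sph n) : qdist u v = qdist v u := by
  unfold qdist
  rw [← inner_conj_symm (u : Cn n) (v : Cn n), ← RCLike.norm_conj]
  simp

lemma qdist_self (u : Sph n) : qdist u u = 0 := by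
  unfold qdist
  rw [inner_self_eq_norm_sq_to_K, norm_sph]; simp

lemma qdist_le_two (u v : Sph n) : qdist u v ≤ 2 := by
  unfold qdist
  refine (norm_sub_le _ _).trans ?_
  have := norm_inner_sph_le u v
  simp only [norm_one]; linarith

lemma continuous_qdist (v : Sph n) : Continuous fun u : Sph n => qdist u v := by
  unfold qdist; fun_prop

/-- The component of `z` orthogonal to a unit vector `w` is controlled by the quasidistance. -/
lemma norm_sq_orthogonal_le (z w : Sph n) :
    ‖(z : Cn n) - inner ℂ (w : Cn n) (z : Cn n) • (w : Cn n)‖ ^ 2 ≤ 2 * qdist z w := by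
  set a := inner ℂ (w : Cn n) (z : Cn n) with ha
  have h1 : ‖(z : Cn n) - a • (w : Cn n)‖ ^ 2 = 1 - ‖a‖ ^ 2 := by
    have h2 := norm_sub_sq (𝕜 := ℂ) (z : Cn n) (a • (w : Cn n))
    rw [h2, norm_sph, norm_smul, norm_sph, inner_smul_right, ← inner_conj_symm (z : Cn n), ← ha,
      Complex.mul_conj]
    simp [Complex.normSq_eq_norm_sq, -Complex.ofReal_pow]
    ring
  rw [h1]
  have h3 : ‖a‖ ≤ 1 := norm_inner_sph_le z w
  have h4 : 1 - ‖a‖ ≤ qdist z w := by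
    have := norm_sub_norm_le (1 : ℂ) a
    simpa [qdist, ← ha] using this
  nlinarith [norm_nonneg a]

lemma inner_decomp (x z v : Cn n) (hx : ‖x‖ = 1) :
    inner ℂ v z = inner ℂ v x * inner ℂ x z +
      inner ℂ (v - inner ℂ x v • x) (z - inner ℂ x z • x) := by
  have hxx : inner ℂ x x = 1 := by rw [inner_self_eq_norm_sq_to_K, hx]; simp
  simp only [inner_sub_left, inner_sub_right, inner_smul_left, inner_smul_right, hxx,
    inner_conj_symm]
  ring

lemma norm_inner_orthogonal_le (x z v : Sph n) :
    ‖inner ℂ ((v : Cn n) - inner ℂ (x : Cn n) (v : Cn n) • (x : Cn n))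
      ((z : Cn n) - inner ℂ (x : Cn n) (z : Cn n) • (x : Cn n))‖
      ≤ 2 * (√(qdist v x) * √(qdist z x)) := by
  refine (norm_inner_le_norm _ _).trans ?_
  have h1 := Real.le_sqrt_of_sq_le (norm_sq_orthogonal_le v x)
  have h2 := Real.le_sqrt_of_sq_le (norm_sq_orthogonal_le z x)
  rw [Real.sqrt_mul (by norm_num)] at h1 h2
  refine (mul_le_mul h1 h2 (norm_nonneg _) (by positivity)).trans ?_
  have : √(2 : ℝ) * √2 = 2 := Real.mul_self_sqrt (by norm_num)
  apply le_of_eq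
  linear_combination (√(qdist v x) * √(qdist z x)) * this

/-- Splitting `z` and `v` along `w` writes `1 - ⟨z,v⟩` as two terms bounded by the quasidistances to
`w`, minus the inner product of the components orthogonal to `w`. The last term is at most `2
√(qdist w v) √(qdist z w)`, exactly the cross term in the square of the right-hand side. -/
lemma sqrt_qdist_triangle (z w v : Sph n) :
    √(qdist z v) ≤ √(qdist z w) + √(qdist w v) := by
  apply Real.sqrt_le_left (by positivity) |>.mpr
  have e : (√(qdist z w) + √(qdist w v)) ^ 2
      = qdist z w + qdist w v + 2 * (√(qdist w v) * √(qdist z w)) := by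
    rw [add_sq, Real.sq_sqrt (qdist_nonneg _ _), Real.sq_sqrt (qdist_nonneg _ _)]; ring
  rw [e]
  have h := inner_decomp (w : Cn n) z v (norm_sph w)
  have h2 := norm_inner_orthogonal_le w z v
  have h3 : (1 : ℂ) - inner ℂ (v : Cn n) (z : Cn n)
      = inner ℂ (v : Cn n) (w : Cn n) * (1 - inner ℂ (w : Cn n) (z : Cn n))
        + (1 - inner ℂ (v : Cn n) (w : Cn n))
        - inner ℂ ((v : Cn n) - inner ℂ (w : Cn n) (v : Cn n) • (w : Cn n))
      ((z : Cn n) - inner ℂ (w : Cn n) (z : Cn n) • (w : Cn n)) := by rw [h]; ring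
  have h4 : qdist z v ≤ 1 * qdist z w + qdist w v + 2 * (√(qdist v w) * √(qdist z w)) := by
    conv_lhs => unfold qdist
    rw [h3]
    refine (norm_sub_le _ _).trans (add_le_add ((norm_add_le _ _).trans (add_le_add ?_ le_rfl)) h2)
    rw [norm_mul]
    exact mul_le_mul_of_nonneg_right (norm_inner_sph_le _ _) (norm_nonneg _)
  rw [qdist_comm v w] at h4
  linarith

lemma qdist_triangle (z w v : Sph n) : qdist z v ≤ 2 * (qdist z w + qdist w v) := by
  have h := sqrt_qdist_triangle z w v
  have h1 := Real.sq_sqrt (qdist_nonneg z w)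
  have h2 := Real.sq_sqrt (qdist_nonneg w v)
  have h3 := Real.sq_sqrt (qdist_nonneg z v)
  nlinarith [Real.sqrt_nonneg (qdist z v), sq_nonneg (√(qdist z w) - √(qdist w v))]

/-- Together with the next lemma, this makes `|1 - ρ w|` comparable to `|1 - w| + (1 - ρ)`, so the
kernels at a point of radius `ρ` see the quasidistance truncated at `1 - ρ`. -/
lemma norm_one_sub_real_mul_ge {ρ : ℝ} (h0 : 0 ≤ ρ) (h1 : ρ ≤ 1) {w : ℂ} (hw : ‖w‖ ≤ 1) :
    ‖1 - w‖ ≤ 2 * ‖1 - ρ * w‖ ∧ 1 - ρ ≤ ‖1 - ρ * w‖ := by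
  have hn : ‖(ρ : ℂ) * w‖ ≤ ρ := by
    rw [norm_mul, Complex.norm_real, Real.norm_of_nonneg h0]
    exact mul_le_of_le_one_right h0 hw
  have h2 : 1 - ρ ≤ ‖1 - ρ * w‖ := by
    have := norm_sub_norm_le (1 : ℂ) (ρ * w)
    simp only [norm_one] at this; linarith
  refine ⟨?_, h2⟩
  have e : 1 - w = (1 - ρ * w) - ((1 - ρ : ℝ) : ℂ) * w := by push_cast; ring
  rw [e]
  refine (norm_sub_le _ _).trans ?_
  rw [norm_mul ((1 - ρ : ℝ) : ℂ), Complex.norm_real, Real.norm_of_nonneg (by linarith)]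
  nlinarith

lemma norm_one_sub_real_mul_le {ρ : ℝ} (h1 : ρ ≤ 1) {w : ℂ} (hw : ‖w‖ ≤ 1) :
    ‖1 - ρ * w‖ ≤ ‖1 - w‖ + (1 - ρ) := by
  have e : 1 - ρ * w = (1 - w) + ((1 - ρ : ℝ) : ℂ) * w := by push_cast; ring
  rw [e]
  refine (norm_add_le _ _).trans ?_
  rw [norm_mul ((1 - ρ : ℝ) : ℂ), Complex.norm_real, Real.norm_of_nonneg (by linarith)]
  nlinarith

/-! ### Unitary maps acting on the sphere -/

/-- A linear isometry of `ℂⁿ` acts on the unit sphere. -/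
def sphMap (e : Cn n ≃ₗᵢ[ℂ] Cn n) (z : Sph n) : Sph n :=
  ⟨e z, by simp⟩

@[simp] lemma coe_sphMap (e : Cn n ≃ₗᵢ[ℂ] Cn n) (z : Sph n) : (sphMap e z : Cn n) = e z := rfl

lemma continuous_sphMap (e : Cn n ≃ₗᵢ[ℂ] Cn n) : Continuous (sphMap e) :=
  Continuous.subtype_mk (e.continuous.comp continuous_subtype_val) _

/-- A complex linear isometry, regarded as a real one. -/
def realIsometry (e : Cn n ≃ₗᵢ[ℂ] Cn n) : Cn n ≃ₗᵢ[ℝ] Cn n where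
  toLinearEquiv := e.toLinearEquiv.restrictScalars ℝ
  norm_map' := e.norm_map

/-- Up to a constant, the surface measure of a set is the volume of the cone over it; a linear
isometry carries cones to cones and preserves volume. -/
lemma measurePreserving_sphMap (e : Cn n ≃ₗᵢ[ℂ] Cn n) :
    MeasurePreserving (sphMap e) (sigma n) (sigma n) := by
  have hm := (continuous_sphMap e).measurable
  refine ⟨hm, ?_⟩
  unfold sigma
  rw [Measure.map_smul]
  congr 1
  ext s hs
  rw [Measure.map_apply hm hs, Measure.toSphere_apply' _ (hm hs), Measure.toSphere_apply' _ hs]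
  congr 1
  have hp := (realIsometry e).measurePreserving
  have hemb : MeasurableEmbedding (realIsometry e) :=
    (realIsometry e).toHomeomorph.measurableEmbedding
  conv_rhs => rw [← hp.measure_preimage_emb hemb]
  congr 1
  ext x
  simp only [Set.mem_smul, Set.mem_image, Set.mem_preimage, Subtype.exists]
  constructor
  · rintro ⟨r, hr, _, ⟨y, hy, hys, rfl⟩, rfl⟩
    refine ⟨r, hr, e y, ⟨e y, by simpa using hy, hys, rfl⟩, ?_⟩
    exact ((realIsometry e).map_smul r y).symm
  · rintro ⟨r, hr, _, ⟨y, hy, hys, rfl⟩, h⟩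
    have hy' : e.symm y ∈ Metric.sphere (0 : Cn n) 1 := by simpa using hy
    refine ⟨r, hr, e.symm y, ⟨e.symm y, hy', ?_, rfl⟩, ?_⟩
    · change sphMap e ⟨e.symm y, hy'⟩ ∈ s
      convert hys
      simp [sphMap]
    · apply (realIsometry e).injective
      rw [← h, (realIsometry e).map_smul]
      congr 1
      exact e.apply_symm_apply y

lemma integral_sphMap {E : Type*} [NormedAddCommGroup E] [NormedSpace ℝ E]
    (e : Cn n ≃ₗᵢ[ℂ] Cn n) (F : Sph n → E) :
    ∫ z, F (sphMap e z) ∂(sigma n) = ∫ z, F z ∂(sigma n) := by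
  have hinj : Function.Injective (sphMap e) := by
    intro x y h
    exact Subtype.ext (e.injective (congrArg Subtype.val h))
  have hce : IsClosedEmbedding (sphMap e) :=
    (continuous_sphMap e).isClosedEmbedding hinj
  exact (measurePreserving_sphMap e).integral_comp hce.measurableEmbedding F

lemma exists_isometry_one [NeZero n] (ζ : Sph n) :
    ∃ e : Cn n ≃ₗᵢ[ℂ] Cn n, e (one n) = ζ := by
  have ho : Orthonormal ℂ (({(0 : Fin n)} : Set (Fin n)).domRestrict fun _ => (ζ : Cn n)) := by
    constructor
    · intro i; exact norm_sph ζ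
    · intro i j hij
      exact absurd (Subsingleton.elim i j) hij
  obtain ⟨b, hb⟩ := ho.exists_orthonormalBasis_extension_of_card_eq (by simp)
  refine ⟨b.repr.symm, ?_⟩
  have := hb 0 rfl
  simp [one, this]

/-- The isometry that fixes the unit vector `v` and multiplies its orthogonal complement by `c`. -/
def phaseIsometry (v : Cn n) (hv : ‖v‖ = 1) (c : ℂ) (hc : ‖c‖ = 1) : Cn n ≃ₗᵢ[ℂ] Cn n :=
  LinearIsometry.toLinearIsometryEquiv
    (E₁ := Cn n) (F := Cn n) (R₁ := ℂ)
    { toFun := fun x => inner ℂ v x • v + c • (x - inner ℂ v x • v)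
      map_add' := by intro x y; simp only [inner_add_right]; module
      map_smul' := by intro a x; simp only [inner_smul_right, RingHom.id_apply]; module
      norm_map' := by
        intro x
        have hvv : inner ℂ v v = 1 := by rw [inner_self_eq_norm_sq_to_K, hv]; simp
        have h0 : inner ℂ (inner ℂ v x • v) (x - inner ℂ v x • v) = 0 := by
          rw [inner_smul_left, inner_sub_right, inner_smul_right, hvv, mul_one, sub_self, mul_zero]
        have h1 := norm_add_sq_eq_norm_sq_add_norm_sq_of_inner_eq_zero (𝕜 := ℂ)
          (inner ℂ v x • v) (c • (x - inner ℂ v x • v)) (by rw [inner_smul_right, h0, mul_zero])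
        have h2 := norm_add_sq_eq_norm_sq_add_norm_sq_of_inner_eq_zero (𝕜 := ℂ)
          (inner ℂ v x • v) (x - inner ℂ v x • v) h0
        rw [norm_smul c, hc, one_mul] at h1
        rw [← h2, add_sub_cancel] at h1
        exact (mul_self_inj (norm_nonneg _) (norm_nonneg _)).mp h1 } rfl

lemma phaseIsometry_apply (v : Cn n) (hv : ‖v‖ = 1) (c : ℂ) (hc : ‖c‖ = 1) (x : Cn n) :
    phaseIsometry v hv c hc x = inner ℂ v x • v + c • (x - inner ℂ v x • v) := rfl

lemma inner_phaseIsometry (v : Cn n) (hv : ‖v‖ = 1) (c : ℂ) (hc : ‖c‖ = 1) (x : Cn n) :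
    inner ℂ v (phaseIsometry v hv c hc x) = inner ℂ v x := by
  have hvv : inner ℂ v v = 1 := by rw [inner_self_eq_norm_sq_to_K, hv]; simp
  rw [phaseIsometry_apply, inner_add_right, inner_smul_right, inner_smul_right, inner_sub_right,
    inner_smul_right, hvv]
  ring

/-- Multiplication by a unimodular scalar. -/
def scalarIsometry (c : ℂ) (hc : ‖c‖ = 1) : Cn n ≃ₗᵢ[ℂ] Cn n :=
  LinearIsometry.toLinearIsometryEquiv
    (E₁ := Cn n) (F := Cn n) (R₁ := ℂ)
    { toLinearMap := c • LinearMap.id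
      norm_map' := by intro x; simp [norm_smul, hc] } rfl

lemma scalarIsometry_apply (c : ℂ) (hc : ‖c‖ = 1) (x : Cn n) :
    scalarIsometry c hc x = c • x := rfl

lemma Continuous.integrable_sphere {E : Type*} [NormedAddCommGroup E] [NeZero n] {F : Sph n → E}
    (hF : Continuous F) : Integrable F (sigma n) := by
  rw [← integrableOn_univ]
  exact hF.continuousOn.integrableOn_compact isCompact_univ

/-! ### Moments of the coordinate functions -/

/-- A rotation by such a `c` turns an integral of mixed degree `(i, l)` into its own negative, so
the integral vanishes. -/
lemma exists_unit_pow_mul_conj_pow_eq_neg_one {i l : ℕ} (h : i ≠ l) :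
    ∃ c : ℂ, ‖c‖ = 1 ∧ c ^ i * (starRingEnd ℂ c) ^ l = -1 := by
  have h' : (i : ℝ) - l ≠ 0 := sub_ne_zero.mpr (by exact_mod_cast h)
  set θ : ℝ := Real.pi / ((i : ℝ) - l) with hθ
  refine ⟨Complex.exp (θ * Complex.I), Complex.norm_exp_ofReal_mul_I θ, ?_⟩
  rw [← Complex.exp_conj, ← Complex.exp_nat_mul, ← Complex.exp_nat_mul, ← Complex.exp_add,
    ← Complex.exp_pi_mul_I]
  congr 1
  simp only [map_mul, Complex.conj_ofReal, Complex.conj_I]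
  have : (Real.pi : ℂ) = ((i : ℂ) - l) * θ := by
    rw [hθ]; push_cast; field_simp [show (i : ℂ) - l ≠ 0 by exact_mod_cast h']
  rw [this]; ring

/-- The moments `∫ |ξ₁|²ᵏ dσ`. -/
def moment (n : ℕ) [NeZero n] (k : ℕ) : ℝ :=
  ∫ ξ : Sph n, ‖inner ℂ (one n : Cn n) (ξ : Cn n)‖ ^ (2 * k) ∂(sigma n)

lemma integral_norm_inner_pow [NeZero n] (ζ : Sph n) (k : ℕ) :
    ∫ ξ : Sph n, ‖inner ℂ (ζ : Cn n) (ξ : Cn n)‖ ^ (2 * k) ∂(sigma n) = moment n k := by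
  obtain ⟨e, he⟩ := exists_isometry_one ζ
  rw [moment, ← integral_sphMap e]
  simp only [coe_sphMap, ← he, LinearIsometryEquiv.inner_map_map]

lemma integral_norm_inner_pow_smul [NeZero n] (a : Cn n) (k : ℕ) :
    ∫ ξ : Sph n, ‖inner ℂ a (ξ : Cn n)‖ ^ (2 * k) ∂(sigma n) = ‖a‖ ^ (2 * k) * moment n k := by
  by_cases ha : a = 0
  · subst ha
    rcases Nat.eq_zero_or_pos k with rfl | hk
    · simp [moment]
    · simp [hk.ne']
  · have hn : ‖a‖ ≠ 0 := norm_ne_zero_iff.mpr ha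
    have hu : ((‖a‖ : ℂ)⁻¹ • a) ∈ Metric.sphere (0 : Cn n) 1 := by
      simp [norm_smul, hn]
    rw [← integral_norm_inner_pow ⟨_, hu⟩ k, ← integral_const_mul]
    congr 1
    ext ξ
    simp only [inner_smul_left, norm_mul, mul_pow]
    simp
    field_simp

/-- Monomials in two orthogonal coordinates with different exponents are orthogonal. -/
lemma integral_mixed_eq_zero [NeZero n] (j : Fin n) (hj : j ≠ 0) (a b i l : ℕ) (h : i ≠ l) :
    ∫ ξ : Sph n, ((ξ : Cn n) 0 ^ a * (ξ : Cn n) j ^ i) *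
      (starRingEnd ℂ ((ξ : Cn n) 0 ^ b * (ξ : Cn n) j ^ l)) ∂(sigma n) = 0 := by
  obtain ⟨c, hc, hcc⟩ := exists_unit_pow_mul_conj_pow_eq_neg_one h
  set e := phaseIsometry (one n : Cn n) (norm_sph _) c hc
  have h0 : ∀ x : Cn n, e x 0 = x 0 := by
    intro x; simp [e, phaseIsometry_apply, one, EuclideanSpace.inner_single_left]
  have h1 : ∀ x : Cn n, e x j = c * x j := by
    intro x; simp [e, phaseIsometry_apply, one, EuclideanSpace.inner_single_left, hj]
  set I := ∫ ξ : Sph n, ((ξ : Cn n) 0 ^ a * (ξ : Cn n) j ^ i) *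
      (starRingEnd ℂ ((ξ : Cn n) 0 ^ b * (ξ : Cn n) j ^ l)) ∂(sigma n) with hI
  have h2 : I = -I := by
    conv_lhs => rw [hI, ← integral_sphMap e]
    rw [hI, ← integral_neg]
    congr 1
    ext ξ
    simp only [coe_sphMap, h0, h1, map_mul, map_pow]
    linear_combination ((ξ : Cn n) 0 ^ a * (ξ : Cn n) j ^ i * (starRingEnd ℂ ((ξ : Cn n) 0)) ^ b
      * (starRingEnd ℂ ((ξ : Cn n) j)) ^ l) * hcc
  exact self_eq_neg.mp h2

lemma inner_one [NeZero n] (x : Cn n) : inner ℂ (one n : Cn n) x = x 0 := by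
  simp [one, EuclideanSpace.inner_single_left]

lemma moment_eq [NeZero n] (k : ℕ) :
    moment n k = ∫ ξ : Sph n, ‖(ξ : Cn n) 0‖ ^ (2 * k) ∂(sigma n) := by
  simp only [moment, inner_one]

/-- For `a = e₀ + t eⱼ`, invariance gives `∫ |⟨ξ,a⟩| ^ (2k+2) = (1 + t²) ^ (k+1) · moment n (k+1)`.
Expanding the left side, only the diagonal terms survive, so both sides are polynomials in `t²`. The
linear coefficients in `t²` give the identity. -/
lemma mixed_moment [NeZero n] (j : Fin n) (hj : j ≠ 0) (k : ℕ) :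
    (k + 1) * ∫ ξ : Sph n, ‖(ξ : Cn n) 0‖ ^ (2 * k) * ‖(ξ : Cn n) j‖ ^ 2 ∂(sigma n)
      = moment n (k + 1) := by
  set M : ℕ → ℂ := fun i => ∫ ξ : Sph n, ((ξ : Cn n) 0 ^ (k + 1 - i) * (ξ : Cn n) j ^ i) *
      (starRingEnd ℂ ((ξ : Cn n) 0 ^ (k + 1 - i) * (ξ : Cn n) j ^ i)) ∂(sigma n) with hM
  have key : ∀ t : ℝ, ∑ i ∈ Finset.range (k + 2), ((k + 1).choose i : ℂ) ^ 2 * M i * (t : ℂ) ^ (2 * i)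
      = (1 + (t : ℂ) ^ 2) ^ (k + 1) * moment n (k + 1) := by
    intro t
    set a : Cn n := EuclideanSpace.single 0 1 + (t : ℂ) • EuclideanSpace.single j 1 with ha
    have hin : ∀ ξ : Cn n, inner ℂ a ξ = t * ξ j + ξ 0 := by
      intro ξ
      simp [ha, EuclideanSpace.inner_single_left, add_comm]
    have hna : ‖a‖ ^ 2 = 1 + t ^ 2 := by
      have h1 := norm_add_sq_eq_norm_sq_add_norm_sq_of_inner_eq_zero (𝕜 := ℂ)
          (EuclideanSpace.single (0 : Fin n) (1 : ℂ)) ((t : ℂ) • EuclideanSpace.single j 1)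
          (by simp [EuclideanSpace.inner_single_left, hj.symm])
      rw [← ha, norm_smul] at h1
      simp at h1
      rw [sq, h1]; ring
    have h1 := integral_norm_inner_pow_smul a (k + 1)
    have h2 : ∫ ξ : Sph n, (inner ℂ a (ξ : Cn n)) ^ (k + 1) *
        starRingEnd ℂ ((inner ℂ a (ξ : Cn n)) ^ (k + 1)) ∂(sigma n)
        = (1 + (t : ℂ) ^ 2) ^ (k + 1) * moment n (k + 1) := by
      have : ∀ ξ : Sph n, (inner ℂ a (ξ : Cn n)) ^ (k + 1) *
        starRingEnd ℂ ((inner ℂ a (ξ : Cn n)) ^ (k + 1)) =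
          ((‖inner ℂ a (ξ : Cn n)‖ ^ (2 * (k + 1)) : ℝ) : ℂ) := by
        intro ξ
        rw [Complex.mul_conj, Complex.normSq_eq_norm_sq, norm_pow]; push_cast; ring
      simp_rw [this]
      rw [integral_complex_ofReal, h1, pow_mul, hna]
      push_cast; ring
    rw [← h2]
    have h3 : ∀ ξ : Sph n, (inner ℂ a (ξ : Cn n)) ^ (k + 1) *
        starRingEnd ℂ ((inner ℂ a (ξ : Cn n)) ^ (k + 1)) =
        ∑ i ∈ Finset.range (k + 2), ∑ l ∈ Finset.range (k + 2),
          ((k + 1).choose i * (k + 1).choose l * (t : ℂ) ^ (i + l)) *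
          (((ξ : Cn n) 0 ^ (k + 1 - i) * (ξ : Cn n) j ^ i) *
      (starRingEnd ℂ ((ξ : Cn n) 0 ^ (k + 1 - l) * (ξ : Cn n) j ^ l))) := by
      intro ξ
      rw [hin, add_pow, map_sum, Finset.sum_mul_sum]
      refine Finset.sum_congr rfl fun i _ => Finset.sum_congr rfl fun l _ => ?_
      simp only [map_mul, map_pow, Complex.conj_ofReal, map_natCast]
      ring
    simp_rw [h3]
    have hint : ∀ i l : ℕ, Integrable (fun ξ : Sph n =>
        ((k + 1).choose i * (k + 1).choose l * (t : ℂ) ^ (i + l)) *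
          (((ξ : Cn n) 0 ^ (k + 1 - i) * (ξ : Cn n) j ^ i) *
      (starRingEnd ℂ ((ξ : Cn n) 0 ^ (k + 1 - l) * (ξ : Cn n) j ^ l)))) (sigma n) := by
      intro i l
      apply Continuous.integrable_sphere
      fun_prop
    rw [integral_finsetSum _ fun i _ => integrable_finsetSum _ fun l _ => hint i l]
    refine Finset.sum_congr rfl fun i hi => ?_
    rw [integral_finsetSum _ fun l _ => hint i l, Finset.sum_eq_single i]
    · rw [integral_const_mul]; ring
    · intro l _ hl
      rw [integral_const_mul, integral_mixed_eq_zero j hj _ _ _ _ (Ne.symm hl), mul_zero]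
    · intro h; exact absurd hi h
  set p : Polynomial ℂ := ∑ i ∈ Finset.range (k + 2),
    Polynomial.C (((k + 1).choose i : ℂ) ^ 2 * M i) * Polynomial.X ^ i with hp
  set q : Polynomial ℂ := (1 + Polynomial.X) ^ (k + 1) * Polynomial.C (moment n (k + 1) : ℂ) with hq
  have hpq : p = q := by
    apply Polynomial.eq_of_infinite_eval_eq
    -- The variable of the polynomials is `t²`, so agreement is checked at the squares of the
    -- natural numbers.
    apply Set.Infinite.mono (s := Set.range fun m : ℕ => ((m : ℂ) ^ 2))
    · rintro _ ⟨m, rfl⟩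
      have := key m
      simp only [Set.mem_ofPred_eq, hp, hq, Polynomial.eval_finsetSum, Polynomial.eval_mul,
        Polynomial.eval_pow, Polynomial.eval_add, Polynomial.eval_C, Polynomial.eval_X,
        Polynomial.eval_one]
      simp only [pow_mul] at this
      exact_mod_cast this
    · apply Set.infinite_range_of_injective
      intro x y hxy
      have hxy' : (x : ℂ) ^ 2 = (y : ℂ) ^ 2 := hxy
      have : x ^ 2 = y ^ 2 := by exact_mod_cast hxy'
      exact Nat.pow_left_injective (n := 2) (by norm_num) this
  have hc := congrArg (fun r => Polynomial.coeff r 1) hpq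
  simp only [hp, hq, Polynomial.finsetSum_coeff, Polynomial.coeff_C_mul, Polynomial.coeff_X_pow,
    Polynomial.coeff_mul_C, Polynomial.coeff_one_add_X_pow] at hc
  simp only [mul_ite, mul_one, mul_zero] at hc
  rw [Finset.sum_ite_eq (Finset.range (k + 2)) 1] at hc
  simp only [Finset.mem_range, show 1 < k + 2 by omega, if_true, Nat.choose_one_right] at hc
  have hM1 : M 1 = ((∫ ξ : Sph n, ‖(ξ : Cn n) 0‖ ^ (2 * k) * ‖(ξ : Cn n) j‖ ^ 2 ∂(sigma n) : ℝ) : ℂ) := by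
    rw [hM, ← integral_complex_ofReal]
    refine integral_congr_ae (Eventually.of_forall fun ξ => ?_)
    simp only
    rw [Complex.mul_conj, Complex.normSq_eq_norm_sq, norm_mul, norm_pow, norm_pow]
    simp only [Nat.add_sub_cancel]
    push_cast; ring
  rw [hM1] at hc
  have hk : ((k : ℝ) + 1) ≠ 0 := by positivity
  have hc' : ((k : ℝ) + 1) ^ 2 * ∫ ξ : Sph n, ‖(ξ : Cn n) 0‖ ^ (2 * k) * ‖(ξ : Cn n) j‖ ^ 2 ∂(sigma n)
      = (k + 1) * moment n (k + 1) := by exact_mod_cast hc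
  apply mul_left_cancel₀ hk
  linear_combination hc'

/-- Insert `∑ |ξⱼ|² = 1` into the moment of order `k`: the term `j = 0` is the next moment, and each
of the other `n - 1` terms is the next moment divided by `k + 1`. -/
lemma moment_succ [NeZero n] (k : ℕ) :
    moment n k * (k + 1) = moment n (k + 1) * (k + n) := by
  have h1 : moment n k = ∑ j : Fin n,
      ∫ ξ : Sph n, ‖(ξ : Cn n) 0‖ ^ (2 * k) * ‖(ξ : Cn n) j‖ ^ 2 ∂(sigma n) := by
    rw [← integral_finsetSum _ fun j _ => by apply Continuous.integrable_sphere; fun_prop, moment_eq]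
    congr 1
    ext ξ
    rw [← Finset.mul_sum, ← EuclideanSpace.norm_sq_eq, norm_sph]; simp
  have h2 : ∀ j ∈ Finset.univ.erase (0 : Fin n),
      ∫ ξ : Sph n, ‖(ξ : Cn n) 0‖ ^ (2 * k) * ‖(ξ : Cn n) j‖ ^ 2 ∂(sigma n)
        = moment n (k + 1) / (k + 1) := by
    intro j hj
    rw [← mixed_moment j (Finset.ne_of_mem_erase hj) k]
    field_simp
  have h3 : ∫ ξ : Sph n, ‖(ξ : Cn n) 0‖ ^ (2 * k) * ‖(ξ : Cn n) 0‖ ^ 2 ∂(sigma n)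
      = moment n (k + 1) := by
    rw [moment_eq]; congr 1; ext ξ; ring
  rw [← Finset.add_sum_erase _ _ (Finset.mem_univ (0 : Fin n)), Finset.sum_congr rfl h2, h3,
    Finset.sum_const, Finset.card_erase_of_mem (Finset.mem_univ _), Finset.card_univ,
    Fintype.card_fin, nsmul_eq_mul, Nat.cast_sub (NeZero.one_le)] at h1
  rw [h1]
  push_cast
  field_simp
  ring

lemma moment_zero [NeZero n] : moment n 0 = 1 := by simp [moment]

/-- The binomial here is the `k`-th Taylor coefficient of `(1 - x)⁻ⁿ`. This cancellation is what
makes the Cauchy kernel reproducing. -/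
lemma moment_mul_choose [NeZero n] (k : ℕ) : moment n k * (n - 1 + k).choose k = 1 := by
  have hn : 1 ≤ n := NeZero.one_le
  induction k with
  | zero => simp [moment_zero]
  | succ k ih =>
    have h1 := moment_succ (n := n) k
    have h2 : ((n - 1 + (k + 1)).choose (k + 1) : ℝ) * (k + 1)
        = (k + n) * (n - 1 + k).choose k := by
      have := Nat.add_one_mul_choose_eq (n - 1 + k) k
      have h3 : n - 1 + k + 1 = k + n := by omega
      rw [h3] at this
      rw [show n - 1 + (k + 1) = k + n by omega]
      exact_mod_cast this.symm
    have hk : ((k : ℝ) + 1) ≠ 0 := by positivity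
    apply mul_right_cancel₀ hk
    calc moment n (k + 1) * ((n - 1 + (k + 1)).choose (k + 1) : ℝ) * (k + 1)
        = moment n (k + 1) * (((n - 1 + (k + 1)).choose (k + 1) : ℝ) * (k + 1)) := by ring
      _ = (moment n (k + 1) * (k + n)) * (n - 1 + k).choose k := by rw [h2]; ring
      _ = (moment n k * (n - 1 + k).choose k) * (k + 1) := by rw [← h1]; ring
      _ = 1 * (k + 1) := by rw [ih]

/-! ### The reproducing property of the Cauchy kernel -/

lemma norm_inner_lt_one {z : Cn n} (hz : ‖z‖ < 1) (ξ : Sph n) : ‖inner ℂ (ξ : Cn n) z‖ < 1 := by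
  have := norm_inner_le_norm (𝕜 := ℂ) (ξ : Cn n) z
  rw [norm_sph, one_mul] at this
  exact this.trans_lt hz

lemma one_sub_inner_ne_zero {z : Cn n} (hz : ‖z‖ < 1) (ξ : Sph n) :
    1 - inner ℂ (ξ : Cn n) z ≠ 0 := by
  intro h
  have := norm_inner_lt_one hz ξ
  rw [← sub_eq_zero.mp h] at this
  simp at this

lemma continuous_cauchyKernel {z : Cn n} (hz : ‖z‖ < 1) :
    Continuous fun ξ : Sph n => cauchyKernel z (ξ : Cn n) := by
  unfold cauchyKernel
  refine Continuous.inv₀ (by fun_prop) fun ξ => pow_ne_zero _ (one_sub_inner_ne_zero hz ξ)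

lemma exists_eq_smul_sph [NeZero n] (z : Cn n) : ∃ ζ : Sph n, z = ((‖z‖ : ℝ) : ℂ) • (ζ : Cn n) := by
  by_cases h : z = 0
  · exact ⟨one n, by simp [h]⟩
  · have hn : ‖z‖ ≠ 0 := norm_ne_zero_iff.mpr h
    refine ⟨⟨((‖z‖ : ℝ) : ℂ)⁻¹ • z, by simp [norm_smul, hn]⟩, ?_⟩
    rw [smul_smul, mul_inv_cancel₀ (by exact_mod_cast hn), one_smul]

lemma integral_inner_pow_mul_conj [NeZero n] (ζ : Sph n) (k j : ℕ) :
    ∫ ξ : Sph n, inner ℂ (ζ : Cn n) (ξ : Cn n) ^ k *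
      (starRingEnd ℂ (inner ℂ (ζ : Cn n) (ξ : Cn n))) ^ j ∂(sigma n)
      = if k = j then (moment n k : ℂ) else 0 := by
  split_ifs with h
  · subst h
    rw [← integral_norm_inner_pow ζ, ← integral_complex_ofReal]
    refine integral_congr_ae (Eventually.of_forall fun ξ => ?_)
    simp only
    rw [← mul_pow, Complex.mul_conj, Complex.normSq_eq_norm_sq]; push_cast; ring
  · obtain ⟨c, hc, hcc⟩ := exists_unit_pow_mul_conj_pow_eq_neg_one h
    set I := ∫ ξ : Sph n, inner ℂ (ζ : Cn n) (ξ : Cn n) ^ k *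
      (starRingEnd ℂ (inner ℂ (ζ : Cn n) (ξ : Cn n))) ^ j ∂(sigma n) with hI
    have h2 : I = -I := by
      conv_lhs => rw [hI, ← integral_sphMap (scalarIsometry c hc)]
      rw [hI, ← integral_neg]
      congr 1
      ext ξ
      simp only [coe_sphMap, scalarIsometry_apply, inner_smul_right, map_mul]
      linear_combination (inner ℂ (ζ : Cn n) (ξ : Cn n) ^ k *
        (starRingEnd ℂ (inner ℂ (ζ : Cn n) (ξ : Cn n))) ^ j) * hcc
    exact self_eq_neg.mp h2

lemma exists_hasSum_pow {h : ℂ → ℂ} {R : ℝ} (hR : 1 < R)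
    (hh : DifferentiableOn ℂ h (Metric.ball 0 R)) :
    ∃ a : ℕ → ℂ, (Summable fun k => ‖a k‖) ∧
      ∀ w : ℂ, ‖w‖ ≤ 1 → HasSum (fun k => a k * w ^ k) (h w) := by
  refine ⟨fun k => ((k.factorial : ℂ))⁻¹ * iteratedDeriv k h 0, ?_, ?_⟩
  · have := (Complex.hasSum_taylorSeries_on_ball hh (z := 1) (by simpa using hR)).summable.norm
    simpa using this
  · intro w hw
    have := Complex.hasSum_taylorSeries_on_ball hh (z := w) (by simpa using hw.trans_lt hR)
    have e : (fun k : ℕ => ((k.factorial : ℂ))⁻¹ * iteratedDeriv k h 0 * w ^ k)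
        = fun k : ℕ => ((k.factorial : ℂ))⁻¹ • (w - 0) ^ k • iteratedDeriv k h 0 := by
      funext k
      simp only [smul_eq_mul, sub_zero]; ring
    rw [e]; exact this

lemma hasSum_inv_one_sub_pow [NeZero n] {x : ℂ} (hx : ‖x‖ < 1) :
    HasSum (fun j => (((n - 1 + j).choose j : ℕ) : ℂ) * x ^ j) (((1 - x) ^ n)⁻¹) := by
  have := hasSum_choose_mul_geometric_of_norm_lt_one (n - 1) hx
  rw [Nat.sub_add_cancel NeZero.one_le, one_div] at this
  have e : (fun j => (((n - 1 + j).choose j : ℕ) : ℂ) * x ^ j)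
      = fun j => (((j + (n - 1)).choose (n - 1) : ℕ) : ℂ) * x ^ j := by
    funext j
    rw [add_comm (n - 1) j, Nat.choose_symm_add]
  rw [e]; exact this

/-- With `w = ⟨ξ,ζ⟩`, `h` is a power series in `w` and the kernel is one in the conjugate of `w`.
Integrating the absolutely convergent double series leaves only the diagonal, where each moment
cancels the binomial coefficient of the kernel. -/
lemma szego_one_variable [NeZero n] (ζ : Sph n) {h : ℂ → ℂ} {R : ℝ} (hR : 1 < R)
    (hh : DifferentiableOn ℂ h (Metric.ball 0 R)) {ρ : ℝ} (h0 : 0 ≤ ρ) (h1 : ρ < 1) :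
    ∫ ξ : Sph n, h (inner ℂ (ζ : Cn n) (ξ : Cn n)) *
      cauchyKernel ((ρ : ℂ) • (ζ : Cn n)) (ξ : Cn n) ∂(sigma n) = h ρ := by
  obtain ⟨a, hasum, hsum⟩ := exists_hasSum_pow hR hh
  obtain ⟨b, hb⟩ : ∃ b : ℕ → ℂ, b = fun j => (((n - 1 + j).choose j : ℕ) : ℂ) * (ρ : ℂ) ^ j :=
    ⟨_, rfl⟩
  have hbsum : Summable fun j => ‖b j‖ := by
    rw [hb]
    exact (hasSum_inv_one_sub_pow (n := n) (x := ρ)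
      (by rwa [Complex.norm_real, Real.norm_of_nonneg h0])).summable.norm
  obtain ⟨w, hw⟩ : ∃ w : Sph n → ℂ, w = fun ξ : Sph n => inner ℂ (ζ : Cn n) (ξ : Cn n) := ⟨_, rfl⟩
  have hwc : Continuous w := by rw [hw]; fun_prop
  have hw1 : ∀ ξ, ‖w ξ‖ ≤ 1 := fun ξ => by rw [hw]; exact norm_inner_sph_le ξ ζ
  have hker : ∀ ξ : Sph n, HasSum (fun j => b j * (starRingEnd ℂ (w ξ)) ^ j)
      (cauchyKernel ((ρ : ℂ) • (ζ : Cn n)) (ξ : Cn n)) := by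
    intro ξ
    have hx : ‖(ρ : ℂ) * starRingEnd ℂ (w ξ)‖ < 1 := by
      rw [norm_mul, Complex.norm_real, Real.norm_of_nonneg h0, RCLike.norm_conj]
      nlinarith [norm_nonneg (w ξ), hw1 ξ]
    have := hasSum_inv_one_sub_pow (n := n) hx
    unfold cauchyKernel
    rw [inner_smul_right, ← inner_conj_symm]
    rw [hw] at this ⊢
    rw [hb]
    simpa only [mul_pow, mul_assoc] using this
  have hnorm : ∀ (q : ℕ × ℕ) ξ, ‖(a q.1 * w ξ ^ q.1) * (b q.2 * (starRingEnd ℂ (w ξ)) ^ q.2)‖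
      ≤ ‖a q.1‖ * ‖b q.2‖ := by
    intro q ξ
    have h2 : ∀ k : ℕ, ‖w ξ‖ ^ k ≤ 1 := fun k => pow_le_one₀ (norm_nonneg _) (hw1 ξ)
    simp only [norm_mul, norm_pow, RCLike.norm_conj]
    have := mul_le_mul (mul_le_mul_of_nonneg_left (h2 q.1) (norm_nonneg (a q.1)))
      (mul_le_mul_of_nonneg_left (h2 q.2) (norm_nonneg (b q.2))) (by positivity) (by positivity)
    simpa using this
  have hab : Summable fun q : ℕ × ℕ => ‖a q.1‖ * ‖b q.2‖ :=
    Summable.mul_of_nonneg hasum hbsum (fun _ => norm_nonneg _) (fun _ => norm_nonneg _)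
  have e1 : ∀ ξ, ∑' q : ℕ × ℕ, (a q.1 * w ξ ^ q.1) * (b q.2 * (starRingEnd ℂ (w ξ)) ^ q.2)
      = h (w ξ) * cauchyKernel ((ρ : ℂ) • (ζ : Cn n)) (ξ : Cn n) := by
    intro ξ
    have hS : Summable fun q : ℕ × ℕ => (a q.1 * w ξ ^ q.1) * (b q.2 * (starRingEnd ℂ (w ξ)) ^ q.2) :=
      Summable.of_norm_bounded hab fun q => hnorm q ξ
    rw [← (hsum _ (hw1 ξ)).tsum_eq, ← (hker ξ).tsum_eq]
    exact ((hsum _ (hw1 ξ)).summable.tsum_mul_tsum (hker ξ).summable hS).symm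
  have hGint : ∀ q : ℕ × ℕ, Integrable
      (fun ξ => (a q.1 * w ξ ^ q.1) * (b q.2 * (starRingEnd ℂ (w ξ)) ^ q.2)) (sigma n) := by
    intro q; apply Continuous.integrable_sphere; fun_prop
  have key := hasSum_integral_of_summable_integral_norm hGint (by
    refine Summable.of_nonneg_of_le (fun q => integral_nonneg fun _ => norm_nonneg _) (fun q => ?_) hab
    have := integral_mono (hGint q).norm (integrable_const (‖a q.1‖ * ‖b q.2‖)) (hnorm q)
    simpa using this)
  simp only [e1] at key
  have e2 : ∀ q : ℕ × ℕ, ∫ ξ, (a q.1 * w ξ ^ q.1) * (b q.2 * (starRingEnd ℂ (w ξ)) ^ q.2) ∂(sigma n)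
      = if q.1 = q.2 then a q.1 * (ρ : ℂ) ^ q.1 else 0 := by
    intro q
    have : ∀ ξ, (a q.1 * w ξ ^ q.1) * (b q.2 * (starRingEnd ℂ (w ξ)) ^ q.2)
        = (a q.1 * b q.2) * (w ξ ^ q.1 * (starRingEnd ℂ (w ξ)) ^ q.2) := fun ξ => by ring
    simp only [this]
    rw [integral_const_mul, hw, integral_inner_pow_mul_conj]
    split_ifs with hq
    · rw [← hq]
      have := moment_mul_choose (n := n) q.1
      have hm : (moment n q.1 : ℂ) * ((n - 1 + q.1).choose q.1 : ℕ) = 1 := by exact_mod_cast this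
      rw [hb]
      linear_combination (a q.1 * (ρ : ℂ) ^ q.1) * hm
    · simp
  simp only [e2] at key
  have hdiag : Function.Injective fun k : ℕ => (k, k) := fun x y hxy => (Prod.mk.inj hxy).1
  rw [← hdiag.hasSum_iff] at key
  · have h3 := hsum ρ (by rw [Complex.norm_real, Real.norm_of_nonneg h0]; exact h1.le)
    rw [hw] at key
    refine HasSum.unique key ?_
    have e3 : ((fun q : ℕ × ℕ => if q.1 = q.2 then a q.1 * (ρ : ℂ) ^ q.1 else 0) ∘ fun k : ℕ => (k, k))
        = fun k => a k * (ρ : ℂ) ^ k := by funext k; simp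
    rw [e3]; exact h3
  · intro q hq
    rw [if_neg]
    intro heq
    exact hq ⟨q.1, by rw [Prod.ext_iff]; exact ⟨rfl, heq⟩⟩

/-- The Cauchy kernel reproduces holomorphic functions. -/
lemma integral_mul_cauchyKernel [NeZero n] {F : Cn n → ℂ} {R : ℝ} (hR : 1 < R)
    (hF : DifferentiableOn ℂ F (Metric.ball 0 R)) {z : Cn n} (hz : ‖z‖ < 1) :
    ∫ ξ : Sph n, F ξ * cauchyKernel z (ξ : Cn n) ∂(sigma n) = F z := by
  obtain ⟨ζ, hζ⟩ := exists_eq_smul_sph z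
  set ρ := ‖z‖ with hρ
  have hs := szego_one_variable ζ (h := fun w => F (w • (ζ : Cn n))) hR
      (by
        refine hF.comp (by fun_prop) ?_
        intro w hw
        simpa [norm_smul] using hw) (norm_nonneg z) hz
  simp only [← hρ, ← hζ] at hs
  rw [← hs]
  set K : Sph n → ℂ := fun ξ => cauchyKernel z (ξ : Cn n) with hK
  have hKc : Continuous K := continuous_cauchyKernel hz
  -- `Φ c` multiplies the component orthogonal to `ζ` by `c`. For `|c| = 1` it preserves the measure
  -- and the kernel. Averaging over the circle then replaces `F` by its value at `c = 0`, by the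
  -- mean value property, and only a function of `⟨ξ,ζ⟩` remains.
  set Φ : ℂ → Sph n → Cn n := fun c ξ => inner ℂ (ζ : Cn n) (ξ : Cn n) • (ζ : Cn n) +
    c • ((ξ : Cn n) - inner ℂ (ζ : Cn n) (ξ : Cn n) • (ζ : Cn n)) with hΦ
  have hrot : ∀ c : ℂ, ‖c‖ = 1 → ∫ ξ, F (Φ c ξ) * K ξ ∂(sigma n) = ∫ ξ : Sph n, F ξ * K ξ ∂(sigma n) := by
    intro c hc
    rw [← integral_sphMap (phaseIsometry (ζ : Cn n) (norm_sph ζ) c hc) (fun ξ : Sph n => F ξ * K ξ)]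
    congr 1
    ext ξ
    have : K (sphMap (phaseIsometry (ζ : Cn n) (norm_sph ζ) c hc) ξ) = K ξ := by
      simp only [hK, cauchyKernel, coe_sphMap]
      rw [hζ, inner_smul_right, inner_smul_right, ← inner_conj_symm, inner_phaseIsometry,
        inner_conj_symm]
    rw [this]; rfl
  have hΦnorm : ∀ (c : ℂ) (ξ : Sph n), ‖Φ c ξ‖ ^ 2 =
      ‖inner ℂ (ζ : Cn n) (ξ : Cn n)‖ ^ 2 + ‖c‖ ^ 2 * (1 - ‖inner ℂ (ζ : Cn n) (ξ : Cn n)‖ ^ 2) := by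
    intro c ξ
    have hvv : inner ℂ (ζ : Cn n) (ζ : Cn n) = 1 := by
      rw [inner_self_eq_norm_sq_to_K, norm_sph]; simp
    set w := inner ℂ (ζ : Cn n) (ξ : Cn n) with hw
    have h0 : inner ℂ (w • (ζ : Cn n)) ((ξ : Cn n) - w • (ζ : Cn n)) = 0 := by
      rw [inner_smul_left, inner_sub_right, inner_smul_right, hvv, mul_one, ← hw, sub_self, mul_zero]
    have h1 := norm_add_sq_eq_norm_sq_add_norm_sq_of_inner_eq_zero (𝕜 := ℂ)
      (w • (ζ : Cn n)) (c • ((ξ : Cn n) - w • (ζ : Cn n))) (by rw [inner_smul_right, h0, mul_zero])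
    have h2 := norm_add_sq_eq_norm_sq_add_norm_sq_of_inner_eq_zero (𝕜 := ℂ)
      (w • (ζ : Cn n)) ((ξ : Cn n) - w • (ζ : Cn n)) h0
    rw [add_sub_cancel, norm_smul, norm_sph, norm_sph] at h2
    rw [norm_smul, norm_smul, norm_sph] at h1
    simp only [hΦ, ← hw]
    rw [sq, h1]
    linear_combination (-‖c‖ ^ 2) * h2
  have hΦle : ∀ (c : ℂ) (ξ : Sph n), ‖c‖ < R → Φ c ξ ∈ Metric.ball (0 : Cn n) R := by
    intro c ξ hc
    rw [mem_ball_zero_iff]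
    apply lt_of_pow_lt_pow_left₀ 2 (by linarith)
    rw [hΦnorm]
    have hw := norm_inner_sph_le ξ ζ
    have hw2 : ‖inner ℂ (ζ : Cn n) (ξ : Cn n)‖ ^ 2 ≤ 1 := pow_le_one₀ (norm_nonneg _) hw
    have hcR : ‖c‖ ^ 2 < R ^ 2 := pow_lt_pow_left₀ hc (norm_nonneg _) (by norm_num)
    have hR2 : 1 < R ^ 2 := one_lt_pow₀ hR (by norm_num)
    rcases hw2.lt_or_eq with h | h
    · nlinarith [sq_nonneg ‖inner ℂ (ζ : Cn n) (ξ : Cn n)‖]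
    · rw [h]; linarith
  have hmean : ∀ ξ, Real.circleAverage (fun c => F (Φ c ξ)) 0 1
      = F (inner ℂ (ζ : Cn n) (ξ : Cn n) • (ζ : Cn n)) := by
    intro ξ
    have hd : DifferentiableOn ℂ (fun c => F (Φ c ξ)) (Metric.ball 0 R) := by
      refine hF.comp (by simp only [hΦ]; fun_prop) ?_
      intro c hc
      exact hΦle c ξ (by simpa using hc)
    have hcl : DiffContOnCl ℂ (fun c => F (Φ c ξ)) (Metric.ball 0 |1|) := by
      rw [abs_one]
      exact (hd.mono (Metric.closedBall_subset_ball hR)).diffContOnCl_ball le_rfl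
    rw [hcl.circleAverage]
    simp [hΦ]
  have hcont : Continuous fun q : ℝ × Sph n => F (Φ (circleMap 0 1 q.1) q.2) * K q.2 := by
    refine Continuous.mul ?_ (hKc.comp continuous_snd)
    refine hF.continuousOn.comp_continuous ?_ ?_
    · simp only [hΦ]
      fun_prop
    · intro q
      refine hΦle _ _ ?_
      simpa using hR
  calc ∫ ξ : Sph n, F ξ * K ξ ∂(sigma n)
      = (2 * Real.pi)⁻¹ • ∫ θ in (0 : ℝ)..2 * Real.pi,
          ∫ ξ, F (Φ (circleMap 0 1 θ) ξ) * K ξ ∂(sigma n) := by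
        have : ∀ θ : ℝ, ∫ ξ, F (Φ (circleMap 0 1 θ) ξ) * K ξ ∂(sigma n)
            = ∫ ξ : Sph n, F ξ * K ξ ∂(sigma n) := fun θ => hrot _ (by simp)
        simp only [this, intervalIntegral.integral_const, sub_zero, smul_smul]
        rw [inv_mul_cancel₀ (by positivity), one_smul]
    _ = ∫ ξ, (2 * Real.pi)⁻¹ • (∫ θ in (0 : ℝ)..2 * Real.pi,
          F (Φ (circleMap 0 1 θ) ξ) * K ξ) ∂(sigma n) := by
        rw [integral_smul]
        congr 1
        simp only [intervalIntegral.integral_of_le Real.two_pi_pos.le]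
        refine integral_integral_swap ?_
        have : IntegrableOn (fun q : ℝ × Sph n => F (Φ (circleMap 0 1 q.1) q.2) * K q.2)
            (Set.Icc 0 (2 * Real.pi) ×ˢ Set.univ) ((volume : Measure ℝ).prod (sigma n)) :=
          hcont.continuousOn.integrableOn_compact (isCompact_Icc.prod isCompact_univ)
        rw [IntegrableOn, ← Measure.prod_restrict, Measure.restrict_univ] at this
        exact this.mono_measure (Measure.prod_mono
          (Measure.restrict_mono Set.Ioc_subset_Icc_self le_rfl) le_rfl)
    _ = _ := by
        congr 1
        ext ξ
        rw [← hmean ξ, Real.circleAverage_def]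
        simp only [Complex.real_smul]
        rw [intervalIntegral.integral_mul_const]
        ring

/-! ### The Poisson–Szegő kernel -/

/-- The Poisson–Szegő kernel of the unit ball. -/
def poisson (z ξ : Cn n) : ℝ := (1 - ‖z‖ ^ 2) ^ n * ‖cauchyKernel z ξ‖ ^ 2

lemma poisson_nonneg {z : Cn n} (hz : ‖z‖ < 1) (ξ : Cn n) : 0 ≤ poisson z ξ := by
  have : 0 ≤ 1 - ‖z‖ ^ 2 := by nlinarith [norm_nonneg z]
  unfold poisson; positivity

lemma continuous_poisson {z : Cn n} (hz : ‖z‖ < 1) :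
    Continuous fun ξ : Sph n => poisson z (ξ : Cn n) := by
  have := continuous_cauchyKernel hz
  unfold poisson; fun_prop

lemma differentiableOn_inv_one_sub_inner (z : Cn n) {R : ℝ} (hR : ‖z‖ * R ≤ 1) :
    DifferentiableOn ℂ (fun w : Cn n => ((1 - inner ℂ z w) ^ n)⁻¹) (Metric.ball 0 R) := by
  intro w hw
  have hne : 1 - inner ℂ z w ≠ 0 := by
    intro h
    have h1 := norm_inner_le_norm (𝕜 := ℂ) z w
    rw [← sub_eq_zero.mp h, norm_one] at h1
    have hw' : ‖w‖ < R := by simpa using hw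
    have hz : 0 < ‖z‖ := by
      by_contra hz
      have : ‖z‖ = 0 := le_antisymm (not_lt.mp hz) (norm_nonneg _)
      rw [this] at h1; linarith [h1]
    nlinarith
  apply DifferentiableAt.differentiableWithinAt
  have hd : DifferentiableAt ℂ (fun w : Cn n => inner ℂ z w) w :=
    (innerSL ℂ z).differentiableAt
  exact ((hd.const_sub 1).pow n).inv (pow_ne_zero _ hne)

lemma conj_cauchyKernel (z ξ : Cn n) :
    starRingEnd ℂ (cauchyKernel z ξ) = ((1 - inner ℂ z ξ) ^ n)⁻¹ := by
  simp [cauchyKernel, map_inv₀]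

/-- The Poisson–Szegő kernel reproduces holomorphic functions. -/
lemma integral_poisson_mul [NeZero n] {F : Cn n → ℂ} {R : ℝ} (hR : 1 < R)
    (hF : DifferentiableOn ℂ F (Metric.ball 0 R)) {z : Cn n} (hz : ‖z‖ < 1) :
    ∫ ξ : Sph n, (poisson z ξ : ℂ) * F ξ ∂(sigma n) = F z := by
  have hz0 := norm_nonneg z
  -- The radius `2 / (1 + ‖z‖)` exceeds 1 but stays within the ball where `1 - ⟨w,z⟩` has no zero.
  have hR1 : 1 < 2 / (1 + ‖z‖) := by rw [lt_div_iff₀ (by linarith)]; linarith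
  have hR2 : ‖z‖ * (2 / (1 + ‖z‖)) ≤ 1 := by
    rw [mul_div_assoc', div_le_one (by linarith)]; linarith
  set R' := min R (2 / (1 + ‖z‖)) with hR'
  -- The Cauchy formula is applied to `F` times a holomorphic factor that equals 1 at `z` and that
  -- turns the Cauchy kernel into the Poisson kernel on the sphere.
  have hd : DifferentiableOn ℂ (fun w : Cn n => F w *
      ((((1 - ‖z‖ ^ 2) ^ n : ℝ) : ℂ) * ((1 - inner ℂ z w) ^ n)⁻¹)) (Metric.ball 0 R') := by
    refine (hF.mono (Metric.ball_subset_ball (min_le_left _ _))).mul ?_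
    exact (differentiableOn_const _).mul ((differentiableOn_inv_one_sub_inner z hR2).mono
      (Metric.ball_subset_ball (min_le_right _ _)))
  have h := integral_mul_cauchyKernel (lt_min hR hR1) hd hz
  have hone : ((((1 - ‖z‖ ^ 2) ^ n : ℝ) : ℂ) * ((1 - inner ℂ z z) ^ n)⁻¹) = 1 := by
    rw [inner_self_eq_norm_sq_to_K]
    have : (1 - ‖z‖ ^ 2) ≠ 0 := by nlinarith
    push_cast
    exact mul_inv_cancel₀ (pow_ne_zero _ (by exact_mod_cast this))
  rw [hone, mul_one] at h
  rw [← h]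
  congr 1
  ext ξ
  rw [← conj_cauchyKernel]
  have h2 : ((‖cauchyKernel z (ξ : Cn n)‖ ^ 2 : ℝ) : ℂ)
      = cauchyKernel z (ξ : Cn n) * starRingEnd ℂ (cauchyKernel z (ξ : Cn n)) := by
    rw [Complex.mul_conj, Complex.normSq_eq_norm_sq]
  unfold poisson
  rw [Complex.ofReal_mul, h2]
  ring

lemma integral_poisson [NeZero n] {z : Cn n} (hz : ‖z‖ < 1) :
    ∫ ξ : Sph n, poisson z ξ ∂(sigma n) = 1 := by
  have := integral_poisson_mul (F := fun _ : Cn n => 1) (R := 2) (by norm_num)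
    (differentiableOn_const _) hz
  simp only [mul_one] at this
  rw [integral_complex_ofReal] at this
  exact_mod_cast this

/-! ### Kernel size and the volume of nonisotropic balls -/

/-- The point `ρ ζ`. -/
abbrev radial (ρ : ℝ) (ζ : Sph n) : Cn n := (ρ : ℂ) • (ζ : Cn n)

lemma norm_radial {ρ : ℝ} (h0 : 0 ≤ ρ) (ζ : Sph n) : ‖radial ρ ζ‖ = ρ := by
  simp [radial, norm_smul, abs_of_nonneg h0]

lemma norm_one_sub_inner_radial_ge {ρ : ℝ} (h0 : 0 ≤ ρ) (h1 : ρ ≤ 1) (ζ ξ : Sph n) :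
    max (qdist ξ ζ) (1 - ρ) / 2 ≤ ‖1 - inner ℂ (ξ : Cn n) (radial ρ ζ)‖ := by
  obtain ⟨h2, h3⟩ := norm_one_sub_real_mul_ge h0 h1 (norm_inner_sph_le ζ ξ)
  rw [inner_smul_right]
  rw [div_le_iff₀ (by norm_num), qdist_comm]
  refine max_le ?_ ?_
  · unfold qdist; linarith
  · linarith [norm_nonneg (1 - (ρ : ℂ) * inner ℂ (ξ : Cn n) (ζ : Cn n))]

lemma norm_one_sub_inner_radial_le {ρ : ℝ} (h1 : ρ ≤ 1) (ζ ξ : Sph n) :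
    ‖1 - inner ℂ (ξ : Cn n) (radial ρ ζ)‖ ≤ qdist ξ ζ + (1 - ρ) := by
  rw [inner_smul_right, qdist_comm]
  exact norm_one_sub_real_mul_le h1 (norm_inner_sph_le ζ ξ)

lemma norm_cauchyKernel_radial_le {ρ : ℝ} (h0 : 0 ≤ ρ) (h1 : ρ < 1) (ζ ξ : Sph n) :
    ‖cauchyKernel (radial ρ ζ) (ξ : Cn n)‖ ≤ 2 ^ n * (max (qdist ξ ζ) (1 - ρ) ^ n)⁻¹ := by
  have h := norm_one_sub_inner_radial_ge h0 h1.le ζ ξ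
  have hp : 0 < max (qdist ξ ζ) (1 - ρ) := lt_max_of_lt_right (by linarith)
  unfold cauchyKernel
  rw [norm_inv, norm_pow]
  refine (inv_anti₀ (by positivity) (pow_le_pow_left₀ (by positivity) h n)).trans (le_of_eq ?_)
  rw [div_pow, inv_div, div_eq_mul_inv]

lemma poisson_radial_le {ρ : ℝ} (h0 : 0 ≤ ρ) (h1 : ρ < 1) (ζ ξ : Sph n) :
    poisson (radial ρ ζ) (ξ : Cn n) ≤ 8 ^ n * (1 - ρ) ^ n * (max (qdist ξ ζ) (1 - ρ) ^ (2 * n))⁻¹ := by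
  have h := norm_cauchyKernel_radial_le h0 h1 ζ ξ
  have hp : 0 < max (qdist ξ ζ) (1 - ρ) := lt_max_of_lt_right (by linarith)
  unfold poisson
  rw [norm_radial h0]
  have h2 : (1 - ρ ^ 2) ^ n ≤ (2 * (1 - ρ)) ^ n :=
    pow_le_pow_left₀ (by nlinarith) (by nlinarith) n
  refine (mul_le_mul h2 (pow_le_pow_left₀ (norm_nonneg _) h 2) (by positivity)
    (by have : 0 < 1 - ρ := by linarith
        positivity)).trans (le_of_eq ?_)
  rw [mul_pow, mul_pow, show (8 : ℝ) = 2 * 2 ^ 2 by norm_num, mul_pow, inv_pow, ← pow_mul, ← pow_mul,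
    ← pow_mul, mul_comm n 2]
  ring

lemma le_poisson_radial {ρ : ℝ} (h0 : 0 ≤ ρ) (h1 : ρ < 1) (ζ ξ : Sph n) :
    (1 - ρ) ^ n * ((qdist ξ ζ + (1 - ρ)) ^ (2 * n))⁻¹ ≤ poisson (radial ρ ζ) (ξ : Cn n) := by
  have h := norm_one_sub_inner_radial_le h1.le ζ ξ
  have hp : 0 < 1 - ρ := by linarith
  have hpos : 0 < ‖1 - inner ℂ (ξ : Cn n) (radial ρ ζ)‖ :=
    norm_pos_iff.mpr (one_sub_inner_ne_zero (by rwa [norm_radial h0]) ξ)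
  unfold poisson
  rw [norm_radial h0]
  unfold cauchyKernel
  rw [norm_inv, norm_pow, inv_pow, ← pow_mul, mul_comm n 2]
  refine mul_le_mul (pow_le_pow_left₀ hp.le (by nlinarith) n) ?_ (by
    have := qdist_nonneg ξ ζ
    positivity) (pow_nonneg (by nlinarith) _)
  exact inv_anti₀ (by positivity) (pow_le_pow_left₀ hpos.le h _)

lemma measurableSet_qball (ζ : Sph n) (r : ℝ) : MeasurableSet (qball ζ r) :=
  (isClosed_le (continuous_qdist ζ) continuous_const).measurableSet

/-- On the ball, the Poisson kernel of the point `(1 - r) ζ` is at least `(4 r)⁻ⁿ`, while its total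
mass is one. For `r ≥ 1` the bound is trivial. -/
lemma sigma_qball_le [NeZero n] (ζ : Sph n) {r : ℝ} (hr : 0 < r) :
    (sigma n).real (qball ζ r) ≤ 4 ^ n * r ^ n := by
  rcases le_total r 1 with h1 | h1
  · have h0 : 0 ≤ 1 - r := by linarith
    have hz : ‖radial (1 - r) ζ‖ < 1 := by rw [norm_radial h0]; linarith
    have hint := Continuous.integrable_sphere (continuous_poisson hz)
    have h2 : ∫ ξ in qball ζ r, (4 ^ n * r ^ n)⁻¹ ∂(sigma n) ≤ 1 := by
      refine ((setIntegral_mono_on (integrable_const _).integrableOn hint.integrableOn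
        (measurableSet_qball ζ r) ?_).trans (setIntegral_le_integral hint
        (Eventually.of_forall fun ξ => poisson_nonneg hz _))).trans (integral_poisson hz).le
      intro ξ hξ
      have hξ' : qdist ξ ζ ≤ r := hξ
      refine le_trans ?_ (le_poisson_radial h0 (by linarith) ζ ξ)
      rw [sub_sub_cancel]
      have : (qdist ξ ζ + r) ^ (2 * n) ≤ (2 * r) ^ (2 * n) :=
        pow_le_pow_left₀ (by have := qdist_nonneg ξ ζ; linarith) (by linarith) _
      calc (4 ^ n * r ^ n)⁻¹ = r ^ n * ((2 * r) ^ (2 * n))⁻¹ := by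
            rw [pow_mul, show (2 * r) ^ 2 = 4 * r * r by ring, mul_pow, mul_pow]
            field_simp
        _ ≤ _ := mul_le_mul_of_nonneg_left
            (inv_anti₀ (by have := qdist_nonneg ξ ζ; positivity) this) (by positivity)
    rw [setIntegral_const, smul_eq_mul, ← div_eq_mul_inv, div_le_one (by positivity)] at h2
    exact h2
  · refine (measureReal_le_one).trans ?_
    have : (1 : ℝ) ≤ r ^ n := one_le_pow₀ h1
    have : (1 : ℝ) ≤ 4 ^ n := one_le_pow₀ (by norm_num)
    nlinarith

lemma continuous_max_rpow (ζ : Sph n) {t : ℝ} (ht : 0 < t) (s : ℝ) :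
    Continuous fun ξ : Sph n => max (qdist ξ ζ) t ^ s := by
  have := continuous_qdist ζ
  refine Continuous.rpow_const (by fun_prop) fun ξ => Or.inl ?_
  exact ne_of_gt (lt_max_of_lt_right ht)

/-- The decay integral of the quasimetric. -/
lemma integral_max_rpow_le (n : ℕ) [NeZero n] {κ : ℝ} (hκ : 0 < κ) :
    ∃ C : ℝ, 0 < C ∧ ∀ (ζ : Sph n) (t : ℝ), 0 < t →
      ∫ ξ, max (qdist ξ ζ) t ^ (-(n + κ)) ∂(sigma n) ≤ C * t ^ (-κ) := by
  have hq0 : (0 : ℝ) < 2 ^ (-κ) := by positivity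
  have hq1 : (2 : ℝ) ^ (-κ) < 1 := Real.rpow_lt_one_of_one_lt_of_neg (by norm_num) (by linarith)
  refine ⟨8 ^ n * (1 - 2 ^ (-κ))⁻¹, mul_pos (by positivity) (inv_pos.mpr (by linarith)), ?_⟩
  intro ζ t ht
  -- Dyadic shells of radii `2 ^ k t`; as the quasidistance is at most 2, the shells up to index `N`
  -- exhaust the sphere.
  obtain ⟨N, hN⟩ := pow_unbounded_of_one_lt (2 / t) (by norm_num : (1 : ℝ) < 2)
  rw [div_lt_iff₀ ht] at hN
  have hpt : ∀ ξ : Sph n, max (qdist ξ ζ) t ^ (-(n + κ)) ≤ ∑ k ∈ Finset.range (N + 1),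
      (qball ζ (2 ^ (k + 1) * t)).indicator (fun _ => (2 ^ k * t) ^ (-(n + κ) : ℝ)) ξ := by
    intro ξ
    have hnn : ∀ k ∈ Finset.range (N + 1), 0 ≤
        (qball ζ (2 ^ (k + 1) * t)).indicator (fun _ => (2 ^ k * t) ^ (-(n + κ) : ℝ)) ξ :=
      fun k _ => Set.indicator_nonneg (fun _ _ => by positivity) _
    have hex : ∃ k, max (qdist ξ ζ) t < 2 ^ (k + 1) * t := by
      refine ⟨N, max_lt ?_ ?_⟩
      · have := qdist_le_two ξ ζ
        rw [pow_succ]; nlinarith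
      · have : (1 : ℝ) ≤ 2 ^ N := one_le_pow₀ (by norm_num)
        rw [pow_succ]; nlinarith
    classical
    set k := Nat.find hex with hk
    have hk1 := Nat.find_spec hex
    have hkN : k ≤ N := by
      apply Nat.find_min'
      refine max_lt ?_ ?_
      · have := qdist_le_two ξ ζ
        rw [pow_succ]; nlinarith
      · have : (1 : ℝ) ≤ 2 ^ N := one_le_pow₀ (by norm_num)
        rw [pow_succ]; nlinarith
    have hk2 : 2 ^ k * t ≤ max (qdist ξ ζ) t := by
      rcases Nat.eq_zero_or_pos k with h | h
      · rw [h]; simp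
      · have := Nat.find_min hex (m := k - 1) (by omega)
        rw [not_lt, Nat.sub_add_cancel h] at this
        exact this
    refine le_trans ?_ (Finset.single_le_sum hnn (Finset.mem_range.mpr (Nat.lt_succ_of_le hkN)))
    rw [Set.indicator_of_mem (show ξ ∈ qball ζ (2 ^ (k + 1) * t) from
      ((le_max_left _ _).trans hk1.le))]
    exact Real.rpow_le_rpow_of_nonpos (by positivity) hk2 (by
      have : (0 : ℝ) ≤ n := Nat.cast_nonneg n
      linarith)
  have hi : ∀ k, Integrable ((qball ζ (2 ^ (k + 1) * t)).indicator
      (fun _ => ((2 : ℝ) ^ k * t) ^ (-(n + κ) : ℝ))) (sigma n) := fun k =>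
    (integrable_const _).indicator (measurableSet_qball _ _)
  calc ∫ ξ, max (qdist ξ ζ) t ^ (-(n + κ)) ∂(sigma n)
      ≤ ∫ ξ, ∑ k ∈ Finset.range (N + 1), (qball ζ (2 ^ (k + 1) * t)).indicator
          (fun _ => (2 ^ k * t) ^ (-(n + κ) : ℝ)) ξ ∂(sigma n) :=
        integral_mono (Continuous.integrable_sphere (continuous_max_rpow ζ ht _))
          (integrable_finsetSum _ fun k _ => hi k) hpt
    _ = ∑ k ∈ Finset.range (N + 1),
          (sigma n).real (qball ζ (2 ^ (k + 1) * t)) * (2 ^ k * t) ^ (-(n + κ) : ℝ) := by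
        rw [integral_finsetSum _ fun k _ => hi k]
        refine Finset.sum_congr rfl fun k _ => ?_
        rw [integral_indicator (measurableSet_qball _ _), setIntegral_const, smul_eq_mul]
    _ ≤ ∑ k ∈ Finset.range (N + 1), 8 ^ n * t ^ (-κ) * ((2 : ℝ) ^ (-κ)) ^ k := by
        refine Finset.sum_le_sum fun k _ => ?_
        have h1 := sigma_qball_le ζ (r := 2 ^ (k + 1) * t) (by positivity)
        refine (mul_le_mul_of_nonneg_right h1 (by positivity)).trans (le_of_eq ?_)
        have hX : (0 : ℝ) < 2 ^ k * t := by positivity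
        rw [neg_add, Real.rpow_add hX, Real.rpow_neg hX.le, Real.rpow_natCast,
          show (2 : ℝ) ^ (k + 1) * t = 2 * (2 ^ k * t) by ring, mul_pow,
          Real.mul_rpow (by positivity) ht.le, ← Real.rpow_natCast (2 : ℝ) k, ← Real.rpow_mul
          (by norm_num), mul_comm (k : ℝ), Real.rpow_mul (by norm_num), Real.rpow_natCast,
          show (8 : ℝ) = 4 * 2 by norm_num, mul_pow 4]
        have : (((2 : ℝ) ^ (k : ℝ) * t) ^ n) ≠ 0 := by positivity
        field_simp
        exact Real.rpow_natCast _ _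
    _ = 8 ^ n * t ^ (-κ) * ∑ k ∈ Finset.range (N + 1), ((2 : ℝ) ^ (-κ)) ^ k := by
        rw [Finset.mul_sum]
    _ ≤ 8 ^ n * t ^ (-κ) * (1 - 2 ^ (-κ))⁻¹ := by
        refine mul_le_mul_of_nonneg_left ?_ (by positivity)
        rw [← tsum_geometric_of_lt_one hq0.le hq1]
        exact (summable_geometric_of_lt_one hq0.le hq1).sum_le_tsum _ fun _ _ => by positivity
    _ = _ := by ring

/-- The Poisson kernel of `(1 - δ) ζ`, with `δ` a small fixed multiple of `r`, has at most half its
mass outside the ball and is at most `8ⁿ δ⁻ⁿ` inside it, so the ball has measure at least of order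
`δⁿ`. -/
lemma le_sigma_qball (n : ℕ) [NeZero n] :
    ∃ c : ℝ, 0 < c ∧ ∀ (ζ : Sph n) (r : ℝ), 0 < r → r ≤ 2 →
      c * r ^ n ≤ (sigma n).real (qball ζ r) := by
  have hn : (0 : ℝ) < n := Nat.cast_pos.mpr (NeZero.pos n)
  obtain ⟨A, hA, hI⟩ := integral_max_rpow_le n hn
  -- Large enough for the outside mass `8 ^ n * A / K ^ n` to be at most `1/2`; the summand 2
  -- ensures `δ ≤ 1` for all `r ≤ 2`.
  set K : ℝ := 2 + 2 * 8 ^ n * A with hK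
  have hK2 : 2 ≤ K := by have : 0 < 8 ^ n * A := by positivity
                         linarith
  have hKpos : 0 < K := by linarith
  refine ⟨(2 * 8 ^ n * K ^ n)⁻¹, by positivity, ?_⟩
  intro ζ r hr hr2
  set δ := r / K with hδ
  have hδ0 : 0 < δ := by positivity
  have hδ1 : δ ≤ 1 := by rw [hδ, div_le_one hKpos]; linarith
  have hrδ : r = K * δ := by rw [hδ]; field_simp
  have h0 : 0 ≤ 1 - δ := by linarith
  have hz : ‖radial (1 - δ) ζ‖ < 1 := by rw [norm_radial h0]; linarith
  have hint := Continuous.integrable_sphere (continuous_poisson hz)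
  have hpt : ∀ ξ : Sph n, poisson (radial (1 - δ) ζ) (ξ : Cn n) ≤
      (qball ζ r).indicator (fun _ => 8 ^ n * (δ ^ n)⁻¹) ξ
        + 8 ^ n * δ ^ n * max (qdist ξ ζ) r ^ (-(n + n : ℝ)) := by
    intro ξ
    have h := poisson_radial_le h0 (by linarith) ζ ξ
    rw [sub_sub_cancel] at h
    have hmr : 0 < max (qdist ξ ζ) r := lt_max_of_lt_right hr
    by_cases hξ : ξ ∈ qball ζ r
    · rw [Set.indicator_of_mem hξ]
      have h2 : 0 ≤ 8 ^ n * δ ^ n * max (qdist ξ ζ) r ^ (-(n + n : ℝ)) := by positivity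
      have h3 : 8 ^ n * δ ^ n * (max (qdist ξ ζ) δ ^ (2 * n))⁻¹ ≤ 8 ^ n * δ ^ n * (δ ^ (2 * n))⁻¹ :=
        mul_le_mul_of_nonneg_left (inv_anti₀ (by positivity)
          (pow_le_pow_left₀ hδ0.le (le_max_right _ _) _)) (by positivity)
      have h4 : 8 ^ n * δ ^ n * (δ ^ (2 * n))⁻¹ = 8 ^ n * (δ ^ n)⁻¹ := by
        rw [two_mul, pow_add]; field_simp
      linarith
    · rw [Set.indicator_of_notMem hξ, zero_add]
      have hξ' : r < qdist ξ ζ := not_le.mp hξ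
      have hδr : δ ≤ r := by rw [hrδ]; nlinarith
      rw [max_eq_left (by linarith)] at h
      rw [max_eq_left hξ'.le]
      refine h.trans (le_of_eq ?_)
      rw [Real.rpow_neg (by linarith), ← two_mul, ← Real.rpow_natCast _ (2 * n)]
      push_cast; rfl
  have hm := continuous_max_rpow ζ hr (-(n + n : ℝ))
  have hi1 : Integrable ((qball ζ r).indicator (fun _ => 8 ^ n * (δ ^ n)⁻¹)) (sigma n) :=
    (integrable_const _).indicator (measurableSet_qball _ _)
  have h1 := integral_mono hint (hi1.add
    ((Continuous.integrable_sphere hm).const_mul (8 ^ n * δ ^ n))) hpt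
  simp only [Pi.add_apply] at h1
  rw [integral_poisson hz, integral_add hi1 ((Continuous.integrable_sphere hm).const_mul _),
    integral_indicator (measurableSet_qball _ _), setIntegral_const, smul_eq_mul,
    integral_const_mul] at h1
  have h2 : 8 ^ n * δ ^ n * ∫ ξ, max (qdist ξ ζ) r ^ (-(n + n : ℝ)) ∂(sigma n) ≤ 1 / 2 := by
    refine (mul_le_mul_of_nonneg_left (hI ζ r hr) (by positivity)).trans ?_
    rw [Real.rpow_neg hr.le, Real.rpow_natCast, hrδ, mul_pow]
    have hKn : 2 * 8 ^ n * A ≤ K ^ n := by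
      have : K ≤ K ^ n := le_self_pow₀ (by linarith) (NeZero.ne n)
      linarith
    have : 8 ^ n * δ ^ n * (A * (K ^ n * δ ^ n)⁻¹) = 8 ^ n * A / K ^ n := by
      field_simp
    rw [this, div_le_iff₀ (by positivity)]
    linarith
  have h3 : 1 / 2 ≤ (sigma n).real (qball ζ r) * (8 ^ n * (δ ^ n)⁻¹) := by linarith
  have h4 : δ ^ n ≤ 2 * 8 ^ n * (sigma n).real (qball ζ r) := by
    have : (sigma n).real (qball ζ r) * (8 ^ n * (δ ^ n)⁻¹) =
      (sigma n).real (qball ζ r) * 8 ^ n / δ ^ n := by field_simp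
    rw [this, le_div_iff₀ (by positivity)] at h3
    linarith
  rw [inv_mul_le_iff₀ (by positivity), hrδ, mul_pow]
  have hK0 : 0 < K ^ n := by positivity
  rw [← hrδ]
  nlinarith

/-! ### The Cauchy integral and its `L²` bound -/

/-- The Cauchy integral of a function on the sphere. -/
def cauchyInt (u : Sph n → ℂ) (z : Cn n) : ℂ :=
  ∫ ξ : Sph n, cauchyKernel z (ξ : Cn n) * u ξ ∂(sigma n)

lemma one_sub_norm_le (z : Cn n) (ξ : Sph n) : 1 - ‖z‖ ≤ ‖1 - inner ℂ (ξ : Cn n) z‖ := by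
  have h1 := norm_inner_le_norm (𝕜 := ℂ) (ξ : Cn n) z
  rw [norm_sph, one_mul] at h1
  have h2 := norm_sub_norm_le (1 : ℂ) (inner ℂ (ξ : Cn n) z)
  rw [norm_one] at h2
  linarith

lemma norm_cauchyKernel_le {z : Cn n} (hz : ‖z‖ < 1) (ξ : Sph n) :
    ‖cauchyKernel z (ξ : Cn n)‖ ≤ ((1 - ‖z‖) ^ n)⁻¹ := by
  unfold cauchyKernel
  rw [norm_inv, norm_pow]
  have : 0 < 1 - ‖z‖ := by linarith
  exact inv_anti₀ (by positivity) (pow_le_pow_left₀ this.le (one_sub_norm_le z ξ) n)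

lemma hasDerivAt_inv_one_sub_pow (n : ℕ) {x : ℂ} (hne : 1 - x ≠ 0) :
    HasDerivAt (fun w : ℂ => ((1 - w) ^ n)⁻¹) (n * ((1 - x) ^ (n + 1))⁻¹) x := by
  have h3 := (((hasDerivAt_id x).const_sub 1).pow n).inv (pow_ne_zero n hne)
  refine h3.congr_deriv ?_
  simp only [id, Pi.pow_apply]
  rcases n with _ | m
  · simp
  · simp only [Nat.add_sub_cancel]
    field_simp
    ring

lemma hasFDerivAt_cauchyKernel {z : Cn n} (hz : ‖z‖ < 1) (ξ : Sph n) :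
    HasFDerivAt (fun z : Cn n => cauchyKernel z (ξ : Cn n))
      ((n * ((1 - inner ℂ (ξ : Cn n) z) ^ (n + 1))⁻¹ : ℂ) • innerSL ℂ (ξ : Cn n)) z := by
  have hne := one_sub_inner_ne_zero hz ξ
  have h1 : HasFDerivAt (fun z : Cn n => inner ℂ (ξ : Cn n) z) (innerSL ℂ (ξ : Cn n)) z :=
    (innerSL ℂ (ξ : Cn n)).hasFDerivAt
  have h2 : HasDerivAt (fun w : ℂ => ((1 - w) ^ n)⁻¹)
      (n * ((1 - inner ℂ (ξ : Cn n) z) ^ (n + 1))⁻¹) (inner ℂ (ξ : Cn n) z) :=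
    hasDerivAt_inv_one_sub_pow n hne
  exact h2.comp_hasFDerivAt z h1

lemma differentiableOn_cauchyInt {u : Sph n → ℂ} (hu : Integrable u (sigma n)) :
    DifferentiableOn ℂ (cauchyInt u) (Metric.ball 0 1) := by
  intro z₀ hz₀
  have hz₀' : ‖z₀‖ < 1 := by simpa using hz₀
  apply DifferentiableAt.differentiableWithinAt
  set ε := (1 - ‖z₀‖) / 2 with hε
  have hε0 : 0 < ε := by rw [hε]; linarith
  have hball : ∀ z ∈ Metric.ball z₀ ε, ‖z‖ < 1 ∧ ε ≤ 1 - ‖z‖ := by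
    intro z hz
    have h1 : ‖z - z₀‖ < ε := by simpa [dist_eq_norm] using hz
    have h2 := norm_sub_norm_le z z₀
    constructor <;> linarith
  have hmeas : ∀ z : Cn n, ‖z‖ < 1 →
      AEStronglyMeasurable (fun ξ : Sph n => cauchyKernel z (ξ : Cn n) * u ξ) (sigma n) :=
    fun z hz => (continuous_cauchyKernel hz).aestronglyMeasurable.mul hu.1
  refine (hasFDerivAt_integral_of_dominated_of_fderiv_le (μ := sigma n)
    (F := fun (z : Cn n) (ξ : Sph n) => cauchyKernel z (ξ : Cn n) * u ξ)
    (F' := fun (z : Cn n) (ξ : Sph n) => (u ξ) •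
      ((n * ((1 - inner ℂ (ξ : Cn n) z) ^ (n + 1))⁻¹ : ℂ) • innerSL ℂ (ξ : Cn n)))
    (bound := fun ξ => n * (ε ^ (n + 1))⁻¹ * ‖u ξ‖)
    (Metric.ball_mem_nhds z₀ hε0) ?_ ?_ ?_ ?_ ?_ ?_).differentiableAt
  · filter_upwards [Metric.ball_mem_nhds z₀ hε0] with z hz
    exact hmeas z (hball z hz).1
  · refine Integrable.bdd_mul (c := ((1 - ‖z₀‖) ^ n)⁻¹) hu
      (continuous_cauchyKernel hz₀').aestronglyMeasurable
      (Eventually.of_forall fun ξ => norm_cauchyKernel_le hz₀' ξ)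
  · refine hu.1.smul (Continuous.aestronglyMeasurable ?_)
    have hc1 : Continuous fun ξ : Sph n =>
        (n * ((1 - inner ℂ (ξ : Cn n) z₀) ^ (n + 1))⁻¹ : ℂ) :=
      continuous_const.mul (Continuous.inv₀ (by fun_prop) fun ξ =>
        pow_ne_zero _ (one_sub_inner_ne_zero hz₀' ξ))
    have hc2 : Continuous fun ξ : Sph n => innerSL ℂ (ξ : Cn n) :=
      (innerSL ℂ (E := Cn n)).continuous.comp continuous_subtype_val
    exact hc1.smul hc2
  · refine Eventually.of_forall fun ξ z hz => ?_
    obtain ⟨h1, h2⟩ := hball z hz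
    have h3 := h2.trans (one_sub_norm_le z ξ)
    rw [norm_smul, norm_smul, innerSL_apply_norm, norm_sph, mul_one, norm_mul, norm_inv, norm_pow,
      Complex.norm_natCast]
    rw [mul_comm]
    refine mul_le_mul_of_nonneg_right (mul_le_mul_of_nonneg_left ?_ (Nat.cast_nonneg n))
      (norm_nonneg _)
    exact inv_anti₀ (by positivity) (pow_le_pow_left₀ hε0.le h3 _)
  · exact hu.norm.const_mul _
  · refine Eventually.of_forall fun ξ z hz => ?_
    have := (hasFDerivAt_cauchyKernel (hball z hz).1 ξ).mul_const (u ξ)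
    exact this

lemma norm_radial_lt_one {ρ : ℝ} (h0 : 0 ≤ ρ) (h1 : ρ < 1) (z : Sph n) : ‖radial ρ z‖ < 1 := by
  rwa [norm_radial h0]

lemma continuous_cauchyKernel_radial {ρ : ℝ} (h0 : 0 ≤ ρ) (h1 : ρ < 1) :
    Continuous fun q : Sph n × Sph n => cauchyKernel (radial ρ q.1) (q.2 : Cn n) := by
  unfold cauchyKernel radial
  refine Continuous.inv₀ (by fun_prop) fun q => pow_ne_zero _ ?_
  exact one_sub_inner_ne_zero (norm_radial_lt_one h0 h1 q.1) q.2

lemma continuous_cauchyInt_radial {u : Sph n → ℂ} (hu : Integrable u (sigma n)) {ρ : ℝ}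
    (h0 : 0 ≤ ρ) (h1 : ρ < 1) : Continuous fun z : Sph n => cauchyInt u (radial ρ z) := by
  refine (differentiableOn_cauchyInt hu).continuousOn.comp_continuous
    (by unfold radial; fun_prop) fun z => ?_
  simpa using norm_radial_lt_one h0 h1 z

lemma norm_cauchyInt_le {u : Sph n → ℂ} (hu : Integrable u (sigma n)) {z : Cn n} (hz : ‖z‖ < 1) :
    ‖cauchyInt u z‖ ≤ ((1 - ‖z‖) ^ n)⁻¹ * ∫ ξ, ‖u ξ‖ ∂(sigma n) := by
  refine (norm_integral_le_integral_norm _).trans ?_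
  rw [← integral_const_mul]
  refine integral_mono_of_nonneg (Eventually.of_forall fun _ => norm_nonneg _)
    (hu.norm.const_mul _) (Eventually.of_forall fun ξ => ?_)
  simp only [norm_mul]
  exact mul_le_mul_of_nonneg_right (norm_cauchyKernel_le hz ξ) (norm_nonneg _)

lemma integrable_cauchyKernel_mul {u : Sph n → ℂ} (hu : Integrable u (sigma n)) {z : Cn n}
    (hz : ‖z‖ < 1) : Integrable (fun ξ : Sph n => cauchyKernel z (ξ : Cn n) * u ξ) (sigma n) :=
  Integrable.bdd_mul (c := ((1 - ‖z‖) ^ n)⁻¹) hu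
      (continuous_cauchyKernel hz).aestronglyMeasurable
      (Eventually.of_forall fun ξ => norm_cauchyKernel_le hz ξ)

lemma cauchyInt_add {u v : Sph n → ℂ} (hu : Integrable u (sigma n)) (hv : Integrable v (sigma n))
    {z : Cn n} (hz : ‖z‖ < 1) : cauchyInt (u + v) z = cauchyInt u z + cauchyInt v z := by
  unfold cauchyInt
  rw [← integral_add (integrable_cauchyKernel_mul hu hz) (integrable_cauchyKernel_mul hv hz)]
  congr 1; ext ξ; simp only [Pi.add_apply]; ring

lemma cauchyInt_sub {u v : Sph n → ℂ} (hu : Integrable u (sigma n)) (hv : Integrable v (sigma n))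
    {z : Cn n} (hz : ‖z‖ < 1) : cauchyInt (u - v) z = cauchyInt u z - cauchyInt v z := by
  unfold cauchyInt
  rw [← integral_sub (integrable_cauchyKernel_mul hu hz) (integrable_cauchyKernel_mul hv hz)]
  congr 1; ext ξ; simp only [Pi.sub_apply]; ring

lemma cauchyInt_finsetSum {ι : Type*} (s : Finset ι) {u : ι → Sph n → ℂ}
    (hu : ∀ i ∈ s, Integrable (u i) (sigma n))
    {z : Cn n} (hz : ‖z‖ < 1) :
    cauchyInt (fun ξ => ∑ i ∈ s, u i ξ) z = ∑ i ∈ s, cauchyInt (u i) z := by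
  unfold cauchyInt
  rw [← integral_finsetSum _ fun i hi => integrable_cauchyKernel_mul (hu i hi) hz]
  congr 1; ext ξ; rw [Finset.mul_sum]

lemma conj_cauchyKernel_radial (ρ : ℝ) (z ξ : Sph n) :
    starRingEnd ℂ (cauchyKernel (radial ρ z) (ξ : Cn n)) = cauchyKernel (radial ρ ξ) (z : Cn n) := by
  rw [conj_cauchyKernel]
  simp [cauchyKernel, radial]

lemma integrable_prod_kernel [NeZero n] {k : Sph n × Sph n → ℂ} (hk : Continuous k)
    {u : Sph n → ℂ} (hu : Integrable u (sigma n)) :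
    Integrable (fun q : Sph n × Sph n => k q * u q.2) ((sigma n).prod (sigma n)) := by
  obtain ⟨C, hC⟩ := isCompact_univ.exists_bound_of_continuousOn hk.continuousOn
  exact Integrable.bdd_mul (c := C) (hu.comp_snd (sigma n)) hk.aestronglyMeasurable
    (Eventually.of_forall fun q => hC q (Set.mem_univ _))

/-- The Cauchy integral is symmetric. -/
lemma integral_cauchyInt_mul_conj [NeZero n] {u v : Sph n → ℂ} (hu : Integrable u (sigma n))
    (hv : Continuous v) {ρ : ℝ} (h0 : 0 ≤ ρ) (h1 : ρ < 1) :
    ∫ z : Sph n, cauchyInt u (radial ρ z) * starRingEnd ℂ (v z) ∂(sigma n)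
      = ∫ ξ : Sph n, u ξ * starRingEnd ℂ (cauchyInt v (radial ρ ξ)) ∂(sigma n) := by
  have hk : Continuous fun q : Sph n × Sph n =>
      cauchyKernel (radial ρ q.1) (q.2 : Cn n) * starRingEnd ℂ (v q.1) :=
    (continuous_cauchyKernel_radial h0 h1).mul (by fun_prop)
  calc ∫ z : Sph n, cauchyInt u (radial ρ z) * starRingEnd ℂ (v z) ∂(sigma n)
      = ∫ z : Sph n, ∫ ξ : Sph n, (cauchyKernel (radial ρ z) (ξ : Cn n) * starRingEnd ℂ (v z)) * u ξ
          ∂(sigma n) ∂(sigma n) := by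
        congr 1; ext z
        rw [cauchyInt, ← integral_mul_const]
        congr 1; ext ξ; ring
    _ = ∫ ξ : Sph n, ∫ z : Sph n, (cauchyKernel (radial ρ z) (ξ : Cn n) * starRingEnd ℂ (v z)) * u ξ
          ∂(sigma n) ∂(sigma n) := integral_integral_swap (integrable_prod_kernel hk hu)
    _ = _ := by
        congr 1; ext ξ
        rw [cauchyInt, ← integral_conj, ← integral_const_mul]
        congr 1; ext z
        rw [map_mul, conj_cauchyKernel_radial]; ring

/-- The dilate `w ↦ cauchyInt u (ρ w)` is holomorphic beyond the closed unit ball, so the Cauchy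
formula reproduces it at `ρ z`. Together with symmetry, this replaces an orthogonal projection
argument. -/
lemma cauchyInt_cauchyInt [NeZero n] {u : Sph n → ℂ} (hu : Integrable u (sigma n)) {ρ : ℝ}
    (h0 : 0 ≤ ρ) (h1 : ρ < 1) (z : Sph n) :
    cauchyInt (fun ξ => cauchyInt u (radial ρ ξ)) (radial ρ z) = cauchyInt u (radial (ρ ^ 2) z) := by
  have hR : 1 < 2 / (1 + ρ) := by rw [lt_div_iff₀ (by linarith)]; linarith
  have hd : DifferentiableOn ℂ (fun w : Cn n => cauchyInt u ((ρ : ℂ) • w))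
      (Metric.ball 0 (2 / (1 + ρ))) := by
    refine (differentiableOn_cauchyInt hu).comp (by fun_prop) ?_
    intro w hw
    have hw' : ‖w‖ < 2 / (1 + ρ) := by simpa using hw
    rw [lt_div_iff₀ (by linarith)] at hw'
    simp only [mem_ball_zero_iff, norm_smul, Complex.norm_real, Real.norm_of_nonneg h0]
    nlinarith [norm_nonneg w]
  have := integral_mul_cauchyKernel hR hd (norm_radial_lt_one h0 h1 z)
  unfold cauchyInt at this ⊢
  rw [show radial (ρ ^ 2) z = (ρ : ℂ) • radial ρ z by
    rw [radial, radial, smul_smul, sq, Complex.ofReal_mul], ← this]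
  congr 1; ext ξ; rw [mul_comm]

/-- The Cauchy integral is a contraction in `L²`. -/
lemma integral_norm_cauchyInt_sq_le [NeZero n] {u : Sph n → ℂ} (hu : Integrable u (sigma n))
    (hu2 : Integrable (fun ξ => ‖u ξ‖ ^ 2) (sigma n)) {ρ : ℝ} (h0 : 0 ≤ ρ) (h1 : ρ < 1) :
    ∫ z : Sph n, ‖cauchyInt u (radial ρ z)‖ ^ 2 ∂(sigma n) ≤ ∫ ξ, ‖u ξ‖ ^ 2 ∂(sigma n) := by
  set a : ℝ → ℝ := fun ρ => ∫ z : Sph n, ‖cauchyInt u (radial ρ z)‖ ^ 2 ∂(sigma n) with ha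
  set N := ∫ ξ, ‖u ξ‖ ^ 2 ∂(sigma n) with hN
  -- By symmetry and the composition rule, `a ρ` is the pairing of `u` with its Cauchy integral at
  -- radius `ρ²`; then `2 |AB| ≤ |A|² + |B|²`.
  have hstep : ∀ ρ : ℝ, 0 ≤ ρ → ρ < 1 → a ρ ≤ (N + a (ρ ^ 2)) / 2 := by
    intro ρ h0 h1
    have hc := continuous_cauchyInt_radial hu h0 h1
    have h02 : 0 ≤ ρ ^ 2 := by positivity
    have h12 : ρ ^ 2 < 1 := by nlinarith
    have hc2 := continuous_cauchyInt_radial hu h02 h12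
    have e1 : ((a ρ : ℝ) : ℂ) = ∫ ξ : Sph n, u ξ *
        starRingEnd ℂ (cauchyInt u (radial (ρ ^ 2) ξ)) ∂(sigma n) := by
      have := integral_cauchyInt_mul_conj hu hc h0 h1
      simp only [cauchyInt_cauchyInt hu h0 h1] at this
      rw [← this, ha, ← integral_complex_ofReal]
      congr 1; ext z
      rw [Complex.mul_conj, Complex.normSq_eq_norm_sq]
    have e2 : a ρ ≤ ‖∫ ξ : Sph n, u ξ *
        starRingEnd ℂ (cauchyInt u (radial (ρ ^ 2) ξ)) ∂(sigma n)‖ := by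
      rw [← e1, Complex.norm_real]; exact le_abs_self _
    refine e2.trans ((norm_integral_le_integral_norm _).trans ?_)
    have hi2 : Integrable (fun ξ : Sph n => ‖cauchyInt u (radial (ρ ^ 2) ξ)‖ ^ 2) (sigma n) :=
      Continuous.integrable_sphere (by fun_prop)
    rw [hN, ha]
    simp only
    rw [← integral_add hu2 hi2, ← integral_div]
    refine integral_mono_of_nonneg (Eventually.of_forall fun _ => norm_nonneg _)
      ((hu2.add hi2).div_const 2) (Eventually.of_forall fun ξ => ?_)
    simp only [norm_mul, RCLike.norm_conj]
    nlinarith [sq_nonneg (‖u ξ‖ - ‖cauchyInt u (radial (ρ ^ 2) ξ)‖)]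
  -- Along the radii `ρ ^ (2 ^ k)` the values of `a` stay bounded, so their supremum `S` satisfies
  -- `S ≤ (N + S) / 2`, hence `S ≤ N`.
  set b : ℕ → ℝ := fun k => a (ρ ^ (2 ^ k)) with hb
  have hbdd : BddAbove (Set.range b) := by
    refine ⟨(((1 - ρ) ^ n)⁻¹ * ∫ ξ, ‖u ξ‖ ∂(sigma n)) ^ 2, ?_⟩
    rintro _ ⟨k, rfl⟩
    have hk0 : 0 ≤ ρ ^ (2 ^ k) := by positivity
    have hkρ : ρ ^ (2 ^ k) ≤ ρ := pow_le_of_le_one h0 h1.le (by positivity)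
    have hk1 : ρ ^ (2 ^ k) < 1 := hkρ.trans_lt h1
    have hpt : ∀ z : Sph n, ‖cauchyInt u (radial (ρ ^ (2 ^ k)) z)‖ ^ 2 ≤
        (((1 - ρ) ^ n)⁻¹ * ∫ ξ, ‖u ξ‖ ∂(sigma n)) ^ 2 := by
      intro z
      refine pow_le_pow_left₀ (norm_nonneg _)
        ((norm_cauchyInt_le hu (norm_radial_lt_one hk0 hk1 z)).trans ?_) 2
      rw [norm_radial hk0]
      refine mul_le_mul_of_nonneg_right ?_ (integral_nonneg fun _ => norm_nonneg _)
      have : 0 < 1 - ρ := by linarith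
      exact inv_anti₀ (by positivity) (pow_le_pow_left₀ this.le (by linarith) n)
    have hc := continuous_cauchyInt_radial hu hk0 hk1
    have := integral_mono (Continuous.integrable_sphere (by fun_prop))
      (integrable_const (μ := sigma n) _) hpt
    rw [integral_const, probReal_univ, one_smul] at this
    exact this
  have hS : ∀ k, b k ≤ (N + ⨆ i, b i) / 2 := by
    intro k
    have hk0 : 0 ≤ ρ ^ (2 ^ k) := by positivity
    have hk1 : ρ ^ (2 ^ k) < 1 := pow_lt_one₀ h0 h1 (by positivity)
    have h2 := hstep _ hk0 hk1
    have h3 : b (k + 1) ≤ ⨆ i, b i := le_ciSup hbdd _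
    have h4 : b (k + 1) = a ((ρ ^ (2 ^ k)) ^ 2) := by
      simp only [hb]; rw [← pow_mul, pow_succ]
    rw [h4] at h3
    exact h2.trans (by linarith)
  have hS2 := ciSup_le hS
  have h5 : b 0 ≤ ⨆ i, b i := le_ciSup hbdd _
  have h6 : b 0 = a ρ := by simp [hb]
  change a ρ ≤ N
  linarith

/-! ### Regularity of the Cauchy kernel and the action on atoms -/

/-- The factor `M ^ 2` fits a difference of reciprocals: `|a⁻¹ - b⁻¹| = |a - b| / |a b|`, where `M`
bounds both reciprocals and `E` bounds `|a - b|`. -/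
lemma norm_pow_sub_pow_le {A B : ℂ} {M E : ℝ} (hA : ‖A‖ ≤ M) (hB : ‖B‖ ≤ M) (hE : 0 ≤ E)
    (hAB : ‖A - B‖ ≤ M ^ 2 * E) (k : ℕ) : ‖A ^ k - B ^ k‖ ≤ k * M ^ (k + 1) * E := by
  have hM : 0 ≤ M := (norm_nonneg A).trans hA
  induction k with
  | zero => simp
  | succ k ih =>
    have e : A ^ (k + 1) - B ^ (k + 1) = A * (A ^ k - B ^ k) + (A - B) * B ^ k := by ring
    rw [e]
    refine (norm_add_le _ _).trans ?_
    rw [norm_mul, norm_mul, norm_pow]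
    have h1 := mul_le_mul hA ih (norm_nonneg _) hM
    have h2 := mul_le_mul hAB (pow_le_pow_left₀ (norm_nonneg _) hB k) (by positivity)
      (by positivity)
    refine (add_le_add h1 h2).trans (le_of_eq ?_)
    push_cast; ring

/-- Moving the pole from `x` to `ξ` changes `1 - ⟨z,·⟩` by at most `3 √δ √d`, with the product of
components orthogonal to `x` as the dominant part. Relative to the size `d⁻ⁿ` of the kernel this
gains `(δ/d) ^ (1/2)`, enough for integrability away from `x`. -/
lemma norm_cauchyKernel_sub_le {ρ : ℝ} (h0 : 0 ≤ ρ) (h1 : ρ < 1) {x ξ z : Sph n} {δ : ℝ}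
    (hδ : 0 < δ) (hξ : qdist ξ x ≤ δ) (hz : 4 * δ < qdist z x) :
    ‖cauchyKernel (radial ρ z) (ξ : Cn n) - cauchyKernel (radial ρ z) (x : Cn n)‖
      ≤ 3 * n * 8 ^ (n + 1) * (√δ * qdist z x ^ (-(n + 1 / 2 : ℝ))) := by
  set d := qdist z x with hd
  have hd0 : 0 < d := by linarith
  have hsd : 0 < √d := Real.sqrt_pos.mpr hd0
  have hsδ : √δ ≤ √d / 2 := by
    rw [le_div_iff₀ (by norm_num), show √δ * 2 = √(δ * 4) by
      rw [Real.sqrt_mul hδ.le, show (4 : ℝ) = 2 ^ 2 by norm_num, Real.sqrt_sq (by norm_num)]]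
    exact Real.sqrt_le_sqrt (by linarith)
  set a := 1 - inner ℂ (ξ : Cn n) (radial ρ z) with ha
  set b := 1 - inner ℂ (x : Cn n) (radial ρ z) with hb
  have hbn : d / 8 ≤ ‖b‖ := by
    have := norm_one_sub_inner_radial_ge h0 h1.le z x
    have h2 := le_max_left (qdist x z) (1 - ρ)
    rw [qdist_comm x z] at h2 this
    linarith
  have hzξ : d / 4 ≤ qdist z ξ := by
    have h2 := sqrt_qdist_triangle z ξ x
    have h3 : √(qdist ξ x) ≤ √δ := Real.sqrt_le_sqrt hξ
    have h4 : √d / 2 ≤ √(qdist z ξ) := by linarith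
    have h5 := pow_le_pow_left₀ (by positivity) h4 2
    rw [Real.sq_sqrt (qdist_nonneg _ _), div_pow, Real.sq_sqrt hd0.le] at h5
    linarith
  have han : d / 8 ≤ ‖a‖ := by
    have := norm_one_sub_inner_radial_ge h0 h1.le z ξ
    have h2 := le_max_left (qdist ξ z) (1 - ρ)
    rw [qdist_comm ξ z] at h2 this
    linarith
  have ha0 : a ≠ 0 := norm_pos_iff.mp (by linarith)
  have hb0 : b ≠ 0 := norm_pos_iff.mp (by linarith)
  have hab : ‖a - b‖ ≤ 3 * (√δ * √d) := by
    have e : a - b = ρ * ((1 - inner ℂ (ξ : Cn n) (x : Cn n)) * inner ℂ (x : Cn n) (z : Cn n)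
        - inner ℂ ((ξ : Cn n) - inner ℂ (x : Cn n) (ξ : Cn n) • (x : Cn n))
          ((z : Cn n) - inner ℂ (x : Cn n) (z : Cn n) • (x : Cn n))) := by
      have := inner_decomp (x : Cn n) z ξ (norm_sph x)
      simp only [ha, hb, radial, inner_smul_right]
      rw [this]; ring
    rw [e, norm_mul, Complex.norm_real, Real.norm_of_nonneg h0]
    have h2 := norm_inner_orthogonal_le x z ξ
    have h3 : ‖(1 - inner ℂ (ξ : Cn n) (x : Cn n)) * inner ℂ (x : Cn n) (z : Cn n)‖ ≤ δ := by
      rw [norm_mul]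
      have h4 : ‖1 - inner ℂ (ξ : Cn n) (x : Cn n)‖ ≤ δ := by rw [qdist_comm] at hξ; exact hξ
      have := mul_le_mul h4 (norm_inner_sph_le z x) (norm_nonneg _) hδ.le
      simpa using this
    have h5 : √(qdist ξ x) * √(qdist z x) ≤ √δ * √d :=
      mul_le_mul_of_nonneg_right (Real.sqrt_le_sqrt hξ) (Real.sqrt_nonneg _)
    have h6 : δ ≤ √δ * √d := by
      calc δ = √δ * √δ := (Real.mul_self_sqrt hδ.le).symm
        _ ≤ √δ * √d := mul_le_mul_of_nonneg_left (by linarith) (Real.sqrt_nonneg _)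
    have h7 := (norm_sub_le ((1 - inner ℂ (ξ : Cn n) (x : Cn n)) * inner ℂ (x : Cn n) (z : Cn n))
      (inner ℂ ((ξ : Cn n) - inner ℂ (x : Cn n) (ξ : Cn n) • (x : Cn n))
          ((z : Cn n) - inner ℂ (x : Cn n) (z : Cn n) • (x : Cn n))))
    have h8 := mul_le_mul h1.le h7 (norm_nonneg _) zero_le_one
    linarith
  have hinv : ∀ c : ℂ, d / 8 ≤ ‖c‖ → ‖c⁻¹‖ ≤ 8 / d := by
    intro c hc
    rw [norm_inv, ← inv_div]
    exact inv_anti₀ (by positivity) hc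
  have hAB : ‖a⁻¹ - b⁻¹‖ ≤ (8 / d) ^ 2 * (3 * (√δ * √d)) := by
    have e : a⁻¹ - b⁻¹ = a⁻¹ * b⁻¹ * (b - a) := by field_simp
    rw [e, norm_mul, norm_mul, norm_sub_rev b a, sq]
    exact mul_le_mul (mul_le_mul (hinv a han) (hinv b hbn) (norm_nonneg _) (by positivity)) hab
      (norm_nonneg _) (by positivity)
  have key := norm_pow_sub_pow_le (hinv a han) (hinv b hbn) (by positivity) hAB n
  unfold cauchyKernel
  rw [← inv_pow, ← inv_pow]
  refine key.trans (le_of_eq ?_)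
  have e : d ^ (-(n + 1 / 2 : ℝ)) = √d / d ^ (n + 1) := by
    rw [Real.sqrt_eq_rpow, ← Real.rpow_natCast, ← Real.rpow_sub hd0]
    congr 1; push_cast; ring
  rw [e, div_pow]; ring

lemma continuous_cauchyKernel_radial_left {ρ : ℝ} (h0 : 0 ≤ ρ) (h1 : ρ < 1) (x : Sph n) :
    Continuous fun z : Sph n => cauchyKernel (radial ρ z) (x : Cn n) := by
  unfold cauchyKernel radial
  refine Continuous.inv₀ (by fun_prop) fun z => pow_ne_zero _ ?_
  exact one_sub_inner_ne_zero (norm_radial_lt_one h0 h1 z) x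

/-- The Cauchy integral of a function of mean zero, supported in a ball, is integrable away
from the ball, uniformly. -/
lemma integral_cauchyInt_atom_le (n : ℕ) [NeZero n] :
    ∃ A : ℝ, 0 < A ∧ ∀ (ρ : ℝ), 0 ≤ ρ → ρ < 1 → ∀ (x : Sph n) (δ : ℝ), 0 < δ →
      ∀ b : Sph n → ℂ, Integrable b (sigma n) → (∀ ξ, ξ ∉ qball x δ → b ξ = 0) →
      ∫ ξ, b ξ ∂(sigma n) = 0 →
      ∫ z in (qball x (4 * δ))ᶜ, ‖cauchyInt b (radial ρ z)‖ ∂(sigma n)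
        ≤ A * ∫ ξ, ‖b ξ‖ ∂(sigma n) := by
  obtain ⟨C, hC, hI⟩ := integral_max_rpow_le n (show (0 : ℝ) < 1 / 2 by norm_num)
  have hn : 0 < n := NeZero.pos n
  refine ⟨3 * n * 8 ^ (n + 1) * C, by positivity, ?_⟩
  intro ρ h0 h1 x δ hδ b hb hsupp hmean
  obtain ⟨D, hD⟩ : ∃ D : Sph n × Sph n → ℂ, ∀ q, D q =
      cauchyKernel (radial ρ q.1) (q.2 : Cn n) - cauchyKernel (radial ρ q.1) (x : Cn n) :=
    ⟨_, fun _ => rfl⟩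
  have hDc : Continuous D := by
    have h2 := continuous_cauchyKernel_radial (n := n) h0 h1
    have h3 := (continuous_cauchyKernel_radial_left h0 h1 x).comp
      (continuous_fst (X := Sph n) (Y := Sph n))
    rw [funext hD]
    exact h2.sub h3
  -- The mean-zero condition allows the kernel with pole at the center `x` to be subtracted.
  have hrep : ∀ z : Sph n, cauchyInt b (radial ρ z) = ∫ ξ, D (z, ξ) * b ξ ∂(sigma n) := by
    intro z
    have e : ∀ ξ : Sph n, D (z, ξ) * b ξ = cauchyKernel (radial ρ z) (ξ : Cn n) * b ξ
        - cauchyKernel (radial ρ z) (x : Cn n) * b ξ := fun ξ => by simp only [hD]; ring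
    simp only [e]
    rw [integral_sub (integrable_cauchyKernel_mul hb (norm_radial_lt_one h0 h1 z))
      (hb.const_mul _), integral_const_mul, hmean, mul_zero, sub_zero]
    rfl
  set s := (qball x (4 * δ))ᶜ with hs
  have hsm : MeasurableSet s := (measurableSet_qball _ _).compl
  have hprod := integrable_prod_kernel hDc hb
  have hprod' : Integrable (fun q : Sph n × Sph n => ‖D q * b q.2‖)
      (((sigma n).restrict s).prod (sigma n)) := by
    have : ((sigma n).restrict s).prod (sigma n) ≤ (sigma n).prod (sigma n) :=
      Measure.prod_mono Measure.restrict_le_self le_rfl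
    exact (hprod.mono_measure this).norm
  have hcont := continuous_cauchyInt_radial hb h0 h1
  calc ∫ z in s, ‖cauchyInt b (radial ρ z)‖ ∂(sigma n)
      ≤ ∫ z in s, ∫ ξ, ‖D (z, ξ) * b ξ‖ ∂(sigma n) ∂(sigma n) := by
        refine integral_mono (Continuous.integrable_sphere hcont.norm).integrableOn
          hprod'.integral_prod_left fun z => ?_
        simp only [hrep z]
        exact norm_integral_le_integral_norm _
    _ = ∫ ξ, ∫ z in s, ‖D (z, ξ) * b ξ‖ ∂(sigma n) ∂(sigma n) := integral_integral_swap hprod'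
    _ ≤ ∫ ξ, 3 * n * 8 ^ (n + 1) * C * ‖b ξ‖ ∂(sigma n) := by
        refine integral_mono hprod'.integral_prod_right (hb.norm.const_mul _) fun ξ => ?_
        simp only [norm_mul]
        rw [integral_mul_const]
        by_cases hξ : ξ ∈ qball x δ
        · refine mul_le_mul_of_nonneg_right ?_ (norm_nonneg _)
          have hbound : ∀ z ∈ s, ‖D (z, ξ)‖ ≤
              3 * n * 8 ^ (n + 1) * √δ * max (qdist z x) δ ^ (-(n + 1 / 2 : ℝ)) := by
            intro z hz
            have hz' : 4 * δ < qdist z x := not_le.mp hz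
            rw [max_eq_left (by linarith)]
            rw [hD]
            refine (norm_cauchyKernel_sub_le h0 h1 hδ hξ hz').trans (le_of_eq ?_)
            ring
          have hci : Integrable (fun z => 3 * n * 8 ^ (n + 1) * √δ *
              max (qdist z x) δ ^ (-(n + 1 / 2 : ℝ))) (sigma n) :=
            (Continuous.integrable_sphere (continuous_max_rpow x hδ _)).const_mul _
          have hDi : Integrable (fun z => ‖D (z, ξ)‖) (sigma n) :=
            Continuous.integrable_sphere (by fun_prop)
          calc ∫ z in s, ‖D (z, ξ)‖ ∂(sigma n)
              ≤ ∫ z in s, 3 * n * 8 ^ (n + 1) * √δ *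
                  max (qdist z x) δ ^ (-(n + 1 / 2 : ℝ)) ∂(sigma n) :=
                setIntegral_mono_on hDi.integrableOn hci.integrableOn hsm hbound
            _ ≤ ∫ z, 3 * n * 8 ^ (n + 1) * √δ *
                  max (qdist z x) δ ^ (-(n + 1 / 2 : ℝ)) ∂(sigma n) := by
                refine setIntegral_le_integral hci (Eventually.of_forall fun z => ?_)
                have : 0 ≤ max (qdist z x) δ := le_max_of_le_right hδ.le
                simp only [Pi.zero_apply]
                positivity
            _ ≤ 3 * n * 8 ^ (n + 1) * √δ * (C * δ ^ (-(1 / 2) : ℝ)) := by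
                rw [integral_const_mul]
                exact mul_le_mul_of_nonneg_left (hI x δ hδ) (by positivity)
            _ = 3 * n * 8 ^ (n + 1) * C * (√δ * δ ^ (-(1 / 2) : ℝ)) := by ring
            _ = _ := by
                rw [Real.sqrt_eq_rpow, ← Real.rpow_add hδ]; simp
        · rw [hsupp ξ hξ]; simp
    _ = _ := by rw [integral_const_mul]

/-! ### Stopping balls and the Calderón–Zygmund decomposition -/

lemma norm_sub_sq_le_qdist (z x : Sph n) : ‖(z : Cn n) - x‖ ^ 2 ≤ 2 * qdist z x := by
  have h := norm_sub_sq (𝕜 := ℂ) (z : Cn n) (x : Cn n)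
  rw [norm_sph, norm_sph] at h
  have h2 := Complex.re_le_norm (1 - inner ℂ (x : Cn n) (z : Cn n))
  have h3 : RCLike.re (inner ℂ (z : Cn n) (x : Cn n)) = (inner ℂ (x : Cn n) (z : Cn n)).re := by
    rw [← inner_conj_symm (z : Cn n) (x : Cn n)]; exact Complex.conj_re _
  rw [h, h3]
  simp only [Complex.sub_re, Complex.one_re] at h2
  unfold qdist
  linarith

lemma qball_eq_univ (x : Sph n) {r : ℝ} (hr : 2 ≤ r) : qball x r = Set.univ :=
  Set.eq_univ_of_forall fun z => (qdist_le_two z x).trans hr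

lemma sigma_qball_pos [NeZero n] (x : Sph n) {r : ℝ} (hr : 0 < r) :
    0 < (sigma n).real (qball x r) := by
  obtain ⟨c, hc, h⟩ := le_sigma_qball n
  rcases le_total r 2 with h2 | h2
  · exact lt_of_lt_of_le (by positivity) (h x r hr h2)
  · rw [qball_eq_univ x h2, probReal_univ]; norm_num

/-- Along the radii `16 ^ k * r₀`, the average of `|w|` exceeds `t/2` at `k = 0` by continuity at
`x`, and no longer does so once the ball is the whole sphere. Hence some step passes from one case
to the other. The ratio 16 is the enlargement needed by the covering argument. -/
lemma exists_stopping_radius [NeZero n] {w : Sph n → ℝ} (hw : Continuous w) {t : ℝ} (ht : 0 < t)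
    (hint : ∫ ξ, |w ξ| ∂(sigma n) ≤ t / 2) (x : Sph n) (hx : t ≤ |w x|) :
    ∃ r, 0 < r ∧ r ≤ 2 ∧ t / 2 * (sigma n).real (qball x r) < ∫ ξ in qball x r, |w ξ| ∂(sigma n) ∧
      ∫ ξ in qball x (16 * r), |w ξ| ∂(sigma n) ≤ t / 2 * (sigma n).real (qball x (16 * r)) := by
  have hwi : Integrable (fun ξ => |w ξ|) (sigma n) := Continuous.integrable_sphere hw.abs
  obtain ⟨ε, hε, hball⟩ := Metric.continuousAt_iff.mp
    (hw.abs.continuousAt (x := x)) (t / 4) (by linarith)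
  set r₀ := ε ^ 2 / 4 with hr₀
  have hr₀pos : 0 < r₀ := by positivity
  have hlow : ∀ ξ ∈ qball x r₀, 3 * t / 4 ≤ |w ξ| := by
    intro ξ hξ
    have h1 := norm_sub_sq_le_qdist ξ x
    have h2 : qdist ξ x ≤ r₀ := hξ
    have h3 : ‖(ξ : Cn n) - x‖ < ε := by
      apply lt_of_pow_lt_pow_left₀ 2 hε.le
      rw [hr₀] at h2
      have : 0 < ε ^ 2 := by positivity
      linarith
    have h4 : dist ξ x < ε := by rwa [Subtype.dist_eq, dist_eq_norm]
    have h5 := hball h4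
    rw [Real.dist_eq, abs_lt] at h5
    linarith [h5.1]
  set P : ℕ → Prop := fun k => t / 2 * (sigma n).real (qball x (16 ^ k * r₀))
    < ∫ ξ in qball x (16 ^ k * r₀), |w ξ| ∂(sigma n) with hP
  have hP0 : P 0 := by
    simp only [hP, pow_zero, one_mul]
    have h1 : ∫ ξ in qball x r₀, 3 * t / 4 ∂(sigma n) ≤ ∫ ξ in qball x r₀, |w ξ| ∂(sigma n) :=
      setIntegral_mono_on (integrable_const _).integrableOn hwi.integrableOn
        (measurableSet_qball _ _) hlow
    rw [setIntegral_const, smul_eq_mul] at h1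
    have h2 := sigma_qball_pos x hr₀pos
    nlinarith
  have hbig : ∀ k, P k → 16 ^ k * r₀ ≤ 2 := by
    intro k hk
    by_contra hcon
    simp only [hP] at hk
    rw [qball_eq_univ x (not_le.mp hcon).le, probReal_univ, setIntegral_univ] at hk
    linarith
  have hex : ∃ k, P k ∧ ¬ P (k + 1) := by
    by_contra hcon
    push Not at hcon
    have hall : ∀ k, P k := fun k => by
      induction k with
      | zero => exact hP0
      | succ k ih => exact hcon k ih
    obtain ⟨N, hN⟩ := pow_unbounded_of_one_lt (2 / r₀) (by norm_num : (1 : ℝ) < 16)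
    rw [div_lt_iff₀ hr₀pos] at hN
    linarith [hbig N (hall N)]
  obtain ⟨k, hk, hk'⟩ := hex
  refine ⟨16 ^ k * r₀, by positivity, hbig k hk, hk, ?_⟩
  have e : 16 * (16 ^ k * r₀) = 16 ^ (k + 1) * r₀ := by ring
  rw [e]
  exact not_lt.mp hk'

/-- The square root of the quasidistance obeys the triangle inequality, and `√r ≤ (3/2) √s`; so the
distances add up to `(3/2 + 3/2 + 1) √s = 4 √s`, and `4² = 16`. -/
lemma qball_subset_of_inter {x y : Sph n} {r s : ℝ} (hs : 0 ≤ s)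
    (hrs : r ≤ 2 * s) (hne : (qball x r ∩ qball y s).Nonempty) : qball x r ⊆ qball y (16 * s) := by
  obtain ⟨p, hp1, hp2⟩ := hne
  intro z hz
  have h1 : √(qdist z x) ≤ √r := Real.sqrt_le_sqrt hz
  have h2 : √(qdist x p) ≤ √r := by rw [qdist_comm]; exact Real.sqrt_le_sqrt hp1
  have h3 : √(qdist p y) ≤ √s := Real.sqrt_le_sqrt hp2
  have h4 := sqrt_qdist_triangle z x y
  have h5 := sqrt_qdist_triangle x p y
  have h6 : √r ≤ 3 / 2 * √s := by
    rw [show (3 / 2 : ℝ) * √s = √((3 / 2) ^ 2 * s) by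
      rw [Real.sqrt_mul (by positivity), Real.sqrt_sq (by norm_num)]]
    exact Real.sqrt_le_sqrt (by linarith)
  have h7 : √(qdist z y) ≤ √(16 * s) := by
    rw [show √(16 * s) = 4 * √s by
      rw [show (16 : ℝ) = 4 ^ 2 by norm_num, Real.sqrt_mul (by positivity),
        Real.sqrt_sq (by norm_num)]]
    linarith
  exact (Real.sqrt_le_sqrt_iff (by positivity)).mp h7

/-- The set `{t ≤ |w|}` is compact, so finitely many stopping balls cover it. Vitali selection with
ratio 2 keeps a disjoint subfamily whose 16-fold enlargements still cover. -/
lemma exists_stopping_balls [NeZero n] {w : Sph n → ℝ} (hw : Continuous w) {t : ℝ} (ht : 0 < t)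
    (hint : ∫ ξ, |w ξ| ∂(sigma n) ≤ t / 2) :
    ∃ (v : Finset (Sph n)) (r : Sph n → ℝ), (∀ x ∈ v, 0 < r x ∧ r x ≤ 2 ∧
      t / 2 * (sigma n).real (qball x (r x)) < ∫ ξ in qball x (r x), |w ξ| ∂(sigma n) ∧
      ∫ ξ in qball x (16 * r x), |w ξ| ∂(sigma n)
        ≤ t / 2 * (sigma n).real (qball x (16 * r x))) ∧
      ((v : Set (Sph n)).PairwiseDisjoint fun x => qball x (r x)) ∧
      ∀ z, t ≤ |w z| → ∃ x ∈ v, z ∈ qball x (16 * r x) := by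
  classical
  have hsel : ∀ x : Sph n, ∃ r, t ≤ |w x| → (0 < r ∧ r ≤ 2 ∧
      t / 2 * (sigma n).real (qball x r) < ∫ ξ in qball x r, |w ξ| ∂(sigma n) ∧
      ∫ ξ in qball x (16 * r), |w ξ| ∂(sigma n) ≤ t / 2 * (sigma n).real (qball x (16 * r))) := by
    intro x
    by_cases hx : t ≤ |w x|
    · obtain ⟨r, hr⟩ := exists_stopping_radius hw ht hint x hx
      exact ⟨r, fun _ => hr⟩
    · exact ⟨0, fun h => absurd h hx⟩
  choose r hr using hsel
  have hK : IsCompact {x | t ≤ |w x|} := (isClosed_le continuous_const hw.abs).isCompact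
  obtain ⟨s, hs, hcov⟩ := hK.elim_nhds_subcover (fun x => qball x (r x)) (by
    intro x hx
    have : {z | qdist z x < r x} ∈ 𝓝 x := by
      refine (isOpen_lt (continuous_qdist x) continuous_const).mem_nhds ?_
      change qdist x x < r x
      rw [qdist_self]; exact (hr x hx).1
    exact mem_of_superset this fun z (hz : qdist z x < r x) =>
      show qdist z x ≤ r x from hz.le)
  obtain ⟨u, hus, hdisj, hcover⟩ := Vitali.exists_disjoint_subfamily_covering_enlargement
    (fun x : Sph n => qball x (r x)) (s : Set (Sph n)) r 2 (by norm_num)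
    (fun x hx => (hr x (hs x hx)).1.le) 2 (fun x hx => (hr x (hs x hx)).2.1)
    (fun x hx => ⟨x, by change qdist x x ≤ r x; rw [qdist_self]; exact (hr x (hs x hx)).1.le⟩)
  have hfin : u.Finite := s.finite_toSet.subset hus
  refine ⟨hfin.toFinset, r, ?_, ?_, ?_⟩
  · intro x hx
    exact hr x (hs x (hus (hfin.mem_toFinset.mp hx)))
  · simpa using hdisj
  · intro z hz
    obtain ⟨x, hx, hzx⟩ := Set.mem_iUnion₂.mp (hcov hz)
    obtain ⟨y, hy, hne, hle⟩ := hcover x hx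
    refine ⟨y, hfin.mem_toFinset.mpr hy, ?_⟩
    exact qball_subset_of_inter (hr y (hs y (hus hy))).1.le hle hne hzx

/-- The function `1_E / ∑ 1_E'`, where `E'` runs over the balls of a finite family. -/
def share (v : Finset (Sph n)) (R : Sph n → ℝ) (x ξ : Sph n) : ℝ :=
  (qball x (R x)).indicator 1 ξ / ∑ y ∈ v, (qball y (R y)).indicator 1 ξ

section share

variable (v : Finset (Sph n)) (R : Sph n → ℝ)

lemma share_nonneg (x ξ : Sph n) : 0 ≤ share v R x ξ :=
  div_nonneg (Set.indicator_nonneg (fun _ _ => zero_le_one) _)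
    (Finset.sum_nonneg fun _ _ => Set.indicator_nonneg (fun _ _ => zero_le_one) _)

lemma share_eq_zero {x ξ : Sph n} (h : ξ ∉ qball x (R x)) : share v R x ξ = 0 := by
  simp [share, Set.indicator_of_notMem h]

lemma sum_share_eq_one {ξ : Sph n} (h : ∃ x ∈ v, ξ ∈ qball x (R x)) :
    ∑ x ∈ v, share v R x ξ = 1 := by
  unfold share
  rw [← Finset.sum_div]
  apply div_self
  obtain ⟨x, hx, hξ⟩ := h
  have h1 : (1 : ℝ) ≤ ∑ y ∈ v, (qball y (R y)).indicator 1 ξ := by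
    refine le_trans ?_ (Finset.single_le_sum (fun y _ =>
      Set.indicator_nonneg (fun _ _ => zero_le_one) ξ) hx)
    simp [Set.indicator_of_mem hξ]
  linarith

lemma sum_share_eq_zero {ξ : Sph n} (h : ¬ ∃ x ∈ v, ξ ∈ qball x (R x)) :
    ∑ x ∈ v, share v R x ξ = 0 := by
  push Not at h
  exact Finset.sum_eq_zero fun x hx => share_eq_zero v R (h x hx)

lemma sum_share_le_one (ξ : Sph n) : ∑ x ∈ v, share v R x ξ ≤ 1 := by
  by_cases h : ∃ x ∈ v, ξ ∈ qball x (R x)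
  · exact (sum_share_eq_one v R h).le
  · rw [sum_share_eq_zero v R h]; exact zero_le_one

lemma share_le_one {x : Sph n} (hx : x ∈ v) (ξ : Sph n) : share v R x ξ ≤ 1 :=
  (Finset.single_le_sum (fun y _ => share_nonneg v R y ξ) hx).trans (sum_share_le_one v R ξ)

lemma measurable_share (x : Sph n) : Measurable (share v R x) := by
  unfold share
  refine (measurable_one.indicator (measurableSet_qball _ _)).div ?_
  exact Finset.measurable_fun_sum v fun y _ => measurable_one.indicator (measurableSet_qball _ _)

lemma integrable_mul_share {w : Sph n → ℝ} (hw : Integrable w (sigma n)) {x : Sph n} (hx : x ∈ v) :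
    Integrable (fun ξ => w ξ * share v R x ξ) (sigma n) := by
  refine Integrable.mul_bdd (c := 1) hw (measurable_share v R x).aestronglyMeasurable
    (Eventually.of_forall fun ξ => ?_)
  rw [Real.norm_of_nonneg (share_nonneg v R x ξ)]
  exact share_le_one v R hx ξ

end share

lemma norm_sum_indicator_le {v : Finset (Sph n)} {B : Sph n → Set (Sph n)}
    (hdisj : (v : Set (Sph n)).PairwiseDisjoint B) {a : Sph n → ℝ} {M : ℝ} (hM : 0 ≤ M)
    (ha : ∀ x ∈ v, |a x| ≤ M) (ξ : Sph n) :
    |∑ x ∈ v, (B x).indicator (fun _ => a x) ξ| ≤ M := by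
  classical
  by_cases h : ∃ x ∈ v, ξ ∈ B x
  · obtain ⟨x, hx, hξ⟩ := h
    rw [Finset.sum_eq_single x, Set.indicator_of_mem hξ]
    · exact ha x hx
    · intro y hy hyx
      refine Set.indicator_of_notMem (fun hy' => ?_) _
      exact Set.disjoint_left.mp (hdisj hy hx hyx) hy' hξ
    · intro hx'; exact absurd hx hx'
  · push Not at h
    rw [Finset.sum_eq_zero fun x hx => Set.indicator_of_notMem (h x hx) _]
    simpa using hM

/-- Calderón–Zygmund decomposition of a continuous function on the sphere. -/
lemma exists_calderonZygmund (n : ℕ) [NeZero n] :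
    ∃ D : ℝ, 0 < D ∧ ∀ (w : Sph n → ℝ), Continuous w → ∀ t : ℝ, 0 < t →
      ∫ ξ, |w ξ| ∂(sigma n) ≤ t / 2 →
      ∃ (v : Finset (Sph n)) (δ : Sph n → ℝ) (g : Sph n → ℝ) (b : Sph n → Sph n → ℝ),
        (∀ x ∈ v, 0 < δ x) ∧
        (∀ ξ, w ξ = g ξ + ∑ x ∈ v, b x ξ) ∧
        Integrable g (sigma n) ∧ Integrable (fun ξ => g ξ ^ 2) (sigma n) ∧
        ∫ ξ, g ξ ^ 2 ∂(sigma n) ≤ D * t * ∫ ξ, |w ξ| ∂(sigma n) ∧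
        (∀ x ∈ v, Integrable (b x) (sigma n) ∧ (∀ ξ, ξ ∉ qball x (δ x) → b x ξ = 0) ∧
          ∫ ξ, b x ξ ∂(sigma n) = 0) ∧
        ∑ x ∈ v, ∫ ξ, |b x ξ| ∂(sigma n) ≤ 2 * ∫ ξ, |w ξ| ∂(sigma n) ∧
        ∑ x ∈ v, (sigma n).real (qball x (4 * δ x)) ≤ D / t * ∫ ξ, |w ξ| ∂(sigma n) := by
  obtain ⟨c, hc, hlow⟩ := le_sigma_qball n
  -- `64 = 4 · 16` and `256 = 4 · 64` come from the upper volume bound for the balls of radius `16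
  -- r` and `64 r`, compared with the lower bound `c r ^ n`.
  set D₀ : ℝ := 64 ^ n / c with hD₀
  have hD₀pos : 0 < D₀ := by positivity
  set D₁ : ℝ := 2 * 256 ^ n / c with hD₁
  have hD₁pos : 0 < D₁ := by positivity
  refine ⟨1 + D₀ + D₁, by positivity, ?_⟩
  intro w hw t ht hint
  obtain ⟨v, r, hr, hdisj, hcov⟩ := exists_stopping_balls hw ht hint
  have hwi : Integrable w (sigma n) := Continuous.integrable_sphere hw
  set R : Sph n → ℝ := fun x => 16 * r x with hR
  set B : Sph n → Set (Sph n) := fun x => qball x (r x) with hB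
  have hBm : ∀ x, MeasurableSet (B x) := fun x => measurableSet_qball _ _
  -- The part of `w` assigned to the enlarged ball of `x` is replaced by a constant with the same
  -- integral on the original stopping ball. Those balls are disjoint, so the good part stays
  -- bounded by a multiple of `t`; the difference is the mean-zero atom `b x`.
  set a : Sph n → ℝ := fun x => (∫ ξ, w ξ * share v R x ξ ∂(sigma n)) / (sigma n).real (B x) with ha
  have hBpos : ∀ x ∈ v, 0 < (sigma n).real (B x) := fun x hx => sigma_qball_pos x (hr x hx).1
  set I : Sph n → ℝ := fun x => ∫ ξ, |w ξ| * share v R x ξ ∂(sigma n) with hI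
  have hIabs : ∀ x ∈ v, |∫ ξ, w ξ * share v R x ξ ∂(sigma n)| ≤ I x := by
    intro x _
    refine (abs_integral_le_integral_abs).trans (le_of_eq ?_)
    congr 1; ext ξ
    rw [abs_mul, abs_of_nonneg (share_nonneg v R x ξ)]
  have haB : ∀ x ∈ v, |a x| * (sigma n).real (B x) ≤ I x := by
    intro x hx
    simp only [ha]
    rw [abs_div, abs_of_pos (hBpos x hx), div_mul_cancel₀ _ (hBpos x hx).ne']
    exact hIabs x hx
  have hIE : ∀ x ∈ v, I x ≤ t / 2 * (D₀ * (sigma n).real (B x)) := by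
    intro x hx
    obtain ⟨h1, h2, _, h4⟩ := hr x hx
    have h5 : I x ≤ ∫ ξ in qball x (R x), |w ξ| ∂(sigma n) := by
      rw [← integral_indicator (measurableSet_qball _ _)]
      refine integral_mono (integrable_mul_share v R hwi.abs hx)
        (hwi.abs.indicator (measurableSet_qball _ _)) fun ξ => ?_
      by_cases hξ : ξ ∈ qball x (R x)
      · rw [Set.indicator_of_mem hξ]
        exact mul_le_of_le_one_right (abs_nonneg _) (share_le_one v R hx ξ)
      · rw [Set.indicator_of_notMem hξ]
        simp only [share_eq_zero v R hξ, mul_zero, le_refl]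
    refine h5.trans (h4.trans (mul_le_mul_of_nonneg_left ?_ (by positivity)))
    have h6 := sigma_qball_le x (r := 16 * r x) (by positivity)
    have h7 := hlow x (r x) h1 h2
    refine h6.trans ?_
    rw [hD₀, mul_pow, ← mul_assoc, ← mul_pow]
    calc (4 * 16 : ℝ) ^ n * r x ^ n = 64 ^ n / c * (c * r x ^ n) := by
          norm_num; field_simp
      _ ≤ _ := mul_le_mul_of_nonneg_left h7 (by positivity)
  have haM : ∀ x ∈ v, |a x| ≤ t / 2 * D₀ := by
    intro x hx
    have h1 := (haB x hx).trans (hIE x hx)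
    rw [← mul_assoc] at h1
    exact le_of_mul_le_mul_right h1 (hBpos x hx)
  set g : Sph n → ℝ := fun ξ => w ξ * (1 - ∑ x ∈ v, share v R x ξ)
    + ∑ x ∈ v, (B x).indicator (fun _ => a x) ξ with hg
  set b : Sph n → Sph n → ℝ := fun x ξ => w ξ * share v R x ξ - (B x).indicator (fun _ => a x) ξ
    with hb
  have hSm : Measurable fun ξ => ∑ x ∈ v, share v R x ξ :=
    Finset.measurable_fun_sum v fun x _ => measurable_share v R x
  have hi1 : Integrable (fun ξ => w ξ * (1 - ∑ x ∈ v, share v R x ξ)) (sigma n) := by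
    refine Integrable.mul_bdd (c := 1) hwi (measurable_const.sub hSm).aestronglyMeasurable
      (Eventually.of_forall fun ξ => ?_)
    have h1 := sum_share_le_one v R ξ
    have h2 : 0 ≤ ∑ x ∈ v, share v R x ξ := Finset.sum_nonneg fun x _ => share_nonneg v R x ξ
    rw [Real.norm_of_nonneg (by linarith)]; linarith
  have hi2 : ∀ x, Integrable ((B x).indicator (fun _ => a x)) (sigma n) := fun x =>
    (integrable_const _).indicator (hBm x)
  have hi2s : Integrable (fun ξ => ∑ x ∈ v, (B x).indicator (fun _ => a x) ξ) (sigma n) :=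
    integrable_finsetSum _ fun x _ => hi2 x
  have hgi : Integrable g (sigma n) := hi1.add hi2s
  have hgM : ∀ ξ, |g ξ| ≤ (1 + D₀) * t := by
    intro ξ
    have h1 : |w ξ * (1 - ∑ x ∈ v, share v R x ξ)| ≤ t := by
      by_cases h : ∃ x ∈ v, ξ ∈ qball x (R x)
      · rw [sum_share_eq_one v R h]; simpa using ht.le
      · rw [sum_share_eq_zero v R h, sub_zero, mul_one]
        by_contra hcon
        exact h (hcov ξ (not_le.mp hcon).le)
    have h2 := norm_sum_indicator_le hdisj (by positivity) haM ξ
    refine (abs_add_le _ _).trans ((add_le_add h1 h2).trans ?_)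
    nlinarith
  have hIsum : ∫ ξ, |w ξ| * (1 - ∑ x ∈ v, share v R x ξ) ∂(sigma n) + ∑ x ∈ v, I x
      = ∫ ξ, |w ξ| ∂(sigma n) := by
    rw [← integral_finsetSum _ fun x hx => integrable_mul_share v R hwi.abs hx, ← integral_add]
    · congr 1; ext ξ; rw [← Finset.mul_sum]; ring
    · have := hi1.abs
      refine this.congr (Eventually.of_forall fun ξ => ?_)
      have h1 := sum_share_le_one v R ξ
      simp only [abs_mul]
      rw [abs_of_nonneg (show 0 ≤ 1 - ∑ x ∈ v, share v R x ξ by linarith)]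
    · exact integrable_finsetSum _ fun x hx => integrable_mul_share v R hwi.abs hx
  have hfirst : 0 ≤ ∫ ξ, |w ξ| * (1 - ∑ x ∈ v, share v R x ξ) ∂(sigma n) :=
    integral_nonneg fun ξ => mul_nonneg (abs_nonneg _) (by
      have h1 := sum_share_le_one v R ξ
      linarith)
  have hI0 : ∀ x, 0 ≤ I x := fun x =>
    integral_nonneg fun ξ => mul_nonneg (abs_nonneg _) (share_nonneg v R x ξ)
  have hg1 : ∫ ξ, |g ξ| ∂(sigma n) ≤ ∫ ξ, |w ξ| ∂(sigma n) := by
    have hj : Integrable (fun ξ => ∑ x ∈ v, (B x).indicator (fun _ => |a x|) ξ) (sigma n) :=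
      integrable_finsetSum _ fun x _ => (integrable_const _).indicator (hBm x)
    calc ∫ ξ, |g ξ| ∂(sigma n)
        ≤ ∫ ξ, (|w ξ * (1 - ∑ x ∈ v, share v R x ξ)|
            + ∑ x ∈ v, (B x).indicator (fun _ => |a x|) ξ) ∂(sigma n) := by
          refine integral_mono hgi.abs (hi1.abs.add hj) fun ξ => ?_
          refine (abs_add_le _ _).trans (add_le_add le_rfl ?_)
          refine (Finset.abs_sum_le_sum_abs _ _).trans (Finset.sum_le_sum fun x _ => ?_)
          by_cases hξ : ξ ∈ B x
          · rw [Set.indicator_of_mem hξ, Set.indicator_of_mem hξ]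
          · rw [Set.indicator_of_notMem hξ, Set.indicator_of_notMem hξ]; simp
      _ = ∫ ξ, |w ξ| * (1 - ∑ x ∈ v, share v R x ξ) ∂(sigma n)
            + ∑ x ∈ v, |a x| * (sigma n).real (B x) := by
          rw [integral_add hi1.abs hj, integral_finsetSum _ fun x _ =>
            (integrable_const _).indicator (hBm x)]
          congr 1
          · congr 1; ext ξ
            have h1 := sum_share_le_one v R ξ
            rw [abs_mul, abs_of_nonneg (show 0 ≤ 1 - ∑ x ∈ v, share v R x ξ by linarith)]
          · refine Finset.sum_congr rfl fun x _ => ?_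
            rw [integral_indicator (hBm x), setIntegral_const, smul_eq_mul, mul_comm]
      _ ≤ _ := by
          rw [← hIsum]
          exact add_le_add le_rfl (Finset.sum_le_sum haB)
  have hgsq : ∀ ξ, g ξ ^ 2 ≤ (1 + D₀) * t * |g ξ| := by
    intro ξ
    rw [← sq_abs, sq]
    exact mul_le_mul_of_nonneg_right (hgM ξ) (abs_nonneg _)
  have hg2i : Integrable (fun ξ => g ξ ^ 2) (sigma n) := by
    refine (hgi.abs.const_mul ((1 + D₀) * t)).mono' (hgi.1.pow 2) (Eventually.of_forall fun ξ => ?_)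
    rw [Real.norm_of_nonneg (sq_nonneg _)]; exact hgsq ξ
  have hW0 : 0 ≤ ∫ ξ, |w ξ| ∂(sigma n) := integral_nonneg fun _ => abs_nonneg _
  refine ⟨v, R, g, b, ?_, ?_, hgi, hg2i, ?_, ?_, ?_, ?_⟩
  · intro x hx
    have := (hr x hx).1
    simp only [hR]; positivity
  · intro ξ
    simp only [hg, hb, Finset.sum_sub_distrib, ← Finset.mul_sum]; ring
  · refine (integral_mono hg2i (hgi.abs.const_mul _) hgsq).trans ?_
    rw [integral_const_mul]
    calc (1 + D₀) * t * ∫ ξ, |g ξ| ∂(sigma n) ≤ (1 + D₀) * t * ∫ ξ, |w ξ| ∂(sigma n) :=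
          mul_le_mul_of_nonneg_left hg1 (by positivity)
      _ ≤ _ := mul_le_mul_of_nonneg_right (mul_le_mul_of_nonneg_right (by linarith) ht.le) hW0
  · intro x hx
    refine ⟨(integrable_mul_share v R hwi hx).sub (hi2 x), ?_, ?_⟩
    · intro ξ hξ
      simp only [hb]
      rw [share_eq_zero v R hξ, Set.indicator_of_notMem]
      · simp
      · intro h
        have h' : qdist ξ x ≤ r x := h
        have := (hr x hx).1
        exact hξ (show qdist ξ x ≤ 16 * r x by linarith)
    · simp only [hb]
      rw [integral_sub (integrable_mul_share v R hwi hx) (hi2 x), integral_indicator (hBm x),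
        setIntegral_const, smul_eq_mul]
      simp only [ha]
      rw [mul_div_cancel₀ _ (hBpos x hx).ne', sub_self]
  · have hbx : ∀ x ∈ v, ∫ ξ, |b x ξ| ∂(sigma n) ≤ 2 * I x := by
      intro x hx
      have hj : Integrable ((B x).indicator (fun _ => |a x|)) (sigma n) :=
        (integrable_const _).indicator (hBm x)
      calc ∫ ξ, |b x ξ| ∂(sigma n)
          ≤ ∫ ξ, (|w ξ| * share v R x ξ + (B x).indicator (fun _ => |a x|) ξ) ∂(sigma n) := by
            refine integral_mono ((integrable_mul_share v R hwi hx).sub (hi2 x)).abs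
              ((integrable_mul_share v R hwi.abs hx).add hj) fun ξ => ?_
            refine (abs_sub _ _).trans (add_le_add ?_ ?_)
            · rw [abs_mul, abs_of_nonneg (share_nonneg v R x ξ)]
            · by_cases hξ : ξ ∈ B x
              · rw [Set.indicator_of_mem hξ, Set.indicator_of_mem hξ]
              · rw [Set.indicator_of_notMem hξ, Set.indicator_of_notMem hξ]; simp
        _ = I x + |a x| * (sigma n).real (B x) := by
            rw [integral_add (integrable_mul_share v R hwi.abs hx) hj, integral_indicator (hBm x),
              setIntegral_const, smul_eq_mul, mul_comm (|a x|)]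
        _ ≤ 2 * I x := by linarith [haB x hx]
    refine (Finset.sum_le_sum hbx).trans ?_
    rw [← Finset.mul_sum]
    linarith
  -- On the original balls the average of `|w|` exceeds `t/2`, so their measures, and hence those of
  -- the enlargements, are paid for by disjoint portions of `∫ |w|`.
  · have hx1 : ∀ x ∈ v, (sigma n).real (qball x (4 * R x)) ≤
        D₁ / t * ∫ ξ in B x, |w ξ| ∂(sigma n) := by
      intro x hx
      obtain ⟨h1, h2, h3, _⟩ := hr x hx
      have h6 := sigma_qball_le x (r := 4 * R x) (by simp only [hR]; positivity)
      have h7 := hlow x (r x) h1 h2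
      calc (sigma n).real (qball x (4 * R x)) ≤ 4 ^ n * (4 * R x) ^ n := h6
        _ = 256 ^ n / c * (c * r x ^ n) := by
            simp only [hR]
            rw [← mul_pow, show 4 * (4 * (16 * r x)) = 256 * r x by ring, mul_pow]
            field_simp
        _ ≤ 256 ^ n / c * ((∫ ξ in B x, |w ξ| ∂(sigma n)) / (t / 2)) := by
            refine mul_le_mul_of_nonneg_left (h7.trans ?_) (by positivity)
            rw [le_div_iff₀ (by positivity), mul_comm]
            exact h3.le
        _ = _ := by rw [hD₁]; field_simp
    refine (Finset.sum_le_sum hx1).trans ?_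
    rw [← Finset.mul_sum, ← integral_biUnion_finset v (fun x _ => hBm x) hdisj
      (fun x _ => hwi.abs.integrableOn)]
    have h8 : ∫ ξ in ⋃ x ∈ v, B x, |w ξ| ∂(sigma n) ≤ ∫ ξ, |w ξ| ∂(sigma n) :=
      setIntegral_le_integral hwi.abs (Eventually.of_forall fun _ => abs_nonneg _)
    calc D₁ / t * ∫ ξ in ⋃ x ∈ v, B x, |w ξ| ∂(sigma n) ≤ D₁ / t * ∫ ξ, |w ξ| ∂(sigma n) :=
          mul_le_mul_of_nonneg_left h8 (by positivity)
      _ ≤ _ := mul_le_mul_of_nonneg_right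
          (div_le_div_of_nonneg_right (by linarith) ht.le) hW0

/-! ### Weak-type estimates for the Cauchy integral -/

lemma measureReal_le_integral_div [NeZero n] {X : Sph n → ℝ} (hX : Integrable X (sigma n))
    (h0 : ∀ z, 0 ≤ X z) {t : ℝ} (ht : 0 < t) :
    (sigma n).real {z | t ≤ X z} ≤ (∫ z, X z ∂(sigma n)) / t := by
  rw [le_div_iff₀ ht, mul_comm]
  exact mul_meas_ge_le_integral_of_nonneg (Eventually.of_forall h0) hX t

/-- The Cauchy integral in `L²`: Chebyshev's inequality. -/
lemma measureReal_cauchyInt_le_sq [NeZero n] {u : Sph n → ℝ} (hu : Integrable u (sigma n))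
    (hu2 : Integrable (fun ξ => u ξ ^ 2) (sigma n)) {ρ : ℝ} (h0 : 0 ≤ ρ) (h1 : ρ < 1)
    {t : ℝ} (ht : 0 < t) :
    (sigma n).real {z | t ≤ ‖cauchyInt (fun ξ => (u ξ : ℂ)) (radial ρ z)‖}
      ≤ (∫ ξ, u ξ ^ 2 ∂(sigma n)) / t ^ 2 := by
  have hc := continuous_cauchyInt_radial (u := fun ξ => (u ξ : ℂ)) hu.ofReal h0 h1
  have h2 := integral_norm_cauchyInt_sq_le (u := fun ξ => (u ξ : ℂ)) hu.ofReal
    (by simpa using hu2) h0 h1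
  have h3 := measureReal_le_integral_div (Continuous.integrable_sphere (hc.norm.pow 2))
    (fun z => sq_nonneg _) (t := t ^ 2) (by positivity)
  refine (measureReal_mono ?_).trans (h3.trans (div_le_div_of_nonneg_right ?_ (by positivity)))
  · intro z (hz : t ≤ _)
    exact pow_le_pow_left₀ ht.le hz 2
  · simpa using h2

/-- The Cauchy integral is of weak type `(1, 1)`, uniformly in the radius. -/
lemma weak_type_one (n : ℕ) [NeZero n] :
    ∃ A : ℝ, 0 < A ∧ ∀ ρ : ℝ, 0 ≤ ρ → ρ < 1 → ∀ w : Sph n → ℝ, Continuous w → ∀ t : ℝ, 0 < t →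
      (sigma n).real {z | t ≤ ‖cauchyInt (fun ξ => (w ξ : ℂ)) (radial ρ z)‖}
        ≤ A / t * ∫ ξ, |w ξ| ∂(sigma n) := by
  obtain ⟨D, hD, hCZ⟩ := exists_calderonZygmund n
  obtain ⟨A, hA, hatom⟩ := integral_cauchyInt_atom_le n
  refine ⟨2 + 4 * D + D + 4 * A, by positivity, ?_⟩
  intro ρ h0 h1 w hw t ht
  have hW0 : 0 ≤ ∫ ξ, |w ξ| ∂(sigma n) := integral_nonneg fun _ => abs_nonneg _
  -- The decomposition needs average at most `t/2` over the sphere; otherwise the asserted bound is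
  -- at least 1.
  rcases le_or_gt (∫ ξ, |w ξ| ∂(sigma n)) (t / 2) with hint | hint
  swap
  · refine measureReal_le_one.trans ?_
    rw [div_mul_eq_mul_div, le_div_iff₀ ht]
    nlinarith
  obtain ⟨v, δ, g, b, hδ, hdec, hgi, hg2i, hg2, hb, hb1, hE⟩ := hCZ w hw t ht hint
  set W := ∫ ξ, |w ξ| ∂(sigma n) with hW
  have hbi : ∀ x ∈ v, Integrable (fun ξ => (b x ξ : ℂ)) (sigma n) := fun x hx => (hb x hx).1.ofReal
  have hsplit : ∀ z : Sph n, cauchyInt (fun ξ => (w ξ : ℂ)) (radial ρ z)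
      = cauchyInt (fun ξ => (g ξ : ℂ)) (radial ρ z)
        + ∑ x ∈ v, cauchyInt (fun ξ => (b x ξ : ℂ)) (radial ρ z) := by
    intro z
    have hz := norm_radial_lt_one h0 h1 z
    have hgC : Integrable (fun ξ => (g ξ : ℂ)) (sigma n) := hgi.ofReal
    rw [← cauchyInt_finsetSum v hbi hz, ← cauchyInt_add hgC (integrable_finsetSum _ hbi) hz]
    congr 1
    ext ξ
    simp only [Pi.add_apply]
    rw [hdec ξ]; push_cast; rfl
  set Y : Sph n → ℝ := fun z => ∑ x ∈ v, (qball x (4 * δ x))ᶜ.indicator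
    (fun z => ‖cauchyInt (fun ξ => (b x ξ : ℂ)) (radial ρ z)‖) z with hY
  have hYi : ∀ x ∈ v, Integrable ((qball x (4 * δ x))ᶜ.indicator
      (fun z => ‖cauchyInt (fun ξ => (b x ξ : ℂ)) (radial ρ z)‖)) (sigma n) := fun x hx =>
    (Continuous.integrable_sphere (continuous_cauchyInt_radial (hbi x hx) h0 h1).norm).indicator
      (measurableSet_qball _ _).compl
  have hYint : ∫ z, Y z ∂(sigma n) ≤ A * (2 * W) := by
    simp only [hY]
    rw [integral_finsetSum _ hYi]
    calc ∑ x ∈ v, ∫ z, (qball x (4 * δ x))ᶜ.indicator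
          (fun z => ‖cauchyInt (fun ξ => (b x ξ : ℂ)) (radial ρ z)‖) z ∂(sigma n)
        ≤ ∑ x ∈ v, A * ∫ ξ, |b x ξ| ∂(sigma n) := by
          refine Finset.sum_le_sum fun x hx => ?_
          rw [integral_indicator (measurableSet_qball _ _).compl]
          have h2 := hatom ρ h0 h1 x (δ x) (hδ x hx) (fun ξ => (b x ξ : ℂ)) (hbi x hx)
            (fun ξ hξ => by simp [(hb x hx).2.1 ξ hξ])
            (by rw [integral_complex_ofReal, (hb x hx).2.2]; simp)
          simpa using h2
      _ ≤ _ := by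
          rw [← Finset.mul_sum]
          exact mul_le_mul_of_nonneg_left hb1 hA.le
  -- A large value comes from the good part (Chebyshev in `L²`), or lies in an enlarged ball (small
  -- measure), or comes from the atoms off their enlarged balls (Chebyshev in `L¹`).
  have hsub : {z | t ≤ ‖cauchyInt (fun ξ => (w ξ : ℂ)) (radial ρ z)‖} ⊆
      ({z | t / 2 ≤ ‖cauchyInt (fun ξ => (g ξ : ℂ)) (radial ρ z)‖} ∪
        ⋃ x ∈ v, qball x (4 * δ x)) ∪ {z | t / 2 ≤ Y z} := by
    intro z (hz : t ≤ _)
    by_cases hE' : z ∈ ⋃ x ∈ v, qball x (4 * δ x)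
    · exact Or.inl (Or.inr hE')
    by_cases hg' : t / 2 ≤ ‖cauchyInt (fun ξ => (g ξ : ℂ)) (radial ρ z)‖
    · exact Or.inl (Or.inl hg')
    · refine Or.inr ?_
      change t / 2 ≤ Y z
      have hYz : Y z = ∑ x ∈ v, ‖cauchyInt (fun ξ => (b x ξ : ℂ)) (radial ρ z)‖ := by
        refine Finset.sum_congr rfl fun x hx => Set.indicator_of_mem ?_ _
        intro hzx
        exact hE' (Set.mem_iUnion₂.mpr ⟨x, hx, hzx⟩)
      rw [hYz]
      rw [hsplit z] at hz
      have h2 := norm_add_le (cauchyInt (fun ξ => (g ξ : ℂ)) (radial ρ z))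
        (∑ x ∈ v, cauchyInt (fun ξ => (b x ξ : ℂ)) (radial ρ z))
      have h3 := norm_sum_le v fun x => cauchyInt (fun ξ => (b x ξ : ℂ)) (radial ρ z)
      linarith [not_le.mp hg']
  have hm1 := measureReal_cauchyInt_le_sq hgi hg2i h0 h1 (t := t / 2) (by positivity)
  have hm2 : (sigma n).real (⋃ x ∈ v, qball x (4 * δ x)) ≤ D / t * W :=
    (measureReal_biUnion_finset_le v _).trans hE
  have hm3 := measureReal_le_integral_div (integrable_finsetSum _ hYi) (fun z =>
    Finset.sum_nonneg fun x _ => Set.indicator_nonneg (fun _ _ => norm_nonneg _) _) (t := t / 2)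
    (by positivity)
  refine (measureReal_mono hsub).trans ((measureReal_union_le _ _).trans
    ((add_le_add (measureReal_union_le _ _) le_rfl).trans ?_))
  have k1 : (∫ ξ, g ξ ^ 2 ∂(sigma n)) / (t / 2) ^ 2 ≤ 4 * D / t * W := by
    rw [div_le_iff₀ (by positivity)]
    refine hg2.trans (le_of_eq ?_)
    field_simp
    ring
  have k3 : (∫ z, Y z ∂(sigma n)) / (t / 2) ≤ 4 * A / t * W := by
    rw [div_le_iff₀ (by positivity)]
    refine hYint.trans (le_of_eq ?_)
    field_simp
    ring
  have k4 : 0 ≤ 2 / t * W := by positivity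
  have e : (2 + 4 * D + D + 4 * A) / t * W
      = 2 / t * W + 4 * D / t * W + D / t * W + 4 * A / t * W := by ring
  rw [e]
  have hm3' : (sigma n).real {z | t / 2 ≤ Y z} ≤ (∫ z, Y z ∂(sigma n)) / (t / 2) := hm3
  linarith [hm1.trans k1, hm3'.trans k3]

/-- Truncate `w` at height `t`. The truncation is treated in `L²` and the remainder by weak type
`(1, 1)`. Pointwise they satisfy `w₁² ≤ t ^ (2-p) |w| ^ p` (this needs `p ≤ 2`) and `|w₂| ≤ t ^
(1-p) |w| ^ p`. -/
lemma weak_type_p (n : ℕ) [NeZero n] :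
    ∃ A : ℝ, 0 < A ∧ ∀ p : ℝ, 1 < p → p ≤ 2 → ∀ ρ : ℝ, 0 ≤ ρ → ρ < 1 →
      ∀ w : Sph n → ℝ, Continuous w → ∀ t : ℝ, 0 < t →
      (sigma n).real {z | 2 * t ≤ ‖cauchyInt (fun ξ => (w ξ : ℂ)) (radial ρ z)‖}
        ≤ A * t ^ (-p) * ∫ ξ, |w ξ| ^ p ∂(sigma n) := by
  obtain ⟨A, hA, hweak⟩ := weak_type_one n
  refine ⟨1 + A, by positivity, ?_⟩
  intro p hp hp2 ρ h0 h1 w hw t ht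
  set w₁ : Sph n → ℝ := fun ξ => max (min (w ξ) t) (-t) with hw₁
  have hw₁c : Continuous w₁ := by fun_prop
  set w₂ : Sph n → ℝ := fun ξ => w ξ - w₁ ξ with hw₂
  have hw₂c : Continuous w₂ := by fun_prop
  have hpc : Continuous fun ξ => |w ξ| ^ p :=
    Continuous.rpow_const hw.abs fun _ => Or.inr (by linarith)
  have hpi : Integrable (fun ξ => |w ξ| ^ p) (sigma n) := Continuous.integrable_sphere hpc
  have hb1 : ∀ ξ, w₁ ξ ^ 2 ≤ t ^ (2 - p) * |w ξ| ^ p := by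
    intro ξ
    have hle : |w₁ ξ| ≤ t := by
      rw [abs_le]
      exact ⟨le_max_right _ _, max_le (min_le_right _ _) (by linarith)⟩
    have hle2 : |w₁ ξ| ≤ |w ξ| := by
      simp only [hw₁]
      rcases le_total (w ξ) t with h | h
      · rw [min_eq_left h]
        rcases le_total (w ξ) (-t) with h' | h'
        · rw [max_eq_right h', abs_of_nonpos (by linarith), abs_of_nonpos (by linarith)]; linarith
        · rw [max_eq_left h']
      · rw [min_eq_right h, max_eq_left (by linarith), abs_of_pos ht, abs_of_nonneg (by linarith)]
        exact h
    rw [← sq_abs]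
    rcases (abs_nonneg (w₁ ξ)).eq_or_lt with h | h
    · rw [← h, zero_pow two_ne_zero]; positivity
    · calc |w₁ ξ| ^ 2 = |w₁ ξ| ^ (2 - p) * |w₁ ξ| ^ p := by
            rw [← Real.rpow_add h, ← Real.rpow_natCast]; congr 1; push_cast; ring
        _ ≤ _ := mul_le_mul (Real.rpow_le_rpow h.le hle (by linarith))
            (Real.rpow_le_rpow h.le hle2 (by linarith)) (by positivity) (by positivity)
  have hb2 : ∀ ξ, |w₂ ξ| ≤ t ^ (1 - p) * |w ξ| ^ p := by
    intro ξ
    by_cases hle : |w ξ| ≤ t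
    · have h3 : w₂ ξ = 0 := by
        obtain ⟨h4, h5⟩ := abs_le.mp hle
        simp only [hw₂, hw₁]
        rw [min_eq_left h5, max_eq_left h4, sub_self]
      rw [h3, abs_zero]; positivity
    · have hgt := not_le.mp hle
      have h4 : |w₂ ξ| ≤ |w ξ| := by
        simp only [hw₂, hw₁]
        rcases le_total (w ξ) 0 with h | h
        · rw [abs_of_nonpos h] at hgt ⊢
          rw [min_eq_left (by linarith), max_eq_right (by linarith), abs_of_nonpos (by linarith)]
          linarith
        · rw [abs_of_nonneg h] at hgt ⊢
          rw [min_eq_right (by linarith), max_eq_left (by linarith), abs_of_nonneg (by linarith)]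
          linarith
      have hpos : 0 < |w ξ| := by linarith
      refine h4.trans ?_
      calc |w ξ| = |w ξ| ^ (1 - p) * |w ξ| ^ p := by
            rw [← Real.rpow_add hpos]; simp
        _ ≤ _ := mul_le_mul_of_nonneg_right
            (Real.rpow_le_rpow_of_nonpos ht hgt.le (by linarith)) (by positivity)
  have hsub : {z | 2 * t ≤ ‖cauchyInt (fun ξ => (w ξ : ℂ)) (radial ρ z)‖} ⊆
      {z | t ≤ ‖cauchyInt (fun ξ => (w₁ ξ : ℂ)) (radial ρ z)‖} ∪
      {z | t ≤ ‖cauchyInt (fun ξ => (w₂ ξ : ℂ)) (radial ρ z)‖} := by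
    intro z (hz : 2 * t ≤ _)
    have e : cauchyInt (fun ξ => (w ξ : ℂ)) (radial ρ z) =
        cauchyInt (fun ξ => (w₁ ξ : ℂ)) (radial ρ z) + cauchyInt (fun ξ => (w₂ ξ : ℂ)) (radial ρ z) := by
      rw [← cauchyInt_add (Continuous.integrable_sphere (by fun_prop))
        (Continuous.integrable_sphere (by fun_prop)) (norm_radial_lt_one h0 h1 z)]
      congr 1; ext ξ; simp [hw₂]
    by_contra hcon
    rw [Set.mem_union, not_or] at hcon
    have h3 : ‖cauchyInt (fun ξ => (w₁ ξ : ℂ)) (radial ρ z)‖ < t := not_le.mp fun h => hcon.1 h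
    have h4 : ‖cauchyInt (fun ξ => (w₂ ξ : ℂ)) (radial ρ z)‖ < t := not_le.mp fun h => hcon.2 h
    rw [e] at hz
    linarith [norm_add_le (cauchyInt (fun ξ => (w₁ ξ : ℂ)) (radial ρ z))
      (cauchyInt (fun ξ => (w₂ ξ : ℂ)) (radial ρ z))]
  refine (measureReal_mono hsub).trans ((measureReal_union_le _ _).trans ?_)
  have hm1 := measureReal_cauchyInt_le_sq (Continuous.integrable_sphere hw₁c)
    (Continuous.integrable_sphere (hw₁c.pow 2)) h0 h1 ht
  have hm2 := hweak ρ h0 h1 w₂ hw₂c t ht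
  have hi1 := integral_mono (Continuous.integrable_sphere (hw₁c.pow 2)) (hpi.const_mul _) hb1
  have hi2 := integral_mono (Continuous.integrable_sphere hw₂c.abs) (hpi.const_mul _) hb2
  rw [integral_const_mul] at hi1 hi2
  set V := ∫ ξ, |w ξ| ^ p ∂(sigma n) with hV
  have e1 : t ^ (2 - p) * V / t ^ 2 = t ^ (-p) * V := by
    rw [Real.rpow_sub ht, Real.rpow_neg ht.le, Real.rpow_two]
    field_simp
  have e2 : A / t * (t ^ (1 - p) * V) = A * t ^ (-p) * V := by
    rw [Real.rpow_sub ht, Real.rpow_neg ht.le, Real.rpow_one]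
    field_simp
  have k1 := hm1.trans (div_le_div_of_nonneg_right hi1 (by positivity))
  have k2 := hm2.trans (mul_le_mul_of_nonneg_left hi2 (by positivity))
  rw [e1] at k1
  rw [e2] at k2
  calc _ ≤ t ^ (-p) * V + A * t ^ (-p) * V := add_le_add k1 k2
    _ = _ := by ring

/-- A linear substitute for Hölder's inequality: integrating it and choosing the level `l` to
balance the two terms gives the same powers, with constants that do not degenerate as `p` varies. -/
lemma le_add_rpow {p l x : ℝ} (hp : 1 ≤ p) (hl : 0 < l) (hx : 0 ≤ x) :
    x ≤ l + l ^ (1 - p) * x ^ p := by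
  rcases le_total x l with h | h
  · have : 0 ≤ l ^ (1 - p) * x ^ p := by positivity
    linarith
  · have hx0 : 0 < x := hl.trans_le h
    have h1 : x = x ^ (1 - p) * x ^ p := by rw [← Real.rpow_add hx0]; simp
    have h2 : x ^ (1 - p) * x ^ p ≤ l ^ (1 - p) * x ^ p :=
      mul_le_mul_of_nonneg_right (Real.rpow_le_rpow_of_nonpos hl h (by linarith)) (by positivity)
    linarith

/-- The Cauchy integral of an `Lᵖ` function belongs to weak `Lᵖ`, uniformly in the radius. -/
lemma exists_weak_bound [NeZero n] {p : ℝ} (hp : 1 < p) (hp2 : p ≤ 2) {u : Sph n → ℝ}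
    (hu : Integrable u (sigma n)) (hup : Integrable (fun ξ => |u ξ| ^ p) (sigma n)) :
    ∃ N : ℝ, 0 ≤ N ∧ ∀ ρ : ℝ, 0 ≤ ρ → ρ < 1 → ∀ t : ℝ, 0 < t →
      (sigma n).real {z | t ≤ ‖cauchyInt (fun ξ => (u ξ : ℂ)) (radial ρ z)‖} ≤ N * t ^ (-p) := by
  obtain ⟨A, hA, hweak⟩ := weak_type_p n
  set V := ∫ ξ, |u ξ| ^ p ∂(sigma n) with hV
  have hV0 : 0 ≤ V := integral_nonneg fun _ => by positivity
  refine ⟨A * 3 ^ p * (2 ^ p * (V + 1)), by positivity, ?_⟩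
  intro ρ h0 h1 t ht
  have hρ : 0 < 1 - ρ := by linarith
  -- The approximation error may depend on `ρ` and `t`: it has to absorb the crude factor `(1 -
  -- ρ)⁻ⁿ` so that the two Cauchy integrals differ by at most `t/3`. The resulting bound does not
  -- see `η`, because `∫ |w| ^ p ≤ 2 ^ p (V + 1)` whenever `η ≤ 1`.
  set η := min 1 ((1 - ρ) ^ n * (t / 3) / 4) with hη
  have hη0 : 0 < η := lt_min one_pos (by positivity)
  have hmem : MemLp u (ENNReal.ofReal p) (sigma n) := by
    rw [← integrable_norm_rpow_iff hu.1 (by simp; linarith) (by simp),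
      ENNReal.toReal_ofReal (by linarith)]
    exact hup
  obtain ⟨w, hw, hwm⟩ := hmem.exists_boundedContinuous_integral_rpow_sub_le (by linarith)
    (show 0 < η ^ p by positivity)
  have hwc : Continuous w := w.continuous
  have hwi : Integrable w (sigma n) := Continuous.integrable_sphere hwc
  have hdi : Integrable (fun ξ => |u ξ - w ξ| ^ p) (sigma n) := by
    have := (hmem.sub hwm).integrable_norm_rpow (by simp; linarith) (by simp)
    rw [ENNReal.toReal_ofReal (by linarith)] at this
    exact this
  have hw' : ∫ ξ, |u ξ - w ξ| ^ p ∂(sigma n) ≤ η ^ p := hw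
  have hL1 : ∫ ξ, |u ξ - w ξ| ∂(sigma n) ≤ 2 * η := by
    have h2 : ∫ ξ, |u ξ - w ξ| ∂(sigma n) ≤
        ∫ ξ, (η + η ^ (1 - p) * |u ξ - w ξ| ^ p) ∂(sigma n) :=
      integral_mono (hu.sub hwi).abs ((integrable_const _).add (hdi.const_mul _))
        fun ξ => le_add_rpow hp.le hη0 (abs_nonneg _)
    rw [integral_add (integrable_const _) (hdi.const_mul _), integral_const_mul, integral_const,
      probReal_univ, one_smul] at h2
    have h3 : η ^ (1 - p) * ∫ ξ, |u ξ - w ξ| ^ p ∂(sigma n) ≤ η ^ (1 - p) * η ^ p :=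
      mul_le_mul_of_nonneg_left hw' (by positivity)
    rw [← Real.rpow_add hη0, show 1 - p + p = 1 by ring, Real.rpow_one] at h3
    linarith
  have hwp : ∫ ξ, |w ξ| ^ p ∂(sigma n) ≤ 2 ^ p * (V + 1) := by
    have hpt : ∀ ξ, |w ξ| ^ p ≤ 2 ^ p * (|u ξ| ^ p + |u ξ - w ξ| ^ p) := by
      intro ξ
      have h2 : |w ξ| ≤ 2 * max |u ξ| |u ξ - w ξ| := by
        have : |w ξ| ≤ |u ξ| + |u ξ - w ξ| := by
          have := abs_sub (u ξ) (u ξ - w ξ)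
          rwa [sub_sub_cancel] at this
        linarith [le_max_left |u ξ| |u ξ - w ξ|, le_max_right |u ξ| |u ξ - w ξ|]
      refine (Real.rpow_le_rpow (abs_nonneg _) h2 (by linarith)).trans ?_
      rw [Real.mul_rpow (by norm_num) (le_max_of_le_left (abs_nonneg _))]
      refine mul_le_mul_of_nonneg_left ?_ (by positivity)
      have h3 : 0 ≤ |u ξ| ^ p := by positivity
      have h4 : 0 ≤ |u ξ - w ξ| ^ p := by positivity
      rcases le_total |u ξ| |u ξ - w ξ| with h | h
      · rw [max_eq_right h]; linarith
      · rw [max_eq_left h]; linarith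
    have hwpi : Integrable (fun ξ => |w ξ| ^ p) (sigma n) :=
      Continuous.integrable_sphere (Continuous.rpow_const hwc.abs fun _ => Or.inr (by linarith))
    refine (integral_mono hwpi ((hup.add hdi).const_mul _) hpt).trans ?_
    rw [integral_const_mul, integral_add' hup hdi]
    refine mul_le_mul_of_nonneg_left ?_ (by positivity)
    have : η ^ p ≤ 1 := Real.rpow_le_one hη0.le (min_le_left _ _) (by linarith)
    linarith
  have hsub : {z | t ≤ ‖cauchyInt (fun ξ => (u ξ : ℂ)) (radial ρ z)‖} ⊆
      {z | 2 * (t / 3) ≤ ‖cauchyInt (fun ξ => (w ξ : ℂ)) (radial ρ z)‖} := by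
    intro z (hz : t ≤ _)
    change 2 * (t / 3) ≤ _
    have hzn := norm_radial_lt_one h0 h1 z
    have huC : Integrable (fun ξ => (u ξ : ℂ)) (sigma n) := hu.ofReal
    have hwC : Integrable (fun ξ => (w ξ : ℂ)) (sigma n) := hwi.ofReal
    have e := cauchyInt_sub huC hwC hzn
    have h2 := norm_cauchyInt_le (huC.sub hwC) hzn
    rw [e, norm_radial h0] at h2
    have h3 : ∫ ξ, ‖((fun ξ => (u ξ : ℂ)) - fun ξ => (w ξ : ℂ)) ξ‖ ∂(sigma n)
        = ∫ ξ, |u ξ - w ξ| ∂(sigma n) := by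
      congr 1; ext ξ
      rw [Pi.sub_apply, ← Complex.ofReal_sub, Complex.norm_real, Real.norm_eq_abs]
    rw [h3] at h2
    have h4 : ((1 - ρ) ^ n)⁻¹ * ∫ ξ, |u ξ - w ξ| ∂(sigma n) ≤ t / 3 := by
      rw [inv_mul_le_iff₀ (by positivity)]
      have := min_le_right 1 ((1 - ρ) ^ n * (t / 3) / 4)
      rw [← hη] at this
      have h5 : 0 < (1 - ρ) ^ n * (t / 3) := by positivity
      linarith
    have h5 := norm_sub_norm_le (cauchyInt (fun ξ => (u ξ : ℂ)) (radial ρ z))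
      (cauchyInt (fun ξ => (w ξ : ℂ)) (radial ρ z))
    linarith
  refine (measureReal_mono hsub).trans ((hweak p hp hp2 ρ h0 h1 w hwc (t / 3) (by positivity)).trans ?_)
  have e : (t / 3) ^ (-p) = 3 ^ p * t ^ (-p) := by
    rw [Real.div_rpow ht.le (by norm_num), Real.rpow_neg (by norm_num : (0 : ℝ) ≤ 3), div_inv_eq_mul,
      mul_comm]
  rw [e]
  calc A * (3 ^ p * t ^ (-p)) * ∫ ξ, |w ξ| ^ p ∂(sigma n)
      ≤ A * (3 ^ p * t ^ (-p)) * (2 ^ p * (V + 1)) :=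
        mul_le_mul_of_nonneg_left hwp (by positivity)
    _ = _ := by ring

/-! ### Uniform integrability and the Poisson representation of the logarithm -/

/-- Functions that are uniformly in weak `Lᵖ`, `p > 1`, have uniformly small tails. -/
lemma integral_tail_le [NeZero n] {p : ℝ} (hp : 1 < p) {X : Sph n → ℝ} (hX : Continuous X)
    {N t₀ : ℝ} (hN : 0 ≤ N) (ht₀ : 0 < t₀)
    (hweak : ∀ t, t₀ ≤ t → (sigma n).real {z | t ≤ X z} ≤ N * t ^ (-p)) :
    ∫ z, {z | t₀ ≤ X z}.indicator X z ∂(sigma n) ≤ 2 * N * (1 - 2 ^ (1 - p))⁻¹ * t₀ ^ (1 - p) := by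
  have hq0 : (0 : ℝ) < 2 ^ (1 - p) := by positivity
  have hq1 : (2 : ℝ) ^ (1 - p) < 1 := Real.rpow_lt_one_of_one_lt_of_neg (by norm_num) (by linarith)
  obtain ⟨M, hM⟩ := isCompact_univ.exists_bound_of_continuousOn hX.continuousOn
  obtain ⟨K, hK⟩ := pow_unbounded_of_one_lt (M / t₀) (by norm_num : (1 : ℝ) < 2)
  rw [div_lt_iff₀ ht₀] at hK
  have hmeas : ∀ t, MeasurableSet {z | t ≤ X z} := fun t =>
    (isClosed_le continuous_const hX).measurableSet
  have hpt : ∀ z, {z | t₀ ≤ X z}.indicator X z ≤ ∑ k ∈ Finset.range (K + 1),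
      {z | 2 ^ k * t₀ ≤ X z}.indicator (fun _ => 2 ^ (k + 1) * t₀) z := by
    intro z
    have hnn : ∀ k ∈ Finset.range (K + 1), (0 : ℝ) ≤
        {z | 2 ^ k * t₀ ≤ X z}.indicator (fun _ => 2 ^ (k + 1) * t₀) z :=
      fun k _ => Set.indicator_nonneg (fun _ _ => by positivity) _
    by_cases hz : t₀ ≤ X z
    swap
    · rw [Set.indicator_of_notMem (show z ∉ {z | t₀ ≤ X z} from hz)]
      exact Finset.sum_nonneg hnn
    rw [Set.indicator_of_mem (show z ∈ {z | t₀ ≤ X z} from hz)]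
    have hKz : X z < 2 ^ (K + 1) * t₀ := by
      have h1 := (le_abs_self _).trans (hM z (Set.mem_univ _))
      have h2 : 0 < 2 ^ K * t₀ := by positivity
      rw [pow_succ]; linarith
    have hex : ∃ k, X z < 2 ^ (k + 1) * t₀ := ⟨K, hKz⟩
    classical
    set k := Nat.find hex with hk
    have hk1 : X z < 2 ^ (k + 1) * t₀ := Nat.find_spec hex
    have hkK : k ≤ K := Nat.find_min' hex hKz
    have hk2 : 2 ^ k * t₀ ≤ X z := by
      rcases Nat.eq_zero_or_pos k with h | h
      · rw [h]; simpa using hz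
      · have := Nat.find_min hex (m := k - 1) (by omega)
        rw [not_lt, Nat.sub_add_cancel h] at this
        exact this
    refine le_trans ?_ (Finset.single_le_sum hnn (Finset.mem_range.mpr (Nat.lt_succ_of_le hkK)))
    rw [Set.indicator_of_mem (show z ∈ {z | 2 ^ k * t₀ ≤ X z} from hk2)]
    exact hk1.le
  have hi : ∀ k : ℕ, Integrable ({z | 2 ^ k * t₀ ≤ X z}.indicator
      (fun _ => (2 : ℝ) ^ (k + 1) * t₀)) (sigma n) := fun k =>
    (integrable_const _).indicator (hmeas _)
  calc ∫ z, {z | t₀ ≤ X z}.indicator X z ∂(sigma n)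
      ≤ ∫ z, ∑ k ∈ Finset.range (K + 1),
          {z | 2 ^ k * t₀ ≤ X z}.indicator (fun _ => (2 : ℝ) ^ (k + 1) * t₀) z ∂(sigma n) :=
        integral_mono ((Continuous.integrable_sphere hX).indicator (hmeas _))
          (integrable_finsetSum _ fun k _ => hi k) hpt
    _ = ∑ k ∈ Finset.range (K + 1),
          (sigma n).real {z | 2 ^ k * t₀ ≤ X z} * (2 ^ (k + 1) * t₀) := by
        rw [integral_finsetSum _ fun k _ => hi k]
        refine Finset.sum_congr rfl fun k _ => ?_
        rw [integral_indicator (hmeas _), setIntegral_const, smul_eq_mul]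
    _ ≤ ∑ k ∈ Finset.range (K + 1), 2 * N * t₀ ^ (1 - p) * ((2 : ℝ) ^ (1 - p)) ^ k := by
        refine Finset.sum_le_sum fun k _ => ?_
        have hk1 : (1 : ℝ) ≤ 2 ^ k := one_le_pow₀ (by norm_num)
        have h1 := hweak (2 ^ k * t₀) (by nlinarith)
        refine (mul_le_mul_of_nonneg_right h1 (by positivity)).trans (le_of_eq ?_)
        have h2 : ((2 : ℝ) ^ (1 - p)) ^ k = ((2 : ℝ) ^ k) ^ (1 - p) := by
          rw [← Real.rpow_natCast, ← Real.rpow_natCast, ← Real.rpow_mul (by norm_num),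
            ← Real.rpow_mul (by norm_num), mul_comm]
        have h3 : ∀ x : ℝ, 0 < x → x ^ (1 - p) = x * x ^ (-p) := by
          intro x hx
          rw [sub_eq_add_neg, Real.rpow_add hx, Real.rpow_one]
        rw [h2, h3 _ ht₀, h3 _ (by positivity), Real.mul_rpow (by positivity) ht₀.le]
        ring
    _ = 2 * N * t₀ ^ (1 - p) * ∑ k ∈ Finset.range (K + 1), ((2 : ℝ) ^ (1 - p)) ^ k := by
        rw [Finset.mul_sum]
    _ ≤ 2 * N * t₀ ^ (1 - p) * (1 - 2 ^ (1 - p))⁻¹ := by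
        refine mul_le_mul_of_nonneg_left ?_ (by positivity)
        rw [← tsum_geometric_of_lt_one hq0.le hq1]
        exact (summable_geometric_of_lt_one hq0.le hq1).sum_le_tsum _ fun _ _ => by positivity
    _ = _ := by ring

/-- The holomorphic function whose exponential is the outer function with modulus `exp u`. -/
def outerLog (u : Sph n → ℝ) (z : Cn n) : ℂ :=
  2 * cauchyInt (fun ξ => (u ξ : ℂ)) z - ((∫ ξ, u ξ ∂(sigma n) : ℝ) : ℂ)

lemma outerLog_eq {u : Sph n → ℝ} (hu : Integrable u (sigma n)) {z : Cn n} (hz : ‖z‖ < 1) :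
    ∫ ξ : Sph n, (2 * cauchyKernel z (ξ : Cn n) - 1) * (u ξ : ℂ) ∂(sigma n) = outerLog u z := by
  have huC : Integrable (fun ξ => (u ξ : ℂ)) (sigma n) := hu.ofReal
  have e : ∀ ξ : Sph n, (2 * cauchyKernel z (ξ : Cn n) - 1) * (u ξ : ℂ)
      = 2 * (cauchyKernel z (ξ : Cn n) * (u ξ : ℂ)) - (u ξ : ℂ) := fun ξ => by ring
  simp only [e]
  rw [integral_sub ((integrable_cauchyKernel_mul huC hz).const_mul 2) huC, integral_const_mul,
    integral_complex_ofReal]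
  rfl

lemma differentiableOn_outerLog {u : Sph n → ℝ} (hu : Integrable u (sigma n)) :
    DifferentiableOn ℂ (outerLog u) (Metric.ball 0 1) :=
  ((differentiableOn_cauchyInt (u := fun ξ => (u ξ : ℂ)) hu.ofReal).const_mul 2).sub_const _

lemma radial_eq (ρ : ℝ) (ξ : Sph n) : radial ρ ξ = ρ • (ξ : Cn n) := Complex.coe_smul ρ _

/-- Holomorphic functions on the ball, at smaller radii, are reproduced by the Poisson kernel. -/
lemma integral_poisson_mul_radial [NeZero n] {F : Cn n → ℂ}
    (hF : DifferentiableOn ℂ F (Metric.ball 0 1)) {ρ : ℝ} (h0 : 0 ≤ ρ) (h1 : ρ < 1)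
    {z : Cn n} (hz : ‖z‖ < 1) :
    ∫ ξ : Sph n, (poisson z ξ : ℂ) * F (radial ρ ξ) ∂(sigma n) = F ((ρ : ℂ) • z) := by
  have hR : 1 < 2 / (1 + ρ) := by rw [lt_div_iff₀ (by linarith)]; linarith
  have hd : DifferentiableOn ℂ (fun w : Cn n => F ((ρ : ℂ) • w)) (Metric.ball 0 (2 / (1 + ρ))) := by
    refine hF.comp (by fun_prop) ?_
    intro w hw
    have hw' : ‖w‖ < 2 / (1 + ρ) := by simpa using hw
    rw [lt_div_iff₀ (by linarith)] at hw'
    simp only [mem_ball_zero_iff, norm_smul, Complex.norm_real, Real.norm_of_nonneg h0]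
    nlinarith [norm_nonneg w]
  exact integral_poisson_mul hR hd hz

lemma tendsto_radii : Tendsto (fun k : ℕ => 1 - 1 / ((k : ℝ) + 1)) atTop (𝓝[<] 1) := by
  refine tendsto_nhdsWithin_iff.mpr ⟨?_, Eventually.of_forall fun k => ?_⟩
  · simpa using (tendsto_one_div_add_atTop_nhds_zero_nat (𝕜 := ℝ)).const_sub 1
  · have : 0 < 1 / ((k : ℝ) + 1) := by positivity
    simp only [Set.mem_Iio]; linarith

lemma radii_mem (k : ℕ) : 0 ≤ 1 - 1 / ((k : ℝ) + 1) ∧ 1 - 1 / ((k : ℝ) + 1) < 1 := by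
  have h1 : 0 < 1 / ((k : ℝ) + 1) := by positivity
  have h2 : 1 / ((k : ℝ) + 1) ≤ 1 := by
    rw [div_le_one (by positivity)]
    have : (0 : ℝ) ≤ k := Nat.cast_nonneg k
    linarith
  constructor <;> linarith

lemma tendsto_radii_smul {F : Cn n → ℂ} (hF : DifferentiableOn ℂ F (Metric.ball 0 1)) {z : Cn n}
    (hz : ‖z‖ < 1) :
    Tendsto (fun k : ℕ => F (((1 - 1 / ((k : ℝ) + 1) : ℝ) : ℂ) • z)) atTop (𝓝 (F z)) := by
  have hc : ContinuousAt F z :=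
    hF.continuousOn.continuousAt (Metric.isOpen_ball.mem_nhds (by simpa using hz))
  refine hc.tendsto.comp ?_
  have h1 : Tendsto (fun k : ℕ => (((1 - 1 / ((k : ℝ) + 1) : ℝ) : ℂ) • z)) atTop
      (𝓝 (((1 : ℝ) : ℂ) • z)) :=
    ((Complex.continuous_ofReal.tendsto 1).comp
      (tendsto_radii.mono_right nhdsWithin_le_nhds)).smul_const z
  simpa using h1

/-- If the real part of `outerLog u` has radial limits `u`, it is the Poisson integral of `u`. -/
lemma re_outerLog_eq_poisson [NeZero n] {p : ℝ} (hp : 1 < p) (hp2 : p ≤ 2) {u : Sph n → ℝ}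
    (hu : Integrable u (sigma n)) (hup : Integrable (fun ξ => |u ξ| ^ p) (sigma n))
    (hlim : ∀ᵐ ξ : Sph n ∂(sigma n),
      Tendsto (fun ρ : ℝ => (outerLog u (radial ρ ξ)).re) (𝓝[<] 1) (𝓝 (u ξ)))
    {z : Cn n} (hz : ‖z‖ < 1) :
    (outerLog u z).re = ∫ ξ : Sph n, poisson z ξ * u ξ ∂(sigma n) := by
  obtain ⟨N, hN, hweak⟩ := exists_weak_bound hp hp2 hu hup
  have huC : Integrable (fun ξ => (u ξ : ℂ)) (sigma n) := hu.ofReal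
  set m := |∫ ξ, u ξ ∂(sigma n)| with hm
  set r : ℕ → ℝ := fun k => 1 - 1 / ((k : ℝ) + 1) with hr
  have hr0 : ∀ k, 0 ≤ r k := fun k => (radii_mem k).1
  have hr1 : ∀ k, r k < 1 := fun k => (radii_mem k).2
  set U : ℕ → Sph n → ℝ := fun k ξ => (outerLog u (radial (r k) ξ)).re with hU
  have hUc : ∀ k, Continuous (U k) := by
    intro k
    have := continuous_cauchyInt_radial huC (hr0 k) (hr1 k)
    exact Complex.continuous_re.comp ((continuous_const.mul this).sub continuous_const)
  have hUle : ∀ k ξ, |U k ξ| ≤ 2 * ‖cauchyInt (fun ξ => (u ξ : ℂ)) (radial (r k) ξ)‖ + m := by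
    intro k ξ
    refine (Complex.abs_re_le_norm _).trans ((norm_sub_le _ _).trans ?_)
    rw [norm_mul, Complex.norm_real, Complex.norm_ofNat, Real.norm_eq_abs]
  have hUweak : ∀ k t, max 1 (3 * m) ≤ t →
      (sigma n).real {ξ | t ≤ |U k ξ|} ≤ (N * 3 ^ p) * t ^ (-p) := by
    intro k t ht
    have ht0 : 0 < t := lt_of_lt_of_le one_pos ((le_max_left _ _).trans ht)
    have ht1 : 3 * m ≤ t := (le_max_right _ _).trans ht
    have hsub : {ξ | t ≤ |U k ξ|} ⊆
        {ξ | t / 3 ≤ ‖cauchyInt (fun ξ => (u ξ : ℂ)) (radial (r k) ξ)‖} := by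
      intro ξ (hξ : t ≤ _)
      change t / 3 ≤ _
      have := hUle k ξ
      linarith
    refine (measureReal_mono hsub).trans ((hweak _ (hr0 k) (hr1 k) (t / 3) (by positivity)).trans
      (le_of_eq ?_))
    rw [Real.div_rpow ht0.le (by norm_num), Real.rpow_neg (by norm_num : (0 : ℝ) ≤ 3),
      div_inv_eq_mul]
    ring
  -- The weak `Lᵖ` bound, `p > 1`, is uniform in the radius, so the tails of `U k` are uniformly
  -- small. With almost everywhere convergence, Vitali's theorem then gives convergence in `L¹`, and
  -- the Poisson formula on smaller spheres passes to the limit.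
  have hui : UnifIntegrable U 1 (sigma n) := by
    refine unifIntegrable_of le_rfl ENNReal.one_ne_top
      (fun k => (hUc k).aestronglyMeasurable) fun ε hε => ?_
    have htend : Tendsto (fun t : ℝ => 2 * (N * 3 ^ p) * (1 - 2 ^ (1 - p))⁻¹ * t ^ (1 - p)) atTop
        (𝓝 0) := by
      have := (tendsto_rpow_neg_atTop (show 0 < p - 1 by linarith)).const_mul
        (2 * (N * 3 ^ p) * (1 - (2 : ℝ) ^ (1 - p))⁻¹)
      rw [mul_zero, neg_sub] at this
      exact this
    obtain ⟨t, htε, ht⟩ := ((htend.eventually (gt_mem_nhds hε)).and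
      (eventually_ge_atTop (max 1 (3 * m)))).exists
    have ht0 : 0 < t := lt_of_lt_of_le one_pos ((le_max_left _ _).trans ht)
    refine ⟨t.toNNReal, fun k => ?_⟩
    have htail := integral_tail_le hp (X := fun ξ => |U k ξ|) (hUc k).abs
      (N := N * 3 ^ p) (by positivity) ht0 (fun s hs => hUweak k s (ht.trans hs))
    have hset : {ξ | t.toNNReal ≤ ‖U k ξ‖₊} = {ξ | t ≤ |U k ξ|} := by
      ext ξ
      exact Real.toNNReal_le_iff_le_coe
    rw [hset]
    have hms : MeasurableSet {ξ | t ≤ |U k ξ|} :=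
      (isClosed_le continuous_const (hUc k).abs).measurableSet
    have hint : Integrable ({ξ | t ≤ |U k ξ|}.indicator (U k)) (sigma n) :=
      (Continuous.integrable_sphere (hUc k)).indicator hms
    rw [eLpNorm_one_eq_lintegral_enorm, ← ofReal_integral_norm_eq_lintegral_enorm hint]
    refine ENNReal.ofReal_le_ofReal (le_trans (le_of_eq ?_) (htail.trans htε.le))
    congr 1
    ext ξ
    by_cases hξ : ξ ∈ {ξ | t ≤ |U k ξ|}
    · rw [Set.indicator_of_mem hξ, Set.indicator_of_mem hξ, Real.norm_eq_abs]
    · rw [Set.indicator_of_notMem hξ, Set.indicator_of_notMem hξ, norm_zero]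
  have hL1 := tendsto_Lp_finite_of_tendsto_ae le_rfl ENNReal.one_ne_top
    (fun k => (hUc k).aestronglyMeasurable) (memLp_one_iff_integrable.mpr hu) hui
    (by filter_upwards [hlim] with ξ hξ
        exact hξ.comp tendsto_radii)
  have hUi : ∀ k, Integrable (U k) (sigma n) := fun k => Continuous.integrable_sphere (hUc k)
  obtain ⟨M, hM⟩ := isCompact_univ.exists_bound_of_continuousOn (continuous_poisson hz).continuousOn
  have hPi : ∀ {v : Sph n → ℝ}, Integrable v (sigma n) →
      Integrable (fun ξ : Sph n => poisson z ξ * v ξ) (sigma n) := fun hv =>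
    Integrable.bdd_mul (c := M) hv (continuous_poisson hz).aestronglyMeasurable
      (Eventually.of_forall fun ξ => hM ξ (Set.mem_univ _))
  have hconv : Tendsto (fun k => ∫ ξ : Sph n, poisson z ξ * U k ξ ∂(sigma n)) atTop
      (𝓝 (∫ ξ : Sph n, poisson z ξ * u ξ ∂(sigma n))) := by
    refine tendsto_integral_of_L1' _ (hPi hu).1 (Eventually.of_forall fun k => hPi (hUi k)) ?_
    have hM0 : 0 ≤ M := (norm_nonneg _).trans (hM (one n) (Set.mem_univ _))
    have hb : ∀ k, eLpNorm ((fun ξ : Sph n => poisson z ξ * U k ξ) - fun ξ : Sph n => poisson z ξ * u ξ)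
        1 (sigma n) ≤ ENNReal.ofReal M * eLpNorm (U k - u) 1 (sigma n) := by
      intro k
      refine eLpNorm_le_mul_eLpNorm_of_ae_le_mul (Eventually.of_forall fun ξ => ?_) 1
      simp only [Pi.sub_apply]
      rw [← mul_sub, norm_mul]
      exact mul_le_mul_of_nonneg_right (hM ξ (Set.mem_univ _)) (norm_nonneg _)
    refine tendsto_of_tendsto_of_tendsto_of_le_of_le tendsto_const_nhds ?_ (fun _ => bot_le) hb
    have := ENNReal.Tendsto.const_mul (a := ENNReal.ofReal M) hL1 (Or.inr ENNReal.ofReal_ne_top)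
    rwa [mul_zero] at this
  have hrep : ∀ k, ∫ ξ : Sph n, poisson z ξ * U k ξ ∂(sigma n)
      = (outerLog u ((r k : ℂ) • z)).re := by
    intro k
    have h2 := integral_poisson_mul_radial (differentiableOn_outerLog hu) (hr0 k) (hr1 k) hz
    rw [← h2]
    have hcc : Continuous fun ξ : Sph n => outerLog u (radial (r k) ξ) := by
      have := continuous_cauchyInt_radial huC (hr0 k) (hr1 k)
      exact (continuous_const.mul this).sub continuous_const
    have hint : Integrable (fun ξ : Sph n => (poisson z ξ : ℂ) * outerLog u (radial (r k) ξ))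
        (sigma n) := Continuous.integrable_sphere
      ((Complex.continuous_ofReal.comp (continuous_poisson hz)).mul hcc)
    have h3 := integral_re hint
    simp only [RCLike.re_eq_complex_re] at h3
    rw [← h3]
    congr 1; ext ξ
    rw [Complex.re_ofReal_mul]
  have hlim2 : Tendsto (fun k => (outerLog u ((r k : ℂ) • z)).re) atTop (𝓝 (outerLog u z).re) :=
    (Complex.continuous_re.tendsto _).comp (tendsto_radii_smul (differentiableOn_outerLog hu) hz)
  refine tendsto_nhds_unique hlim2 ?_
  simpa only [hrep] using hconv

/-! ### Boundary behaviour of outer functions -/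

lemma integrable_poisson_mul [NeZero n] {z : Cn n} (hz : ‖z‖ < 1) {v : Sph n → ℝ}
    (hv : Integrable v (sigma n)) :
    Integrable (fun ξ : Sph n => poisson z ξ * v ξ) (sigma n) := by
  obtain ⟨M, hM⟩ := isCompact_univ.exists_bound_of_continuousOn (continuous_poisson hz).continuousOn
  exact Integrable.bdd_mul (c := M) hv (continuous_poisson hz).aestronglyMeasurable
    (Eventually.of_forall fun ξ => hM ξ (Set.mem_univ _))

lemma IsOuter.eq_exp_outerLog {f : Cn n → ℂ} (hf : IsOuter f) {z : Cn n} (hz : ‖z‖ < 1) :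
    f z = Complex.exp (outerLog (fun ξ : Sph n => Real.log ‖f ξ‖) z) := by
  rw [hf.eq_exp z (by simpa using hz), ← outerLog_eq hf.integrable_log hz]

lemma IsOuter.differentiableOn {f : Cn n → ℂ} (hf : IsOuter f) :
    DifferentiableOn ℂ f (Metric.ball 0 1) :=
  (differentiableOn_outerLog hf.integrable_log).cexp.congr fun z hz =>
    hf.eq_exp_outerLog (by simpa using hz)

/-- The modulus of an outer function with `log |f| ∈ Lᵖ`, `p > 1`, is the exponential of the
Poisson integral of `log |f|`. -/
lemma IsOuter.norm_eq_exp_poisson [NeZero n] {f : Cn n → ℂ} (hf : IsOuter f) {p : ℝ} (hp : 1 < p)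
    (hup : Integrable (fun ξ : Sph n => |Real.log ‖f ξ‖| ^ p) (sigma n)) {z : Cn n}
    (hz : ‖z‖ < 1) :
    ‖f z‖ = Real.exp (∫ ξ : Sph n, poisson z ξ * Real.log ‖f ξ‖ ∂(sigma n)) := by
  -- The weak-type theory is available for exponents at most 2, so the integrability exponent is
  -- lowered.
  have hmin : 1 < min p 2 := lt_min hp (by norm_num)
  have hup' : Integrable (fun ξ : Sph n => |Real.log ‖f ξ‖| ^ min p 2) (sigma n) := by
    refine ((integrable_const (1 : ℝ)).add hup).mono'
      (hf.integrable_log.1.norm.aemeasurable.pow_const _).aestronglyMeasurable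
      (Eventually.of_forall fun ξ => ?_)
    set x := |Real.log ‖f ξ‖| with hx
    have hx0 : 0 ≤ x := abs_nonneg _
    rw [Real.norm_of_nonneg (by positivity)]
    change x ^ min p 2 ≤ 1 + x ^ p
    rcases le_total x 1 with h | h
    · have := Real.rpow_le_one hx0 h (by linarith : 0 ≤ min p 2)
      have : 0 ≤ x ^ p := by positivity
      linarith
    · have := Real.rpow_le_rpow_of_exponent_le h (min_le_left p 2)
      linarith
  rw [hf.eq_exp_outerLog hz, Complex.norm_exp,
    re_outerLog_eq_poisson hmin (min_le_right _ _) hf.integrable_log hup' ?_ hz]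
  filter_upwards [hf.boundary, hf.ne_zero] with ξ hξ hne
  have h1 : Tendsto (fun ρ : ℝ => Real.log ‖f (ρ • (ξ : Cn n))‖) (𝓝[<] 1) (𝓝 (Real.log ‖f ξ‖)) :=
    hξ.norm.log (norm_ne_zero_iff.mpr hne)
  refine h1.congr' ?_
  have hmem : Set.Ioo (0 : ℝ) 1 ∈ 𝓝[<] (1 : ℝ) := Ioo_mem_nhdsLT one_pos
  filter_upwards [hmem] with ρ hρ
  rw [← radial_eq, hf.eq_exp_outerLog (norm_radial_lt_one hρ.1.le hρ.2 ξ), Complex.norm_exp,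
    Real.log_exp]

/-- The Poisson integral of `log |f|` is an average, so it does not exceed `log M`. -/
lemma IsOuter.norm_le [NeZero n] {f : Cn n → ℂ} (hf : IsOuter f) {p : ℝ} (hp : 1 < p)
    (hup : Integrable (fun ξ : Sph n => |Real.log ‖f ξ‖| ^ p) (sigma n)) {M : ℝ} (hM : 1 ≤ M)
    (hb : ∀ ξ : Sph n, ‖f ξ‖ ≤ M) {z : Cn n} (hz : ‖z‖ < 1) : ‖f z‖ ≤ M := by
  rw [hf.norm_eq_exp_poisson hp hup hz, ← Real.le_log_iff_exp_le (by linarith)]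
  have hl : ∀ ξ : Sph n, Real.log ‖f ξ‖ ≤ Real.log M := by
    intro ξ
    rcases (norm_nonneg (f ξ)).eq_or_lt with h | h
    -- Here `log 0` is 0 by convention, which is why `M ≥ 1` is required.
    · rw [← h, Real.log_zero]; exact Real.log_nonneg hM
    · exact Real.log_le_log h (hb ξ)
  calc ∫ ξ : Sph n, poisson z ξ * Real.log ‖f ξ‖ ∂(sigma n)
      ≤ ∫ ξ : Sph n, poisson z ξ * Real.log M ∂(sigma n) :=
        integral_mono (integrable_poisson_mul hz hf.integrable_log)
          (integrable_poisson_mul hz (integrable_const _))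
          fun ξ => mul_le_mul_of_nonneg_left (hl ξ) (poisson_nonneg hz _)
    _ = Real.log M := by rw [integral_mul_const, integral_poisson hz, one_mul]

lemma IsOuter.tendsto_radii {f : Cn n → ℂ} (hf : IsOuter f) :
    ∀ᵐ ξ : Sph n ∂(sigma n), Tendsto (fun k : ℕ => f (radial (1 - 1 / ((k : ℝ) + 1)) ξ)) atTop
      (𝓝 (f ξ)) := by
  filter_upwards [hf.boundary] with ξ hξ
  simp only [radial_eq]
  exact hξ.comp BallOuter.tendsto_radii

lemma IsOuter.continuous_radial {f : Cn n → ℂ} (hf : IsOuter f) {ρ : ℝ} (h0 : 0 ≤ ρ) (h1 : ρ < 1) :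
    Continuous fun ξ : Sph n => f (radial ρ ξ) :=
  hf.differentiableOn.continuousOn.comp_continuous (by unfold radial; fun_prop)
    fun ξ => by simpa using norm_radial_lt_one h0 h1 ξ

/-- Measurability on the sphere is not part of the definition; it comes from the radial limits of
continuous functions. -/
lemma IsOuter.integrable [NeZero n] {f : Cn n → ℂ} (hf : IsOuter f) {M : ℝ}
    (hb : ∀ ξ : Sph n, ‖f ξ‖ ≤ M) : Integrable (fun ξ : Sph n => f ξ) (sigma n) := by
  refine Integrable.of_bound (aestronglyMeasurable_of_tendsto_ae atTop
    (fun k : ℕ => (hf.continuous_radial (radii_mem k).1 (radii_mem k).2).aestronglyMeasurable)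
    hf.tendsto_radii) M (Eventually.of_forall hb)

/-- Bounded outer functions are reproduced by the Poisson kernel. -/
lemma IsOuter.eq_integral_poisson [NeZero n] {f : Cn n → ℂ} (hf : IsOuter f) {p : ℝ} (hp : 1 < p)
    (hup : Integrable (fun ξ : Sph n => |Real.log ‖f ξ‖| ^ p) (sigma n)) {M : ℝ} (hM : 1 ≤ M)
    (hb : ∀ ξ : Sph n, ‖f ξ‖ ≤ M) {z : Cn n} (hz : ‖z‖ < 1) :
    f z = ∫ ξ : Sph n, (poisson z ξ : ℂ) * f ξ ∂(sigma n) := by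
  refine tendsto_nhds_unique (tendsto_radii_smul hf.differentiableOn hz) ?_
  simp only [← integral_poisson_mul_radial hf.differentiableOn (radii_mem _).1 (radii_mem _).2 hz]
  have hPc : Continuous fun ξ : Sph n => (poisson z ξ : ℂ) :=
    Complex.continuous_ofReal.comp (continuous_poisson hz)
  refine tendsto_integral_of_dominated_convergence (fun ξ : Sph n => poisson z ξ * M)
    (fun k => (hPc.mul (hf.continuous_radial (radii_mem k).1
      (radii_mem k).2)).aestronglyMeasurable)
    (integrable_poisson_mul hz (integrable_const M)) (fun k => Eventually.of_forall fun ξ => ?_) ?_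
  · rw [norm_mul, Complex.norm_real, Real.norm_of_nonneg (poisson_nonneg hz _)]
    exact mul_le_mul_of_nonneg_left (hf.norm_le hp hup hM hb
      (norm_radial_lt_one (radii_mem k).1 (radii_mem k).2 ξ)) (poisson_nonneg hz _)
  · filter_upwards [hf.tendsto_radii] with ξ hξ
    exact hξ.const_mul _

/-! ### A combination of two Poisson kernels with fast decay -/

/-- On the circle `|⟨ζ,ξ⟩| = 1`, so the kernel is an exact function of the quasidistance.
Cancellation between two kernels needs this equality, not just two-sided bounds. -/
lemma poisson_radial_dim_one (ρ : ℝ) (h0 : 0 ≤ ρ) (ζ ξ : Sph 1) :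
    poisson (radial ρ ζ) (ξ : Cn 1) = (1 - ρ ^ 2) / ((1 - ρ) ^ 2 + ρ * qdist ξ ζ ^ 2) := by
  set c : ℂ := inner ℂ (ξ : Cn 1) (ζ : Cn 1) with hc
  have hcn : ‖c‖ = 1 := by
    have h1 := norm_sph ξ
    have h2 := norm_sph ζ
    rw [EuclideanSpace.norm_eq] at h1 h2
    simp only [Finset.univ_unique, Fin.default_eq_zero, Fin.isValue, Finset.sum_singleton,
      Real.sqrt_sq (norm_nonneg _)] at h1 h2
    rw [hc, PiLp.inner_apply]
    simp [h1, h2]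
  have hcn' : c.re ^ 2 + c.im ^ 2 = 1 := by
    have := Complex.sq_norm c
    rw [hcn, Complex.normSq_apply] at this
    nlinarith
  have e1 : ‖1 - inner ℂ (ξ : Cn 1) (radial ρ ζ)‖ ^ 2 = (1 - ρ) ^ 2 + ρ * qdist ξ ζ ^ 2 := by
    rw [qdist_comm]
    unfold qdist
    rw [inner_smul_right, ← hc, Complex.sq_norm, Complex.sq_norm, Complex.normSq_apply,
      Complex.normSq_apply]
    simp
    nlinarith
  unfold poisson cauchyKernel
  rw [norm_radial h0, pow_one, pow_one, norm_inv, inv_pow, e1]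
  rfl

/-- There is a combination of two Poisson kernels of mass one that is nonnegative, comparable to
`r⁻ⁿ` at distance at most `4 r`, and decays like `r² d⁻ⁿ⁻²`. -/
lemma exists_kernel (n : ℕ) [NeZero n] :
    ∃ K : ℝ, 1 ≤ K ∧ ∀ r : ℝ, 0 < r → r ≤ 1 / 8 → ∃ b ρ₁ ρ₂ : ℝ,
      0 ≤ b ∧ b ≤ 1 ∧ 0 ≤ ρ₁ ∧ ρ₁ < 1 ∧ 0 ≤ ρ₂ ∧ ρ₂ < 1 ∧ ∀ ζ ξ : Sph n,
        poisson (radial ρ₁ ζ) ξ ≤ K * r * (max (qdist ξ ζ) r ^ (n + 1))⁻¹ ∧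
        poisson (radial ρ₂ ζ) ξ ≤ K * r * (max (qdist ξ ζ) r ^ (n + 1))⁻¹ ∧
        0 ≤ (1 + b) * poisson (radial ρ₁ ζ) ξ - b * poisson (radial ρ₂ ζ) ξ ∧
        (1 + b) * poisson (radial ρ₁ ζ) ξ - b * poisson (radial ρ₂ ζ) ξ
          ≤ K * r ^ 2 * (max (qdist ξ ζ) r ^ (n + 2))⁻¹ ∧
        (qdist ξ ζ ≤ 4 * r → 1 ≤ K * r ^ n *
          ((1 + b) * poisson (radial ρ₁ ζ) ξ - b * poisson (radial ρ₂ ζ) ξ)) := by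
  rcases (show n = 1 ∨ 2 ≤ n by have := NeZero.pos n; omega) with rfl | hn
  · refine ⟨100, by norm_num, fun r hr hr8 => ?_⟩
    have hD : 0 < 2 - 3 * r + 2 * r ^ 2 := by nlinarith
    -- This `b` makes the coefficient of `d²` vanish in the numerator of the combined fraction. What
    -- remains is `4 r³ (b + 2 - r)`, so the combination decays like `r³ d⁻⁴`, which is better than
    -- required.
    set b := (2 - 5 * r + 2 * r ^ 2) / (2 - 3 * r + 2 * r ^ 2) with hb
    have hbD : b * (2 - 3 * r + 2 * r ^ 2) = 2 - 5 * r + 2 * r ^ 2 := div_mul_cancel₀ _ hD.ne'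
    have hb0 : 0 ≤ b := div_nonneg (by nlinarith) hD.le
    have hb1 : b ≤ 1 := by rw [hb, div_le_one hD]; linarith
    refine ⟨b, 1 - r, 1 - 2 * r, hb0, hb1, by linarith, by linarith, by linarith, by linarith, ?_⟩
    intro ζ ξ
    rw [poisson_radial_dim_one _ (by linarith), poisson_radial_dim_one _ (by linarith)]
    have hd0 := qdist_nonneg ξ ζ
    set d := qdist ξ ζ
    set m := max d r with hm
    have hm0 : 0 < m := lt_max_of_lt_right hr
    have hrm : r ≤ m := le_max_right _ _
    set X := (1 - (1 - r)) ^ 2 + (1 - r) * d ^ 2 with hX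
    set Y := (1 - (1 - 2 * r)) ^ 2 + (1 - 2 * r) * d ^ 2 with hY
    have hXm : m ^ 2 / 2 ≤ X := by
      rcases max_cases d r with ⟨h, _⟩ | ⟨h, _⟩ <;> rw [hm, h, hX] <;> nlinarith [sq_nonneg d]
    have hYm : m ^ 2 / 2 ≤ Y := by
      rcases max_cases d r with ⟨h, _⟩ | ⟨h, _⟩ <;> rw [hm, h, hY] <;> nlinarith [sq_nonneg d]
    have hm2 : 0 < m ^ 2 / 2 := by positivity
    have hX0 : 0 < X := hm2.trans_le hXm
    have hY0 : 0 < Y := hm2.trans_le hYm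
    have hW : (1 + b) * ((1 - (1 - r) ^ 2) / X) - b * ((1 - (1 - 2 * r) ^ 2) / Y)
        = 4 * r ^ 3 * (b + 2 - r) / (X * Y) := by
      have hnum : (1 + b) * (1 - (1 - r) ^ 2) * Y - b * (1 - (1 - 2 * r) ^ 2) * X
          = 4 * r ^ 3 * (b + 2 - r) := by
        rw [hX, hY]
        linear_combination (-r * d ^ 2) * hbD
      rw [← hnum]
      field_simp
    rw [hW]
    have hXY : m ^ 4 / 4 ≤ X * Y := by nlinarith
    refine ⟨?_, ?_, ?_, ?_, ?_⟩
    · rw [← div_eq_mul_inv, div_le_div_iff₀ hX0 (by positivity)]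
      have : (1 - (1 - r) ^ 2) ≤ 2 * r := by nlinarith
      norm_num
      nlinarith [mul_le_mul_of_nonneg_right this (sq_nonneg m),
        mul_le_mul_of_nonneg_left hXm hr.le]
    · rw [← div_eq_mul_inv, div_le_div_iff₀ hY0 (by positivity)]
      have : (1 - (1 - 2 * r) ^ 2) ≤ 4 * r := by nlinarith
      norm_num
      nlinarith [mul_le_mul_of_nonneg_right this (sq_nonneg m),
        mul_le_mul_of_nonneg_left hYm hr.le]
    · have : 0 ≤ b + 2 - r := by linarith
      positivity
    · rw [← div_eq_mul_inv, div_le_div_iff₀ (by positivity) (by positivity)]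
      have h1 : 4 * r ^ 3 * (b + 2 - r) * m ^ (1 + 2) ≤ 12 * r ^ 3 * m ^ 3 := by
        have : r ^ 3 * m ^ 3 * (b + 2 - r) ≤ r ^ 3 * m ^ 3 * 3 :=
          mul_le_mul_of_nonneg_left (by linarith) (by positivity)
        linarith [show 4 * r ^ 3 * (b + 2 - r) * m ^ (1 + 2)
          = 4 * (r ^ 3 * m ^ 3 * (b + 2 - r)) by ring]
      have h2 : 12 * r ^ 3 * m ^ 3 ≤ 12 * r ^ 2 * m ^ 4 := by
        have : r ^ 2 * m ^ 3 * r ≤ r ^ 2 * m ^ 3 * m :=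
          mul_le_mul_of_nonneg_left hrm (by positivity)
        linarith [show r ^ 2 * m ^ 3 * r = r ^ 3 * m ^ 3 by ring,
          show r ^ 2 * m ^ 3 * m = r ^ 2 * m ^ 4 by ring]
      have h3 : 100 * r ^ 2 * (m ^ 4 / 4) ≤ 100 * r ^ 2 * (X * Y) :=
        mul_le_mul_of_nonneg_left hXY (by positivity)
      have : 0 ≤ r ^ 2 * m ^ 4 := by positivity
      linarith
    · intro h4
      rw [pow_one, ← mul_div_assoc, le_div_iff₀ (by positivity), one_mul]
      have hd2 : d ^ 2 ≤ 16 * r ^ 2 := by nlinarith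
      have hrd : 0 ≤ r * d ^ 2 := by positivity
      have hXu : X ≤ 17 * r ^ 2 := by
        rw [show X = r ^ 2 + d ^ 2 - r * d ^ 2 by rw [hX]; ring]; linarith
      have hYu : Y ≤ 20 * r ^ 2 := by
        rw [show Y = 4 * r ^ 2 + d ^ 2 - 2 * (r * d ^ 2) by rw [hY]; ring]; linarith
      have h1 : X * Y ≤ 340 * r ^ 4 := by
        have := mul_le_mul hXu hYu hY0.le (by positivity)
        linarith [show 17 * r ^ 2 * (20 * r ^ 2) = 340 * r ^ 4 by ring]
      have h5 : r ^ 4 * 1 ≤ r ^ 4 * (b + 2 - r) :=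
        mul_le_mul_of_nonneg_left (by linarith) (by positivity)
      linarith [show 100 * r * (4 * r ^ 3 * (b + 2 - r)) = 400 * (r ^ 4 * (b + 2 - r)) by ring,
        show 0 ≤ r ^ 4 by positivity]
  -- For `n ≥ 2` a single kernel suffices, since `r ^ n d ^ (-2n) ≤ r² d ^ (-n-2)` for `d ≥ r`. The
  -- base `25 = 5²` comes from `d + r ≤ 5 r` in the lower bound.
  · refine ⟨25 ^ n, one_le_pow₀ (by norm_num), fun r hr hr8 => ?_⟩
    refine ⟨0, 1 - r, 1 - r, le_rfl, zero_le_one, by linarith, by linarith, by linarith,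
      by linarith, ?_⟩
    intro ζ ξ
    have h0 : 0 ≤ 1 - r := by linarith
    have h1 : 1 - r < 1 := by linarith
    have hu := poisson_radial_le h0 h1 ζ ξ
    have hl := le_poisson_radial h0 h1 ζ ξ
    rw [sub_sub_cancel] at hu hl
    have hd0 := qdist_nonneg ξ ζ
    set d := qdist ξ ζ
    set m := max d r with hm
    have hm0 : 0 < m := lt_max_of_lt_right hr
    have hrm : r ≤ m := le_max_right _ _
    set P := poisson (radial (1 - r) ζ) (ξ : Cn n)
    have h825 : (8 : ℝ) ^ n ≤ 25 ^ n := pow_le_pow_left₀ (by norm_num) (by norm_num) n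
    have key : ∀ j : ℕ, j ≤ n → P ≤ 25 ^ n * r ^ j * (m ^ (n + j))⁻¹ := by
      intro j hj
      refine hu.trans ?_
      rw [← div_eq_mul_inv, ← div_eq_mul_inv, div_le_div_iff₀ (by positivity) (by positivity)]
      obtain ⟨i, rfl⟩ := Nat.exists_eq_add_of_le hj
      calc (8 : ℝ) ^ (j + i) * r ^ (j + i) * m ^ (j + i + j)
          = 8 ^ (j + i) * (r ^ i * (r ^ j * m ^ (j + i + j))) := by ring
        _ ≤ 25 ^ (j + i) * (m ^ i * (r ^ j * m ^ (j + i + j))) := by gcongr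
        _ = _ := by ring
    have hP0 : 0 ≤ P := le_trans (by positivity) hl
    refine ⟨?_, ?_, ?_, ?_, ?_⟩
    · simpa using key 1 (by omega)
    · simpa using key 1 (by omega)
    · simpa using hP0
    · simpa using key 2 hn
    · intro h4
      have h5 : r ^ n * ((5 * r) ^ (2 * n))⁻¹ ≤ P := by
        refine le_trans ?_ hl
        gcongr
        linarith
      have h6 : 25 ^ n * r ^ n * (r ^ n * ((5 * r) ^ (2 * n))⁻¹) = 1 := by
        rw [mul_pow, pow_mul, pow_mul]
        norm_num
        field_simp
        ring
      simp only [add_zero, one_mul, zero_mul, sub_zero]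
      rw [← h6]
      gcongr

/-! ### Weighted variances -/

lemma abs_log_sub_log_le {x y : ℝ} (hx : 0 < x) (h : x / 2 ≤ y) :
    |Real.log y - Real.log x| ≤ 2 * |y - x| / x := by
  have hy : 0 < y := by linarith
  have hq : 0 < y / x := div_pos hy hx
  have h1 := Real.log_le_sub_one_of_pos hq
  have h2 := Real.one_sub_inv_le_log_of_pos hq
  have hq2 : (y / x)⁻¹ ≤ 2 := by
    rw [inv_div, div_le_iff₀ hy]; linarith
  have e : 2 * |y - x| / x = 2 * |y / x - 1| := by
    rw [div_sub_one hx.ne', abs_div, abs_of_pos hx, mul_div_assoc]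
  rw [← Real.log_div hy.ne' hx.ne', e, abs_le]
  set q := y / x
  have h3 : |1 - q⁻¹| ≤ 2 * |q - 1| := by
    rw [show 1 - q⁻¹ = q⁻¹ * (q - 1) by field_simp, abs_mul, abs_of_pos (inv_pos.mpr hq)]
    exact mul_le_mul_of_nonneg_right hq2 (abs_nonneg _)
  constructor
  · linarith [neg_abs_le (1 - q⁻¹)]
  · linarith [le_abs_self (q - 1), abs_nonneg (q - 1)]

/-- The left side vanishes to second order at `y = x`: subtracting the logarithm with weight `2 x²`
removes the linear term of `y² - x²`. This is the pointwise source of the variance bound. -/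
lemma sq_sub_sq_sub_log_le {x y : ℝ} (hx : 0 < x) (h : x / 2 ≤ y) :
    y ^ 2 - x ^ 2 - 2 * x ^ 2 * (Real.log y - Real.log x) ≤ 5 * (y - x) ^ 2 := by
  have hy : 0 < y := by linarith
  have h2 := Real.one_sub_inv_le_log_of_pos (div_pos hy hx)
  rw [inv_div, Real.log_div hy.ne' hx.ne'] at h2
  have ht : x / y ≤ 2 := by rw [div_le_iff₀ hy]; linarith
  have e : y ^ 2 - x ^ 2 - 2 * x ^ 2 * (1 - x / y) = (y - x) ^ 2 * (1 + 2 * (x / y)) := by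
    field_simp; ring
  have h3 : x ^ 2 * (1 - x / y) ≤ x ^ 2 * (Real.log y - Real.log x) :=
    mul_le_mul_of_nonneg_left h2 (sq_nonneg x)
  have h4 : (y - x) ^ 2 * (1 + 2 * (x / y)) ≤ (y - x) ^ 2 * 5 :=
    mul_le_mul_of_nonneg_left (by linarith) (sq_nonneg _)
  linarith

/-- For `E ≤ 1`, use `Y² ≥ 2 Y - 1` and the Taylor expansion of the exponentials. For `E ≥ 1` the
left side is at most `1 + 6 E - 7 E² ≤ 0`. -/
lemma sq_ge_of_exp_combination_le {b x₁ x₂ E Y : ℝ} (hb0 : 0 ≤ b) (hb1 : b ≤ 1) (h1 : |x₁| ≤ E)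
    (h2 : |x₂| ≤ E) (hY : (1 + b) * Real.exp x₁ - b * Real.exp x₂ ≤ Y) :
    1 + 2 * ((1 + b) * x₁ - b * x₂) - 7 * E ^ 2 ≤ Y ^ 2 := by
  have hE : 0 ≤ E := (abs_nonneg _).trans h1
  rcases le_total E 1 with h | h
  · have h3 := Real.add_one_le_exp x₁
    have h4 := (abs_le.mp (Real.abs_exp_sub_one_sub_id_le (h2.trans h))).2
    have h5 : x₂ ^ 2 ≤ E ^ 2 := by rw [← sq_abs]; exact pow_le_pow_left₀ (abs_nonneg _) h2 2
    have h6 : (1 + b) * (x₁ + 1) ≤ (1 + b) * Real.exp x₁ :=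
      mul_le_mul_of_nonneg_left h3 (by linarith)
    have h7 : b * Real.exp x₂ ≤ b * (1 + x₂ + E ^ 2) :=
      mul_le_mul_of_nonneg_left (by linarith) hb0
    have h8 : b * E ^ 2 ≤ 1 * E ^ 2 := mul_le_mul_of_nonneg_right hb1 (sq_nonneg E)
    nlinarith [sq_nonneg (Y - 1), sq_nonneg E]
  · have h3 : (1 + b) * x₁ ≤ 2 * E := by
      have := mul_le_mul (show 1 + b ≤ 2 by linarith) ((le_abs_self _).trans h1 : x₁ ≤ E)
      nlinarith [abs_le.mp h1]
    have h4 : -(b * x₂) ≤ E := by nlinarith [abs_le.mp h2]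
    nlinarith [sq_nonneg Y]

lemma integrable_continuous_mul {A : Type*} [NormedRing A] [NeZero n] {P : Sph n → A}
    (hP : Continuous P) {v : Sph n → A} (hv : Integrable v (sigma n)) :
    Integrable (fun ξ => P ξ * v ξ) (sigma n) := by
  obtain ⟨M, hM⟩ := isCompact_univ.exists_bound_of_continuousOn hP.continuousOn
  exact Integrable.bdd_mul (c := M) hv hP.aestronglyMeasurable
    (Eventually.of_forall fun ξ => hM ξ (Set.mem_univ _))

lemma integral_mul_norm_sub_sq [NeZero n] {w : Sph n → ℝ} (hw : Continuous w)
    (hw1 : ∫ ξ, w ξ ∂(sigma n) = 1) {F : Sph n → ℂ} (hF : Integrable F (sigma n))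
    (hF2 : Integrable (fun ξ => ‖F ξ‖ ^ 2) (sigma n)) {a : ℂ}
    (ha : a = ∫ ξ, (w ξ : ℂ) * F ξ ∂(sigma n)) :
    Integrable (fun ξ => w ξ * ‖F ξ - a‖ ^ 2) (sigma n) ∧
      ∫ ξ, w ξ * ‖F ξ - a‖ ^ 2 ∂(sigma n) = ∫ ξ, w ξ * ‖F ξ‖ ^ 2 ∂(sigma n) - ‖a‖ ^ 2 := by
  have hwC : Continuous fun ξ => (w ξ : ℂ) := Complex.continuous_ofReal.comp hw
  have hpt : ∀ ξ, w ξ * ‖F ξ - a‖ ^ 2 = w ξ * ‖F ξ‖ ^ 2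
      - (2 * ((starRingEnd ℂ a) * ((w ξ : ℂ) * F ξ)).re - ‖a‖ ^ 2 * w ξ) := by
    intro ξ
    simp only [Complex.sq_norm, Complex.normSq_apply, Complex.sub_re, Complex.sub_im,
      Complex.mul_re, Complex.mul_im, Complex.conj_re, Complex.conj_im, Complex.ofReal_re,
      Complex.ofReal_im]
    ring
  have i1 := integrable_continuous_mul hw hF2
  have i2 : Integrable (fun ξ => (starRingEnd ℂ a) * ((w ξ : ℂ) * F ξ)) (sigma n) :=
    (integrable_continuous_mul hwC hF).const_mul _
  have i3 : Integrable w (sigma n) := Continuous.integrable_sphere hw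
  have i4 : Integrable (fun ξ => ((starRingEnd ℂ a) * ((w ξ : ℂ) * F ξ)).re) (sigma n) := i2.re
  have i5 : Integrable (fun ξ => 2 * ((starRingEnd ℂ a) * ((w ξ : ℂ) * F ξ)).re - ‖a‖ ^ 2 * w ξ)
      (sigma n) := (i4.const_mul 2).sub (i3.const_mul _)
  simp only [hpt]
  refine ⟨i1.sub i5, ?_⟩
  have e : ∫ ξ, ((starRingEnd ℂ a) * ((w ξ : ℂ) * F ξ)).re ∂(sigma n) = ‖a‖ ^ 2 := by
    have h3 := integral_re i2
    simp only [RCLike.re_eq_complex_re] at h3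
    rw [h3, integral_const_mul, ← ha, ← Complex.normSq_eq_conj_mul_self, Complex.ofReal_re,
      Complex.sq_norm]
  rw [integral_sub i1 i5, integral_sub (i4.const_mul 2) (i3.const_mul _), integral_const_mul,
    integral_const_mul, e, hw1]
  ring

/-- The variance of a function with respect to a combination of two kernels for which the
geometric mean value property holds. -/
lemma weighted_variance_le [NeZero n] {P₁ P₂ v G : Sph n → ℝ} {F : Sph n → ℂ} {a₁ a₂ : ℂ}
    {b x E : ℝ} (hb0 : 0 ≤ b) (hb1 : b ≤ 1) (hx : 0 < x) (hP₁ : Continuous P₁) (hP₂ : Continuous P₂)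
    (h₁ : ∫ ξ, P₁ ξ ∂(sigma n) = 1) (h₂ : ∫ ξ, P₂ ξ ∂(sigma n) = 1)
    (hF : Integrable F (sigma n)) (hF2 : Integrable (fun ξ => ‖F ξ‖ ^ 2) (sigma n))
    (hv : Integrable v (sigma n)) (hG : Integrable G (sigma n))
    (ha₁ : a₁ = ∫ ξ, (P₁ ξ : ℂ) * F ξ ∂(sigma n)) (ha₂ : a₂ = ∫ ξ, (P₂ ξ : ℂ) * F ξ ∂(sigma n))
    (he₁ : ‖a₁‖ = Real.exp (∫ ξ, P₁ ξ * v ξ ∂(sigma n)))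
    (he₂ : ‖a₂‖ = Real.exp (∫ ξ, P₂ ξ * v ξ ∂(sigma n)))
    (hE₁ : |∫ ξ, P₁ ξ * (v ξ - Real.log x) ∂(sigma n)| ≤ E)
    (hE₂ : |∫ ξ, P₂ ξ * (v ξ - Real.log x) ∂(sigma n)| ≤ E)
    (hW : ∀ ξ, 0 ≤ (1 + b) * P₁ ξ - b * P₂ ξ)
    (hFG : ∀ ξ, ‖F ξ‖ ^ 2 - x ^ 2 - 2 * x ^ 2 * (v ξ - Real.log x) ≤ G ξ) :
    Integrable (fun ξ => ((1 + b) * P₁ ξ - b * P₂ ξ) * ‖F ξ - ((1 + b) * a₁ - b * a₂)‖ ^ 2)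
        (sigma n) ∧
      ∫ ξ, ((1 + b) * P₁ ξ - b * P₂ ξ) * ‖F ξ - ((1 + b) * a₁ - b * a₂)‖ ^ 2 ∂(sigma n) ≤
        ∫ ξ, ((1 + b) * P₁ ξ - b * P₂ ξ) * G ξ ∂(sigma n) + 7 * x ^ 2 * E ^ 2 := by
  have comb : ∀ {g : Sph n → ℝ}, Integrable g (sigma n) →
      ∫ ξ, ((1 + b) * P₁ ξ - b * P₂ ξ) * g ξ ∂(sigma n) =
        (1 + b) * ∫ ξ, P₁ ξ * g ξ ∂(sigma n) - b * ∫ ξ, P₂ ξ * g ξ ∂(sigma n) := by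
    intro g hg
    rw [← integral_const_mul, ← integral_const_mul,
      ← integral_sub ((integrable_continuous_mul hP₁ hg).const_mul _)
        ((integrable_continuous_mul hP₂ hg).const_mul _)]
    congr 1; ext ξ; ring
  have hWc : Continuous fun ξ => (1 + b) * P₁ ξ - b * P₂ ξ := by fun_prop
  have hW1 : ∫ ξ, ((1 + b) * P₁ ξ - b * P₂ ξ) ∂(sigma n) = 1 := by
    have := comb (integrable_const (1 : ℝ))
    simp only [mul_one] at this
    rw [this, h₁, h₂]; ring
  have hvx : Integrable (fun ξ => v ξ - Real.log x) (sigma n) := hv.sub (integrable_const _)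
  have ha : (1 + b) * a₁ - b * a₂ =
      ∫ ξ, (((1 + b) * P₁ ξ - b * P₂ ξ : ℝ) : ℂ) * F ξ ∂(sigma n) := by
    have c₁ : Continuous fun ξ => (P₁ ξ : ℂ) := Complex.continuous_ofReal.comp hP₁
    have c₂ : Continuous fun ξ => (P₂ ξ : ℂ) := Complex.continuous_ofReal.comp hP₂
    rw [ha₁, ha₂, ← integral_const_mul, ← integral_const_mul,
      ← integral_sub ((integrable_continuous_mul c₁ hF).const_mul _)
        ((integrable_continuous_mul c₂ hF).const_mul _)]
    congr 1; ext ξ; push_cast; ring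
  obtain ⟨hi, heq⟩ := integral_mul_norm_sub_sq hWc hW1 hF hF2 ha
  refine ⟨hi, ?_⟩
  rw [heq]
  set x₁ := ∫ ξ, P₁ ξ * (v ξ - Real.log x) ∂(sigma n) with hx₁
  set x₂ := ∫ ξ, P₂ ξ * (v ξ - Real.log x) ∂(sigma n) with hx₂
  have mean : ∀ {P : Sph n → ℝ}, Continuous P → ∫ ξ, P ξ ∂(sigma n) = 1 →
      Real.exp (∫ ξ, P ξ * v ξ ∂(sigma n)) =
        x * Real.exp (∫ ξ, P ξ * (v ξ - Real.log x) ∂(sigma n)) := by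
    intro P hP h
    have : ∫ ξ, P ξ * (v ξ - Real.log x) ∂(sigma n) = ∫ ξ, P ξ * v ξ ∂(sigma n) - Real.log x := by
      simp only [mul_sub]
      rw [integral_sub (integrable_continuous_mul hP hv)
        (integrable_continuous_mul hP (integrable_const _)), integral_mul_const, h, one_mul]
    rw [this, Real.exp_sub, Real.exp_log hx]
    field_simp
  -- Only the moduli of `a₁` and `a₂` are known; the reverse triangle inequality suffices, because
  -- `|a|²` enters the variance with a minus sign.
  have hnorm : (1 + b) * ‖a₁‖ - b * ‖a₂‖ ≤ ‖(1 + b) * a₁ - b * a₂‖ := by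
    have := norm_sub_norm_le ((1 + b) * a₁) (b * a₂)
    rw [norm_mul, norm_mul, Complex.norm_real, Real.norm_of_nonneg hb0] at this
    have e : ‖(1 + b : ℂ)‖ = 1 + b := by
      rw [← Complex.ofReal_one, ← Complex.ofReal_add, Complex.norm_real,
        Real.norm_of_nonneg (by linarith)]
    rwa [e] at this
  have hlow := sq_ge_of_exp_combination_le (Y := ‖(1 + b) * a₁ - b * a₂‖ / x) hb0 hb1 hE₁ hE₂ (by
    rw [le_div_iff₀ hx]
    refine le_trans (le_of_eq ?_) hnorm
    rw [he₁, he₂, mean hP₁ h₁, mean hP₂ h₂]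
    ring)
  rw [div_pow, le_div_iff₀ (by positivity)] at hlow
  have hup : ∫ ξ, ((1 + b) * P₁ ξ - b * P₂ ξ) *
      (‖F ξ‖ ^ 2 - x ^ 2 - 2 * x ^ 2 * (v ξ - Real.log x)) ∂(sigma n) ≤
      ∫ ξ, ((1 + b) * P₁ ξ - b * P₂ ξ) * G ξ ∂(sigma n) :=
    integral_mono (integrable_continuous_mul hWc
      ((hF2.sub (integrable_const _)).sub (hvx.const_mul _)))
      (integrable_continuous_mul hWc hG) fun ξ => mul_le_mul_of_nonneg_left (hFG ξ) (hW ξ)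
  have hexp : ∫ ξ, ((1 + b) * P₁ ξ - b * P₂ ξ) *
      (‖F ξ‖ ^ 2 - x ^ 2 - 2 * x ^ 2 * (v ξ - Real.log x)) ∂(sigma n) =
      ∫ ξ, ((1 + b) * P₁ ξ - b * P₂ ξ) * ‖F ξ‖ ^ 2 ∂(sigma n)
        - (x ^ 2 + 2 * x ^ 2 * ((1 + b) * x₁ - b * x₂)) := by
    rw [hx₁, hx₂, ← comb hvx]
    have j1 := integrable_continuous_mul hWc hF2
    have j2 := integrable_continuous_mul hWc hvx
    have j3 : Integrable (fun ξ => (1 + b) * P₁ ξ - b * P₂ ξ) (sigma n) :=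
      Continuous.integrable_sphere hWc
    have : ∫ ξ, (x ^ 2 * ((1 + b) * P₁ ξ - b * P₂ ξ)
        + 2 * x ^ 2 * (((1 + b) * P₁ ξ - b * P₂ ξ) * (v ξ - Real.log x))) ∂(sigma n) =
        x ^ 2 + 2 * x ^ 2 * ∫ ξ, ((1 + b) * P₁ ξ - b * P₂ ξ) * (v ξ - Real.log x) ∂(sigma n) := by
      rw [integral_add (j3.const_mul _) (j2.const_mul _), integral_const_mul, integral_const_mul,
        hW1, mul_one]
    have j4 : Integrable (fun ξ => x ^ 2 * ((1 + b) * P₁ ξ - b * P₂ ξ)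
        + 2 * x ^ 2 * (((1 + b) * P₁ ξ - b * P₂ ξ) * (v ξ - Real.log x))) (sigma n) :=
      (j3.const_mul _).add (j2.const_mul _)
    rw [← this, ← integral_sub j1 j4]
    congr 1; ext ξ; ring
  rw [hexp] at hup
  linarith

/-! ### Estimates at the scale of the central value -/

/-- The level `l = R ^ (-n/p)` is balanced: `l ^ (1-p)` equals `l` times the order `R ^ n` of the
volume of a ball of radius `R`. -/
lemma rpow_neg_div_rpow {R p : ℝ} (hR : 0 < R) (hp : 0 < p) (n : ℕ) :
    (R ^ (-(n / p))) ^ (1 - p) = R ^ n * R ^ (-(n / p)) := by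
  rw [← Real.rpow_mul hR.le, ← Real.rpow_natCast, ← Real.rpow_add hR]
  congr 1
  field_simp
  ring

lemma one_le_rpow_neg_div {R p : ℝ} (hR : 0 < R) (hR1 : R ≤ 1) (hp : 0 < p) (n : ℕ) :
    1 ≤ R ^ (-(n / p)) :=
  Real.one_le_rpow_of_pos_of_le_one_of_nonpos hR hR1 (neg_nonpos.mpr (by positivity))

/-- Average `|x| ≤ 1 + |v|` over the ball of radius `R`, whose measure is at least `c R ^ n`, and
split `|v|` at the balanced level. -/
lemma abs_le_of_near_const [NeZero n] {c R p B x : ℝ} {v : Sph n → ℝ} {ζ : Sph n} (hc : 0 < c)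
    (hR : 0 < R) (hR1 : R ≤ 1) (hσ : c * R ^ n ≤ (sigma n).real (qball ζ R)) (hp : 1 < p)
    (hvp : Integrable (fun ξ => |v ξ| ^ p) (sigma n)) (hB : ∫ ξ, |v ξ| ^ p ∂(sigma n) ≤ B)
    (hnear : ∀ ξ, qdist ξ ζ ≤ R → |v ξ - x| ≤ 1) :
    |x| ≤ (2 + B / c) * R ^ (-(n / p)) := by
  set l := R ^ (-(n / p)) with hl
  have hl1 : 1 ≤ l := one_le_rpow_neg_div hR hR1 (by linarith) n
  have hl0 : 0 < l := by linarith
  set S := (sigma n).real (qball ζ R)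
  have hS : 0 < S := lt_of_lt_of_le (by positivity) hσ
  have hB0 : 0 ≤ B := (integral_nonneg fun _ => by positivity).trans hB
  have hlp : l ^ (1 - p) = R ^ n * l := rpow_neg_div_rpow hR (by linarith) n
  have h1 : ∫ ξ in qball ζ R, |x| ∂(sigma n) ≤
      ∫ ξ in qball ζ R, ((1 + l) + l ^ (1 - p) * |v ξ| ^ p) ∂(sigma n) := by
    refine setIntegral_mono_on (integrable_const _).integrableOn
      ((integrable_const _).add (hvp.const_mul _)).integrableOn (measurableSet_qball ζ R) ?_
    intro ξ hξ
    have h2 := le_add_rpow hp.le hl0 (abs_nonneg (v ξ))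
    have h3 := hnear ξ hξ
    have h4 : |x| ≤ |v ξ| + |v ξ - x| := by
      have := abs_sub (v ξ) (v ξ - x)
      rwa [sub_sub_cancel] at this
    linarith
  rw [integral_add (integrable_const _).integrableOn (hvp.const_mul _).integrableOn,
    integral_const_mul, setIntegral_const, setIntegral_const, smul_eq_mul, smul_eq_mul] at h1
  have h2 : ∫ ξ in qball ζ R, |v ξ| ^ p ∂(sigma n) ≤ B :=
    (setIntegral_le_integral hvp (Eventually.of_forall fun _ => by positivity)).trans hB
  have h3 : l ^ (1 - p) * ∫ ξ in qball ζ R, |v ξ| ^ p ∂(sigma n) ≤ S * (B / c * l) := by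
    refine (mul_le_mul_of_nonneg_left h2 (by positivity)).trans ?_
    calc l ^ (1 - p) * B = c * R ^ n * (B / c * l) := by rw [hlp]; field_simp
      _ ≤ S * (B / c * l) := mul_le_mul_of_nonneg_right hσ (by positivity)
  have h4 : S * |x| ≤ S * ((1 + l) + B / c * l) := by
    rw [mul_add]; exact h1.trans (by gcongr)
  have h5 := le_of_mul_le_mul_left h4 hS
  linarith

/-- Split `|v|` at the balanced level `R ^ (-n/p)`. The bounded part meets the kernel integral of
order `R⁻¹`, the `p`-th power meets the supremum `R ^ (-n-1)` of the kernel, and both give the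
exponent `-(1 + n/p)`. -/
lemma integral_tail_kernel_le [NeZero n] {CI CL R p B L : ℝ} {v : Sph n → ℝ} {ζ : Sph n}
    (hR : 0 < R) (hp : 1 < p) (hv : Integrable v (sigma n))
    (hI : ∫ ξ, max (qdist ξ ζ) R ^ (-((n : ℝ) + 1)) ∂(sigma n) ≤ CI * R ^ (-1 : ℝ))
    (hvp : Integrable (fun ξ => |v ξ| ^ p) (sigma n)) (hB : ∫ ξ, |v ξ| ^ p ∂(sigma n) ≤ B)
    (hL0 : 0 ≤ L) (hL : L ≤ CL * R ^ (-(n / p))) :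
    ∫ ξ, max (qdist ξ ζ) R ^ (-((n : ℝ) + 1)) * (|v ξ| + L) ∂(sigma n) ≤
      ((1 + CL) * CI + B) * R ^ (-(1 + n / p)) := by
  set l := R ^ (-(n / p)) with hl
  have hl0 : 0 < l := by positivity
  have hlp : l ^ (1 - p) = R ^ n * l := rpow_neg_div_rpow hR (by linarith) n
  have hc := continuous_max_rpow ζ hR (-((n : ℝ) + 1))
  have hi : Integrable (fun ξ => max (qdist ξ ζ) R ^ (-((n : ℝ) + 1))) (sigma n) :=
    Continuous.integrable_sphere hc
  have hlL : 0 ≤ l + L := by linarith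
  calc ∫ ξ, max (qdist ξ ζ) R ^ (-((n : ℝ) + 1)) * (|v ξ| + L) ∂(sigma n)
      ≤ ∫ ξ, ((l + L) * max (qdist ξ ζ) R ^ (-((n : ℝ) + 1))
          + R ^ (-((n : ℝ) + 1)) * l ^ (1 - p) * |v ξ| ^ p) ∂(sigma n) := by
        refine integral_mono (integrable_continuous_mul hc (hv.abs.add (integrable_const L)))
          ((hi.const_mul _).add (hvp.const_mul _)) fun ξ => ?_
        have h1 := le_add_rpow hp.le hl0 (abs_nonneg (v ξ))
        have h2 : max (qdist ξ ζ) R ^ (-((n : ℝ) + 1)) ≤ R ^ (-((n : ℝ) + 1)) :=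
          Real.rpow_le_rpow_of_nonpos hR (le_max_right _ _) (by
            have : (0 : ℝ) ≤ n := Nat.cast_nonneg n
            linarith)
        have hm0 : 0 < max (qdist ξ ζ) R := lt_max_of_lt_right hR
        have hm : 0 ≤ max (qdist ξ ζ) R ^ (-((n : ℝ) + 1)) := by positivity
        calc max (qdist ξ ζ) R ^ (-((n : ℝ) + 1)) * (|v ξ| + L)
            ≤ max (qdist ξ ζ) R ^ (-((n : ℝ) + 1)) * ((l + l ^ (1 - p) * |v ξ| ^ p) + L) :=
              mul_le_mul_of_nonneg_left (by linarith) hm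
          _ = (l + L) * max (qdist ξ ζ) R ^ (-((n : ℝ) + 1))
              + max (qdist ξ ζ) R ^ (-((n : ℝ) + 1)) * (l ^ (1 - p) * |v ξ| ^ p) := by ring
          _ ≤ (l + L) * max (qdist ξ ζ) R ^ (-((n : ℝ) + 1))
              + R ^ (-((n : ℝ) + 1)) * (l ^ (1 - p) * |v ξ| ^ p) := by gcongr
          _ = _ := by ring
    _ = (l + L) * ∫ ξ, max (qdist ξ ζ) R ^ (-((n : ℝ) + 1)) ∂(sigma n)
          + R ^ (-((n : ℝ) + 1)) * l ^ (1 - p) * ∫ ξ, |v ξ| ^ p ∂(sigma n) := by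
        rw [integral_add (hi.const_mul _) (hvp.const_mul _), integral_const_mul,
          integral_const_mul]
    _ ≤ ((1 + CL) * l) * (CI * R ^ (-1 : ℝ)) + R ^ (-((n : ℝ) + 1)) * l ^ (1 - p) * B := by
        have hI0 : 0 ≤ ∫ ξ, max (qdist ξ ζ) R ^ (-((n : ℝ) + 1)) ∂(sigma n) :=
          integral_nonneg fun ξ => by
            have hm0 : 0 < max (qdist ξ ζ) R := lt_max_of_lt_right hR
            positivity
        refine add_le_add (mul_le_mul (by linarith) hI hI0 (by linarith)) ?_
        exact mul_le_mul_of_nonneg_left hB (by positivity)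
    _ = _ := by
        have e1 : R ^ (-(1 + n / p)) = R ^ (-1 : ℝ) * l := by
          rw [neg_add, Real.rpow_add hR]
        have e2 : R ^ (-((n : ℝ) + 1)) * l ^ (1 - p) = R ^ (-1 : ℝ) * l := by
          rw [hlp, neg_add, Real.rpow_add hR, Real.rpow_neg hR.le, Real.rpow_natCast]
          field_simp
        rw [e1, e2]
        ring

lemma integral_kernel_mul_qdist_rpow_le [NeZero n] {P : Sph n → ℝ} (hP : Continuous P) {ζ : Sph n}
    {K CI r γ : ℝ} {j : ℕ} (hr : 0 < r) (hK : 0 ≤ K) (hγ : 0 ≤ γ)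
    (hle : ∀ ξ, P ξ ≤ K * r ^ j * (max (qdist ξ ζ) r ^ (n + j))⁻¹)
    (hI : ∫ ξ, max (qdist ξ ζ) r ^ (-((n : ℝ) + (j - γ))) ∂(sigma n) ≤ CI * r ^ (-(j - γ))) :
    ∫ ξ, P ξ * qdist ξ ζ ^ γ ∂(sigma n) ≤ K * CI * r ^ γ := by
  have hd : Continuous fun ξ : Sph n => qdist ξ ζ ^ γ :=
    (continuous_qdist ζ).rpow_const fun _ => Or.inr hγ
  have hi : Integrable (fun ξ => max (qdist ξ ζ) r ^ (-((n : ℝ) + (j - γ)))) (sigma n) :=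
    Continuous.integrable_sphere (continuous_max_rpow ζ hr _)
  calc ∫ ξ, P ξ * qdist ξ ζ ^ γ ∂(sigma n)
      ≤ ∫ ξ, K * r ^ j * max (qdist ξ ζ) r ^ (-((n : ℝ) + (j - γ))) ∂(sigma n) := by
        refine integral_mono (Continuous.integrable_sphere (hP.mul hd)) (hi.const_mul _) fun ξ => ?_
        have hm0 : 0 < max (qdist ξ ζ) r := lt_max_of_lt_right hr
        have hd0 : 0 ≤ qdist ξ ζ ^ γ := Real.rpow_nonneg (qdist_nonneg _ _) _
        have hdm : qdist ξ ζ ^ γ ≤ max (qdist ξ ζ) r ^ γ :=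
          Real.rpow_le_rpow (qdist_nonneg _ _) (le_max_left _ _) hγ
        have e : max (qdist ξ ζ) r ^ (-((n : ℝ) + (j - γ))) =
            (max (qdist ξ ζ) r ^ (n + j))⁻¹ * max (qdist ξ ζ) r ^ γ := by
          rw [← Real.rpow_natCast, ← Real.rpow_neg hm0.le, ← Real.rpow_add hm0]
          push_cast
          congr 1
          ring
        rw [e]
        calc P ξ * qdist ξ ζ ^ γ
            ≤ (K * r ^ j * (max (qdist ξ ζ) r ^ (n + j))⁻¹) * qdist ξ ζ ^ γ :=
              mul_le_mul_of_nonneg_right (hle ξ) hd0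
          _ ≤ (K * r ^ j * (max (qdist ξ ζ) r ^ (n + j))⁻¹) * max (qdist ξ ζ) r ^ γ :=
              mul_le_mul_of_nonneg_left hdm (by positivity)
          _ = _ := by ring
    _ ≤ K * r ^ j * (CI * r ^ (-(j - γ))) := by
        rw [integral_const_mul]
        exact mul_le_mul_of_nonneg_left hI (by positivity)
    _ = _ := by
        have : r ^ (-(j - γ)) = (r ^ j)⁻¹ * r ^ γ := by
          rw [neg_sub, sub_eq_neg_add, Real.rpow_add hr, Real.rpow_neg hr.le, Real.rpow_natCast]
        rw [this]
        field_simp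

/-- Beyond `R`, `n + 1` powers of the distance are kept in the reference kernel and each further
power of decay is worth `1/R`. The case `j = 0` serves the Poisson kernels and `j = 1` the combined
kernel. -/
lemma integral_kernel_mul_tail_le [NeZero n] {P h : Sph n → ℝ} (hP : Continuous P) {ζ : Sph n}
    {K r R : ℝ} {j : ℕ} (hr : 0 < r) (hrR : r ≤ R) (hK : 0 ≤ K) (hh : Integrable h (sigma n))
    (hh0 : ∀ ξ, 0 ≤ h ξ)
    (hle : ∀ ξ, P ξ ≤ K * r ^ (j + 1) * (max (qdist ξ ζ) r ^ (n + (j + 1)))⁻¹) :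
    ∫ ξ, P ξ * (qball ζ R)ᶜ.indicator h ξ ∂(sigma n) ≤
      K * r ^ (j + 1) * (R ^ j)⁻¹ *
        ∫ ξ, max (qdist ξ ζ) R ^ (-((n : ℝ) + 1)) * h ξ ∂(sigma n) := by
  have hR : 0 < R := hr.trans_le hrR
  have hi := integrable_continuous_mul (continuous_max_rpow ζ hR (-((n : ℝ) + 1))) hh
  rw [← integral_const_mul]
  refine integral_mono (integrable_continuous_mul hP
    (hh.indicator (measurableSet_qball ζ R).compl)) (hi.const_mul _) fun ξ => ?_
  have hm0 : 0 < max (qdist ξ ζ) R := lt_max_of_lt_right hR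
  have e : max (qdist ξ ζ) R ^ (-((n : ℝ) + 1)) = (max (qdist ξ ζ) R ^ (n + 1))⁻¹ := by
    rw [← Real.rpow_natCast, ← Real.rpow_neg hm0.le]
    push_cast
    rfl
  simp only [e]
  by_cases hξ : qdist ξ ζ ≤ R
  · rw [Set.indicator_of_notMem (by simpa using (show ξ ∈ qball ζ R from hξ)), mul_zero]
    have := hh0 ξ
    positivity
  · have hξ' : R < qdist ξ ζ := not_le.mp hξ
    rw [Set.indicator_of_mem (show ξ ∈ (qball ζ R)ᶜ from hξ)]
    have h1 := hle ξ
    rw [max_eq_left (hrR.trans hξ'.le)] at h1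
    rw [max_eq_left hξ'.le]
    have hd : 0 < qdist ξ ζ := hR.trans hξ'
    rw [← mul_assoc]
    refine mul_le_mul_of_nonneg_right (h1.trans ?_) (hh0 ξ)
    rw [mul_assoc (K * r ^ (j + 1)), ← mul_inv]
    have : R ^ j * qdist ξ ζ ^ (n + 1) ≤ qdist ξ ζ ^ (n + (j + 1)) := by
      rw [show n + (j + 1) = j + (n + 1) by ring, pow_add _ j (n + 1)]
      gcongr
    gcongr

/-- The scale at which a function that is Hölder at `ζ` is comparable to its value at `ζ`. -/
lemma exists_scale (n : ℕ) [NeZero n] {α C B : ℝ} (hα : 0 < α) (hC : 1 ≤ C) (hB : 1 ≤ B) :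
    ∃ M : ℝ, 1 ≤ M ∧ ∀ (p : ℝ) (φ : Sph n → ℝ) (ζ : Sph n), 1 < p → 0 < φ ζ →
      (∀ ξ, |φ ξ - φ ζ| ≤ C * qdist ξ ζ ^ α) →
      Integrable (fun ξ => |Real.log (φ ξ)| ^ p) (sigma n) →
      ∫ ξ, |Real.log (φ ξ)| ^ p ∂(sigma n) ≤ B →
      ∃ R : ℝ, 0 < R ∧ R ≤ 1 ∧ (∀ ξ, qdist ξ ζ ≤ R → φ ζ / 2 ≤ φ ξ) ∧
        |Real.log (φ ζ)| ≤ M * R ^ (-(n / p)) ∧ φ ζ ≤ M * R ^ α ∧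
        ∀ r : ℝ, 0 < r → r ≤ 1 → 2 * C * r ^ (α / (1 + n / p)) < φ ζ →
          r ^ (1 / (1 + n / p)) ≤ R := by
  obtain ⟨c, hc, hσ⟩ := le_sigma_qball n
  have hBc : 0 < B / c := by positivity
  -- The three summands cover the bound `2 C R ^ α` when `R < 1`, the bound on `φ ζ` through its
  -- logarithm when `R = 1`, and the logarithm itself.
  set M := 2 * C + Real.exp (2 + B / c) + (2 + B / c) with hM
  have hexp := Real.exp_pos (2 + B / c)
  refine ⟨M, by linarith, ?_⟩
  intro p φ ζ hp hφ hH hint hle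
  set x := φ ζ with hx
  have hx2 : 0 < x / (2 * C) := by positivity
  -- With this choice `C R ^ α ≤ φ ζ / 2`, so `φ` stays within a factor 2 of its central value up to
  -- distance `R`.
  set R := min 1 ((x / (2 * C)) ^ (1 / α)) with hR
  have hR0 : 0 < R := lt_min one_pos (by positivity)
  have hR1 : R ≤ 1 := min_le_left _ _
  have hRα : C * R ^ α ≤ x / 2 := by
    have h1 : R ^ α ≤ ((x / (2 * C)) ^ (1 / α)) ^ α :=
      Real.rpow_le_rpow hR0.le (min_le_right _ _) hα.le
    rw [← Real.rpow_mul hx2.le, one_div_mul_cancel hα.ne', Real.rpow_one, le_div_iff₀ (by positivity)]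
      at h1
    linarith
  have hnear : ∀ ξ, qdist ξ ζ ≤ R → |φ ξ - x| ≤ x / 2 := by
    intro ξ hξ
    refine (hH ξ).trans (le_trans ?_ hRα)
    have := Real.rpow_le_rpow (qdist_nonneg _ _) hξ hα.le
    gcongr
  have hnear2 : ∀ ξ, qdist ξ ζ ≤ R → x / 2 ≤ φ ξ := fun ξ hξ => by
    linarith [(abs_le.mp (hnear ξ hξ)).1]
  have hlog : |Real.log x| ≤ (2 + B / c) * R ^ (-(n / p)) := by
    refine abs_le_of_near_const hc hR0 hR1 (hσ ζ R hR0 (by linarith)) hp hint hle fun ξ hξ => ?_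
    refine (abs_log_sub_log_le hφ (hnear2 ξ hξ)).trans ?_
    rw [div_le_one hφ]
    linarith [hnear ξ hξ]
  refine ⟨R, hR0, hR1, hnear2, hlog.trans ?_, ?_, ?_⟩
  · gcongr
    linarith
  · rcases le_total 1 ((x / (2 * C)) ^ (1 / α)) with h | h
    · have hRe : R = 1 := min_eq_left h
      rw [hRe, Real.one_rpow, mul_one] at hlog
      rw [hRe, Real.one_rpow, mul_one, ← Real.exp_log hφ]
      have := Real.exp_le_exp.mpr ((le_abs_self _).trans hlog)
      linarith
    · have hRe : R = (x / (2 * C)) ^ (1 / α) := min_eq_right h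
      have h2 : R ^ α = x / (2 * C) := by
        rw [hRe, ← Real.rpow_mul hx2.le, one_div_mul_cancel hα.ne', Real.rpow_one]
      have h3 : x = 2 * C * R ^ α := by rw [h2]; field_simp
      have h4 : 0 ≤ R ^ α := by positivity
      calc x = 2 * C * R ^ α := h3
        _ ≤ M * R ^ α := mul_le_mul_of_nonneg_right (by linarith) h4
  · intro r hr hr1 hlt
    refine le_min (Real.rpow_le_one hr.le hr1 (by positivity)) ?_
    have h1 : r ^ (α / (1 + n / p)) ≤ x / (2 * C) := by
      rw [le_div_iff₀ (by positivity)]; linarith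
    have h2 := Real.rpow_le_rpow (by positivity) h1 (show 0 ≤ 1 / α by positivity)
    rwa [← Real.rpow_mul hr.le, div_mul_div_comm, mul_one, mul_comm _ α,
      ← div_div, div_self hα.ne'] at h2

/-! ### The mean oscillation estimate -/

/-- Pointwise bounds for a nonnegative function that is Hölder at `ζ`: near `ζ` by the Hölder
condition, far from `ζ` by the size of the logarithm. -/
lemma holder_log_bounds {α C M R : ℝ} (hα : 0 < α) (hC : 1 ≤ C) (hM : 1 ≤ M) (hR : 0 < R)
    {φ : Sph n → ℝ} {ζ : Sph n} (hφ : 0 < φ ζ) (hφ0 : ∀ ξ, 0 ≤ φ ξ)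
    (hH : ∀ ξ, |φ ξ - φ ζ| ≤ C * qdist ξ ζ ^ α) (hnear : ∀ ξ, qdist ξ ζ ≤ R → φ ζ / 2 ≤ φ ξ)
    (hle : φ ζ ≤ M * R ^ α) (ξ : Sph n) :
    |Real.log (φ ξ) - Real.log (φ ζ)| ≤ 2 * C / φ ζ * qdist ξ ζ ^ α +
        (qball ζ R)ᶜ.indicator (fun ξ => |Real.log (φ ξ)| + |Real.log (φ ζ)|) ξ ∧
      φ ξ ^ 2 - φ ζ ^ 2 - 2 * φ ζ ^ 2 * (Real.log (φ ξ) - Real.log (φ ζ)) ≤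
        (5 * C ^ 2 + (M + C) ^ 2) * qdist ξ ζ ^ (2 * α) + 2 * φ ζ ^ 2 *
          (qball ζ R)ᶜ.indicator (fun ξ => |Real.log (φ ξ)| + |Real.log (φ ζ)|) ξ := by
  have hd := qdist_nonneg ξ ζ
  have hdα : 0 ≤ qdist ξ ζ ^ α := by positivity
  have e2 : qdist ξ ζ ^ (2 * α) = (qdist ξ ζ ^ α) ^ 2 := by
    rw [mul_comm, Real.rpow_mul hd, Real.rpow_ofNat]
  have h1 := hH ξ
  rw [e2]
  by_cases hξ : qdist ξ ζ ≤ R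
  · rw [Set.indicator_of_notMem (by simpa using (show ξ ∈ qball ζ R from hξ)), mul_zero, add_zero,
      add_zero]
    constructor
    · refine (abs_log_sub_log_le hφ (hnear ξ hξ)).trans ?_
      rw [div_mul_eq_mul_div, mul_assoc]
      gcongr
    · refine (sq_sub_sq_sub_log_le hφ (hnear ξ hξ)).trans ?_
      have h2 : (φ ξ - φ ζ) ^ 2 ≤ (C * qdist ξ ζ ^ α) ^ 2 := by
        rw [← sq_abs]; exact pow_le_pow_left₀ (abs_nonneg _) h1 2
      have h3 : 0 ≤ (M + C) ^ 2 * (qdist ξ ζ ^ α) ^ 2 := by positivity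
      linarith [mul_pow C (qdist ξ ζ ^ α) 2]
  · have hξ' : R < qdist ξ ζ := not_le.mp hξ
    rw [Set.indicator_of_mem (show ξ ∈ (qball ζ R)ᶜ from hξ)]
    have h2 := abs_sub (Real.log (φ ξ)) (Real.log (φ ζ))
    constructor
    · have : 0 ≤ 2 * C / φ ζ * qdist ξ ζ ^ α := by positivity
      linarith
    -- Far from `ζ` the central value is itself dominated by the distance: `φ ζ ≤ M R ^ α ≤ M d ^
    -- α`.
    · have h3 : φ ξ ≤ (M + C) * qdist ξ ζ ^ α := by
        have h4 : M * R ^ α ≤ M * qdist ξ ζ ^ α := by gcongr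
        linarith [(abs_le.mp h1).2]
      have h5 : φ ξ ^ 2 ≤ (M + C) ^ 2 * (qdist ξ ζ ^ α) ^ 2 := by
        rw [← mul_pow]; exact pow_le_pow_left₀ (hφ0 ξ) h3 2
      have h6 : φ ζ ^ 2 * -(Real.log (φ ξ) - Real.log (φ ζ)) ≤
          φ ζ ^ 2 * (|Real.log (φ ξ)| + |Real.log (φ ζ)|) :=
        mul_le_mul_of_nonneg_left ((neg_le_abs _).trans h2) (sq_nonneg _)
      have h7 : 0 ≤ C ^ 2 * (qdist ξ ζ ^ α) ^ 2 := by positivity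
      nlinarith [sq_nonneg (φ ζ)]

/-- Arithmetic of the scales `r` and `R`. -/
lemma mul_scale_le {α s r R M x : ℝ} (hs : 1 < s) (hα1 : α < 1) (hr : 0 < r)
    (hR : 0 < R) (hM : 0 ≤ M) (hrR : r ^ (1 / s) ≤ R) (hx : x ≤ M * R ^ α) :
    x * (r * R ^ (-s)) ≤ M * r ^ (α / s) := by
  -- As `α < s` the power of `R` is decreasing, so the lower bound on `R` applies; the exponents
  -- then add up as `1 + (α - s)/s = α/s`.
  have h1 : R ^ (α - s) ≤ (r ^ (1 / s)) ^ (α - s) :=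
    Real.rpow_le_rpow_of_nonpos (by positivity) hrR (by linarith)
  rw [← Real.rpow_mul hr.le] at h1
  calc x * (r * R ^ (-s)) ≤ M * R ^ α * (r * R ^ (-s)) := by gcongr
    _ = M * (r * R ^ (α - s)) := by rw [sub_eq_add_neg, Real.rpow_add hR]; ring
    _ ≤ M * (r * r ^ (1 / s * (α - s))) := by gcongr
    _ = M * r ^ (α / s) := by
        congr 1
        nth_rewrite 1 [← Real.rpow_one r]
        rw [← Real.rpow_add hr]
        congr 1
        field_simp
        ring

lemma norm_le_of_holder [NeZero n] {α C M : ℝ} (hα : 0 < α) (hα1 : α < 1) (hC : 0 ≤ C)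
    {φ : Sph n → ℝ} {ζ : Sph n} (hM : φ ζ ≤ M) (hH : ∀ ξ, |φ ξ - φ ζ| ≤ C * qdist ξ ζ ^ α)
    (ξ : Sph n) : φ ξ ≤ M + 2 * C := by
  have h1 : qdist ξ ζ ^ α ≤ 2 := by
    calc qdist ξ ζ ^ α ≤ 2 ^ α := Real.rpow_le_rpow (qdist_nonneg _ _) (qdist_le_two _ _) hα.le
      _ ≤ 2 ^ (1 : ℝ) := Real.rpow_le_rpow_of_exponent_le (by norm_num) hα1.le
      _ = 2 := Real.rpow_one 2
  have h2 : C * qdist ξ ζ ^ α ≤ C * 2 := mul_le_mul_of_nonneg_left h1 hC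
  linarith [(abs_le.mp (hH ξ)).2]

/-- The `L²` oscillation of an outer function near a point where its modulus is Hölder and not
too small. -/
lemma exists_variance_bound (n : ℕ) [NeZero n] {α C B : ℝ} (hα : 0 < α) (hα1 : α < 1)
    (hC : 1 ≤ C) (hB : 1 ≤ B) :
    ∃ K : ℝ, 0 < K ∧ ∀ (p : ℝ) (f : Cn n → ℂ) (ζ : Sph n), 1 < p → IsOuter f →
      (∀ ξ : Sph n, |‖f ξ‖ - ‖f ζ‖| ≤ C * qdist ξ ζ ^ α) →
      Integrable (fun ξ : Sph n => |Real.log ‖f ξ‖| ^ p) (sigma n) →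
      ∫ ξ : Sph n, |Real.log ‖f ξ‖| ^ p ∂(sigma n) ≤ B →
      ∀ r : ℝ, 0 < r → r ≤ 1 / 8 → 2 * C * r ^ (α / (1 + n / p)) < ‖f ζ‖ →
        ∃ a : ℂ, ∫ ξ in qball ζ (4 * r), ‖f ξ - a‖ ^ 2 ∂(sigma n) ≤
          K * r ^ n * (r ^ (α / (1 + n / p))) ^ 2 := by
  obtain ⟨M, hM, hscale⟩ := exists_scale n hα hC hB
  obtain ⟨K, hK, hker⟩ := exists_kernel n
  -- Each exponent is the decay left over: `r d ^ (-n-1)` against `d ^ α`, then `r² d ^ (-n-2)`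
  -- against `d ^ (2α)`, then the reference kernel alone. The first two are positive because `α <
  -- 1`; the second would fail for `α ≥ 1/2` with a single power of decay.
  obtain ⟨Ca, hCa, hIa⟩ := integral_max_rpow_le n (show 0 < 1 - α by linarith)
  obtain ⟨Cb, hCb, hIb⟩ := integral_max_rpow_le n (show 0 < 2 - 2 * α by linarith)
  obtain ⟨Ct, hCt, hIt⟩ := integral_max_rpow_le n one_pos
  set J := (1 + M) * Ct + B with hJ
  have hJ0 : 0 < J := by positivity
  have hK0 : 0 < K := by linarith
  refine ⟨K * ((5 * C ^ 2 + (M + C) ^ 2) * (K * Cb) + 2 * K * J * M ^ 2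
    + 7 * (2 * C * (K * Ca) + K * J * M) ^ 2), by positivity, ?_⟩
  intro p f ζ hp hf hH hint hle r hr hr8 hlt
  set s : ℝ := 1 + n / p with hs
  have hn : (0 : ℝ) < n := Nat.cast_pos.mpr (NeZero.pos n)
  have hs1 : 1 < s := by
    have : 0 < n / p := by positivity
    linarith
  obtain ⟨x, hx⟩ : ∃ x, x = ‖f ζ‖ := ⟨_, rfl⟩
  have hx0 : 0 < x := by
    rw [hx]; exact lt_trans (by positivity) hlt
  obtain ⟨R, hR0, hR1, hnear, hlogR, hxR, hrR⟩ := hscale p (fun ξ => ‖f ξ‖) ζ hp (hx ▸ hx0) hH hint hle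
  have hrR' := hrR r hr (by linarith) hlt
  have hrleR : r ≤ R := by
    refine le_trans ?_ hrR'
    have := Real.rpow_le_rpow_of_exponent_ge hr (by linarith : r ≤ 1)
      (show 1 / s ≤ 1 by rw [div_le_one (by linarith)]; exact hs1.le)
    rwa [Real.rpow_one] at this
  set v : Sph n → ℝ := fun ξ => Real.log ‖f ξ‖ with hv
  have hvi : Integrable v (sigma n) := hf.integrable_log
  have hbounds := holder_log_bounds (φ := fun ξ : Sph n => ‖f ξ‖) (ζ := ζ) hα hC hM hR0
    (hx ▸ hx0 : 0 < ‖f ζ‖) (fun ξ => norm_nonneg (f ξ)) hH hnear hxR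
  simp only [← hx] at hbounds hlogR hxR
  set h : Sph n → ℝ := fun ξ => |v ξ| + |Real.log x| with hh
  have hhi : Integrable h (sigma n) := hvi.abs.add (integrable_const _)
  have hh0 : ∀ ξ, 0 ≤ h ξ := fun ξ => by positivity
  set T : Sph n → ℝ := (qball ζ R)ᶜ.indicator h with hT
  have hTi : Integrable T (sigma n) := hhi.indicator (measurableSet_qball ζ R).compl
  have hu : ∀ ξ, |v ξ - Real.log x| ≤ 2 * C / x * qdist ξ ζ ^ α + T ξ := fun ξ => (hbounds ξ).1
  have hb : ∀ ξ : Sph n, ‖f ξ‖ ^ 2 - x ^ 2 - 2 * x ^ 2 * (v ξ - Real.log x) ≤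
      (5 * C ^ 2 + (M + C) ^ 2) * qdist ξ ζ ^ (2 * α) + 2 * x ^ 2 * T ξ := fun ξ => (hbounds ξ).2
  have htail : ∫ ξ, max (qdist ξ ζ) R ^ (-((n : ℝ) + 1)) * h ξ ∂(sigma n) ≤ J * R ^ (-s) :=
    integral_tail_kernel_le hR0 hp hvi (hIt ζ R hR0) hint hle (abs_nonneg _) hlogR
  obtain ⟨b, ρ₁, ρ₂, hb0, hb1, hρ₁0, hρ₁1, hρ₂0, hρ₂1, hker'⟩ := hker r hr hr8
  have hz₁ := norm_radial_lt_one hρ₁0 hρ₁1 ζ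
  have hz₂ := norm_radial_lt_one hρ₂0 hρ₂1 ζ
  have hqα : ∀ γ : ℝ, 0 ≤ γ → Integrable (fun ξ : Sph n => qdist ξ ζ ^ γ) (sigma n) := fun γ hγ =>
    Continuous.integrable_sphere ((continuous_qdist ζ).rpow_const fun _ => Or.inr hγ)
  -- deviation of the Poisson integrals of `log |f|`
  set E := 2 * C / x * (K * Ca * r ^ α) + K * (r * (J * R ^ (-s))) with hE
  have hdev : ∀ z : Cn n, ‖z‖ < 1 →
      (∀ ξ : Sph n, poisson z ξ ≤ K * r * (max (qdist ξ ζ) r ^ (n + 1))⁻¹) →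
      |∫ ξ : Sph n, poisson z ξ * (v ξ - Real.log x) ∂(sigma n)| ≤ E := by
    intro z hz hle
    have hc := continuous_poisson hz
    have hle' : ∀ ξ : Sph n, poisson z ξ ≤ K * r ^ (0 + 1) * (max (qdist ξ ζ) r ^ (n + (0 + 1)))⁻¹ :=
      fun ξ => by simpa using hle ξ
    have i1 := integral_kernel_mul_qdist_rpow_le (γ := α) (CI := Ca) (j := 0 + 1) hc hr hK0.le hα.le
      hle' (by simpa using hIa ζ r hr)
    have i2 := integral_kernel_mul_tail_le (j := 0) hc hr hrleR hK0.le hhi hh0 hle'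
    have i3 : ∫ ξ : Sph n, poisson z ξ * (2 * C / x * qdist ξ ζ ^ α + T ξ) ∂(sigma n) =
        2 * C / x * ∫ ξ : Sph n, poisson z ξ * qdist ξ ζ ^ α ∂(sigma n)
          + ∫ ξ : Sph n, poisson z ξ * T ξ ∂(sigma n) := by
      rw [← integral_const_mul, ← integral_add
        ((integrable_continuous_mul hc (hqα α hα.le)).const_mul _) (integrable_continuous_mul hc hTi)]
      congr 1; ext ξ; ring
    calc |∫ ξ : Sph n, poisson z ξ * (v ξ - Real.log x) ∂(sigma n)|
        ≤ ∫ ξ : Sph n, |poisson z ξ * (v ξ - Real.log x)| ∂(sigma n) := abs_integral_le_integral_abs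
      _ ≤ ∫ ξ : Sph n, poisson z ξ * (2 * C / x * qdist ξ ζ ^ α + T ξ) ∂(sigma n) := by
          refine integral_mono (integrable_continuous_mul hc (hvi.sub (integrable_const _))).abs
            (integrable_continuous_mul hc (((hqα α hα.le).const_mul _).add hTi)) fun ξ => ?_
          rw [abs_mul, abs_of_nonneg (poisson_nonneg hz _)]
          exact mul_le_mul_of_nonneg_left (hu ξ) (poisson_nonneg hz _)
      _ ≤ E := by
          rw [i3]
          refine add_le_add (mul_le_mul_of_nonneg_left i1 (by positivity)) (i2.trans ?_)
          rw [zero_add, pow_one, pow_zero, inv_one, mul_one, mul_assoc]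
          gcongr
  have hbd := norm_le_of_holder (φ := fun ξ : Sph n => ‖f ξ‖) hα hα1 (by linarith)
    (show ‖f ζ‖ ≤ M by
      rw [← hx]
      refine hxR.trans ?_
      have := Real.rpow_le_one hR0.le hR1 hα.le
      nlinarith) hH
  have hfi := hf.integrable hbd
  have hf2 : Integrable (fun ξ : Sph n => ‖f ξ‖ ^ 2) (sigma n) := by
    refine Integrable.of_bound (hfi.1.norm.pow 2) ((M + 2 * C) ^ 2) (Eventually.of_forall fun ξ => ?_)
    rw [Real.norm_of_nonneg (by positivity)]
    exact pow_le_pow_left₀ (norm_nonneg _) (hbd ξ) 2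
  have hM2 : 1 ≤ M + 2 * C := by linarith
  set G : Sph n → ℝ := fun ξ =>
    (5 * C ^ 2 + (M + C) ^ 2) * qdist ξ ζ ^ (2 * α) + 2 * x ^ 2 * T ξ with hG
  have hGi : Integrable G (sigma n) :=
    ((hqα (2 * α) (by linarith)).const_mul _).add (hTi.const_mul _)
  obtain ⟨hWi, hWle⟩ := weighted_variance_le hb0 hb1 hx0 (continuous_poisson hz₁)
    (continuous_poisson hz₂) (integral_poisson hz₁) (integral_poisson hz₂) hfi hf2 hvi hGi
    (hf.eq_integral_poisson hp hint hM2 hbd hz₁) (hf.eq_integral_poisson hp hint hM2 hbd hz₂)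
    (hf.norm_eq_exp_poisson hp hint hz₁) (hf.norm_eq_exp_poisson hp hint hz₂)
    (hdev _ hz₁ fun ξ => (hker' ζ ξ).1) (hdev _ hz₂ fun ξ => (hker' ζ ξ).2.1)
    (fun ξ => (hker' ζ ξ).2.2.1) hb
  set a : ℂ := (1 + b) * f (radial ρ₁ ζ) - b * f (radial ρ₂ ζ) with ha
  set W : Sph n → ℝ := fun ξ => (1 + b) * poisson (radial ρ₁ ζ) ξ - b * poisson (radial ρ₂ ζ) ξ
    with hW
  have hWc : Continuous W :=
    (continuous_const.mul (continuous_poisson hz₁)).sub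
      (continuous_const.mul (continuous_poisson hz₂))
  have hW0 : ∀ ξ, 0 ≤ W ξ := fun ξ => (hker' ζ ξ).2.2.1
  have hWG : ∫ ξ, W ξ * G ξ ∂(sigma n) ≤ (5 * C ^ 2 + (M + C) ^ 2) * (K * Cb * r ^ (2 * α))
      + 2 * x ^ 2 * (K * r ^ 2 * R⁻¹ * (J * R ^ (-s))) := by
    have hle' : ∀ ξ, W ξ ≤ K * r ^ (1 + 1) * (max (qdist ξ ζ) r ^ (n + (1 + 1)))⁻¹ :=
      fun ξ => (hker' ζ ξ).2.2.2.1
    have i1 := integral_kernel_mul_qdist_rpow_le (γ := 2 * α) (CI := Cb) (j := 1 + 1) hWc hr hK0.le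
      (by linarith) hle' (by
        have := hIb ζ r hr
        rwa [show ((1 + 1 : ℕ) : ℝ) = 2 by norm_num])
    have i2 := integral_kernel_mul_tail_le (j := 1) hWc hr hrleR hK0.le hhi hh0 hle'
    have i3 : ∫ ξ, W ξ * G ξ ∂(sigma n) =
        (5 * C ^ 2 + (M + C) ^ 2) * ∫ ξ, W ξ * qdist ξ ζ ^ (2 * α) ∂(sigma n)
          + 2 * x ^ 2 * ∫ ξ, W ξ * T ξ ∂(sigma n) := by
      rw [← integral_const_mul, ← integral_const_mul, ← integral_add
        ((integrable_continuous_mul hWc (hqα (2 * α) (by linarith))).const_mul _)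
        ((integrable_continuous_mul hWc hTi).const_mul _)]
      congr 1; ext ξ; rw [hG]; ring
    rw [i3]
    refine add_le_add (mul_le_mul_of_nonneg_left i1 (by positivity))
      (mul_le_mul_of_nonneg_left (i2.trans ?_) (by positivity))
    rw [pow_one]
    exact mul_le_mul_of_nonneg_left htail (by positivity)
  -- the bound in terms of `r ^ (α / s)`
  set y := r ^ (α / s) with hy
  have hy0 : 0 < y := by positivity
  have hry : r ^ α ≤ y :=
    Real.rpow_le_rpow_of_exponent_ge hr (by linarith) (div_le_self hα.le hs1.le)
  have hxy : x * (r * R ^ (-s)) ≤ M * y := mul_scale_le hs1 hα1 hr hR0 (by linarith) hrR' hxR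
  have hRs : R⁻¹ ≤ R ^ (-s) := by
    rw [← Real.rpow_neg_one]
    exact Real.rpow_le_rpow_of_exponent_ge hR0 hR1 (by linarith)
  have hxE : x * E ≤ (2 * C * (K * Ca) + K * J * M) * y := by
    have e : x * E = 2 * C * (K * Ca) * r ^ α + K * J * (x * (r * R ^ (-s))) := by
      rw [hE]; field_simp
    rw [e, add_mul]
    refine add_le_add (by gcongr) ?_
    rw [mul_assoc (K * J)]
    gcongr
  have hE0 : 0 ≤ x * E := by positivity
  have hxE2 : x ^ 2 * E ^ 2 ≤ (2 * C * (K * Ca) + K * J * M) ^ 2 * y ^ 2 := by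
    rw [← mul_pow, ← mul_pow]; exact pow_le_pow_left₀ hE0 hxE 2
  have hr2 : r ^ (2 * α) ≤ y ^ 2 := by
    rw [mul_comm, Real.rpow_mul hr.le, Real.rpow_ofNat]
    exact pow_le_pow_left₀ (by positivity) hry 2
  -- The tail enters the variance linearly. The second power of decay supplies `r² R⁻¹ R ^ (-s) ≤ (r
  -- R ^ (-s))²`, so this term is also of order `y²`.
  have hx2 : x ^ 2 * (K * r ^ 2 * R⁻¹ * (J * R ^ (-s))) ≤ K * J * M ^ 2 * y ^ 2 := by
    calc x ^ 2 * (K * r ^ 2 * R⁻¹ * (J * R ^ (-s)))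
        ≤ x ^ 2 * (K * r ^ 2 * R ^ (-s) * (J * R ^ (-s))) := by gcongr
      _ = K * J * (x * (r * R ^ (-s))) ^ 2 := by ring
      _ ≤ K * J * (M * y) ^ 2 := by gcongr
      _ = _ := by ring
  have hV : ∫ ξ, W ξ * ‖f ξ - a‖ ^ 2 ∂(sigma n) ≤
      ((5 * C ^ 2 + (M + C) ^ 2) * (K * Cb) + 2 * K * J * M ^ 2
        + 7 * (2 * C * (K * Ca) + K * J * M) ^ 2) * y ^ 2 := by
    have h1 : (5 * C ^ 2 + (M + C) ^ 2) * (K * Cb * r ^ (2 * α)) ≤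
        (5 * C ^ 2 + (M + C) ^ 2) * (K * Cb * y ^ 2) := by gcongr
    linarith
  refine ⟨a, ?_⟩
  calc ∫ ξ in qball ζ (4 * r), ‖f ξ - a‖ ^ 2 ∂(sigma n)
      ≤ ∫ ξ in qball ζ (4 * r), K * r ^ n * (W ξ * ‖f ξ - a‖ ^ 2) ∂(sigma n) := by
        refine integral_mono_of_nonneg (Eventually.of_forall fun _ => by positivity)
          (hWi.const_mul _).integrableOn ?_
        filter_upwards [ae_restrict_mem (measurableSet_qball ζ (4 * r))] with ξ hξ
        have h1 : 1 ≤ K * r ^ n * W ξ := (hker' ζ ξ).2.2.2.2 hξ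
        calc ‖f ξ - a‖ ^ 2 = 1 * ‖f ξ - a‖ ^ 2 := (one_mul _).symm
          _ ≤ K * r ^ n * W ξ * ‖f ξ - a‖ ^ 2 := mul_le_mul_of_nonneg_right h1 (by positivity)
          _ = _ := by ring
    _ ≤ ∫ ξ, K * r ^ n * (W ξ * ‖f ξ - a‖ ^ 2) ∂(sigma n) :=
        setIntegral_le_integral (hWi.const_mul _) (Eventually.of_forall fun ξ =>
          mul_nonneg (by positivity) (mul_nonneg (hW0 ξ) (by positivity)))
    _ ≤ K * r ^ n * (((5 * C ^ 2 + (M + C) ^ 2) * (K * Cb) + 2 * K * J * M ^ 2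
        + 7 * (2 * C * (K * Ca) + K * J * M) ^ 2) * y ^ 2) := by
        rw [integral_const_mul]
        exact mul_le_mul_of_nonneg_left hV (by positivity)
    _ = _ := by ring

lemma meanOsc_le (f : Sph n → ℂ) (Q : Set (Sph n)) (a : ℂ) :
    meanOsc f Q ≤ ((sigma n).real Q)⁻¹ * ∫ z in Q, ‖f z - a‖ ∂(sigma n) :=
  ciInf_le ⟨0, by
    rintro _ ⟨b, rfl⟩
    exact mul_nonneg (inv_nonneg.mpr measureReal_nonneg) (integral_nonneg fun _ => norm_nonneg _)⟩ a

lemma meanOsc_le_of_norm_le [NeZero n] {f : Sph n → ℂ} {Q : Set (Sph n)} (hQ : MeasurableSet Q)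
    {M : ℝ} (hM : 0 ≤ M) (h : ∀ z ∈ Q, ‖f z‖ ≤ M) : meanOsc f Q ≤ M := by
  refine (meanOsc_le f Q 0).trans ?_
  simp only [sub_zero]
  have h1 : ∫ z in Q, ‖f z‖ ∂(sigma n) ≤ ∫ _ in Q, M ∂(sigma n) := by
    refine integral_mono_of_nonneg (Eventually.of_forall fun _ => norm_nonneg _)
      (integrable_const M).integrableOn ?_
    filter_upwards [ae_restrict_mem hQ] with z hz using h z hz
  rw [setIntegral_const, smul_eq_mul] at h1
  rcases (measureReal_nonneg (μ := sigma n) (s := Q)).eq_or_lt with h0 | h0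
  · rw [← h0, inv_zero, zero_mul]; exact hM
  · rwa [inv_mul_le_iff₀ h0]

/-- The inequality `|g| ≤ y + |g|² / y` replaces Cauchy–Schwarz and turns a mean square of order
`y²` into a mean of order `y`. -/
lemma meanOsc_le_of_sq [NeZero n] {f : Sph n → ℂ} (hf : AEStronglyMeasurable f (sigma n)) {M : ℝ}
    (hb : ∀ ξ, ‖f ξ‖ ≤ M) {Q Q' : Set (Sph n)} (hQQ : Q ⊆ Q') {a : ℂ} {c K t y : ℝ} (hc : 0 < c)
    (ht : 0 < t) (hy : 0 < y) (hσ : c * t ≤ (sigma n).real Q)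
    (hV : ∫ ξ in Q', ‖f ξ - a‖ ^ 2 ∂(sigma n) ≤ K * t * y ^ 2) :
    meanOsc f Q ≤ (1 + K / c) * y := by
  have hS : 0 < (sigma n).real Q := lt_of_lt_of_le (by positivity) hσ
  have h2i : Integrable (fun ξ => ‖f ξ - a‖ ^ 2) (sigma n) := by
    refine Integrable.of_bound ((hf.sub aestronglyMeasurable_const).norm.pow 2) ((M + ‖a‖) ^ 2)
      (Eventually.of_forall fun ξ => ?_)
    rw [Real.norm_of_nonneg (by positivity)]
    exact pow_le_pow_left₀ (norm_nonneg _) ((norm_sub_le _ _).trans (by linarith [hb ξ])) 2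
  have hV' : ∫ ξ in Q, ‖f ξ - a‖ ^ 2 ∂(sigma n) ≤ K * t * y ^ 2 :=
    (setIntegral_mono_set h2i.integrableOn (Eventually.of_forall fun _ => by positivity)
      (Eventually.of_forall hQQ)).trans hV
  have hK : 0 ≤ K := by
    have : 0 ≤ K * (t * y ^ 2) := by
      rw [← mul_assoc]
      exact (setIntegral_nonneg_of_ae (Eventually.of_forall fun _ => by positivity)).trans hV'
    exact nonneg_of_mul_nonneg_left this (by positivity)
  refine (meanOsc_le f Q a).trans ?_
  rw [inv_mul_le_iff₀ hS]
  calc ∫ ξ in Q, ‖f ξ - a‖ ∂(sigma n)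
      ≤ ∫ ξ in Q, (y + y⁻¹ * ‖f ξ - a‖ ^ 2) ∂(sigma n) := by
        refine integral_mono_of_nonneg (Eventually.of_forall fun _ => norm_nonneg _)
          ((integrable_const _).add (h2i.const_mul _)).integrableOn (Eventually.of_forall fun ξ => ?_)
        change ‖f ξ - a‖ ≤ y + y⁻¹ * ‖f ξ - a‖ ^ 2
        rw [← sub_nonneg, show y + y⁻¹ * ‖f ξ - a‖ ^ 2 - ‖f ξ - a‖
          = y⁻¹ * ((y - ‖f ξ - a‖ / 2) ^ 2 + 3 / 4 * ‖f ξ - a‖ ^ 2) by field_simp; ring]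
        positivity
    _ = (sigma n).real Q * y + y⁻¹ * ∫ ξ in Q, ‖f ξ - a‖ ^ 2 ∂(sigma n) := by
        rw [integral_add (integrable_const _).integrableOn (h2i.const_mul _).integrableOn,
          integral_const_mul, setIntegral_const, smul_eq_mul]
    _ ≤ (sigma n).real Q * y + y⁻¹ * (K * t * y ^ 2) := by gcongr
    _ = (sigma n).real Q * y + c * t * (K / c * y) := by field_simp
    _ ≤ (sigma n).real Q * y + (sigma n).real Q * (K / c * y) := by gcongr
    _ = _ := by ring

lemma sigma_qball_zero [NeZero n] (ζ : Sph n) : (sigma n).real (qball ζ 0) = 0 := by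
  refine le_antisymm (le_of_forall_pos_le_add fun ε hε => ?_) measureReal_nonneg
  have hr : 0 < min 1 (ε / 4 ^ n) := lt_min one_pos (by positivity)
  have h1 : (sigma n).real (qball ζ 0) ≤ (sigma n).real (qball ζ (min 1 (ε / 4 ^ n))) :=
    measureReal_mono fun z (hz : qdist z ζ ≤ 0) => hz.trans hr.le
  have h2 := sigma_qball_le ζ hr
  have h3 : min 1 (ε / 4 ^ n) ^ n ≤ ε / 4 ^ n :=
    (pow_le_of_le_one hr.le (min_le_left _ _) (NeZero.ne n)).trans (min_le_right _ _)
  have h4 : 4 ^ n * min 1 (ε / 4 ^ n) ^ n ≤ 4 ^ n * (ε / 4 ^ n) := by gcongr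
  rw [mul_div_cancel₀ _ (by positivity)] at h4
  linarith

lemma exponent_eq {p q α : ℝ} (h : p.HolderConjugate q) (n : ℕ) :
    α / (n + 1 - n / q) = α / (1 + n / p) ∧ α / (n + 1 - n / q) = α * p / (p + n) := by
  have hp : 0 < p := h.pos
  have h1 : (n : ℝ) / q = n - n / p := by
    have h2 : q⁻¹ = 1 - p⁻¹ := by linarith [h.inv_add_inv_eq_one]
    rw [div_eq_mul_inv, h2, div_eq_mul_inv]; ring
  have e : (n : ℝ) + 1 - n / q = 1 + n / p := by rw [h1]; ring
  refine ⟨by rw [e], ?_⟩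
  have hpn : (0 : ℝ) < p + n := by positivity
  rw [e, show 1 + n / p = (p + n) / p by field_simp, div_div_eq_mul_div]

/-- The oscillation of an outer function at a point where its modulus is Hölder. -/
theorem exists_meanOsc_bound (n : ℕ) [NeZero n] {α C B : ℝ} (hα : 0 < α) (hα1 : α < 1)
    (hC : 1 ≤ C) (hB : 1 ≤ B) :
    ∃ K : ℝ, 0 < K ∧ ∀ (p : ℝ) (f : Cn n → ℂ) (ω : Sph n), 1 < p → IsOuter f →
      (∀ ξ : Sph n, |‖f ξ‖ - ‖f ω‖| ≤ C * qdist ξ ω ^ α) →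
      Integrable (fun ξ : Sph n => |Real.log ‖f ξ‖| ^ p) (sigma n) →
      ∫ ξ : Sph n, |Real.log ‖f ξ‖| ^ p ∂(sigma n) ≤ B →
      Integrable (fun ξ : Sph n => f ξ) (sigma n) ∧
      ∀ (ζ : Sph n) (r : ℝ), 0 ≤ r → ω ∈ qball ζ r →
        meanOsc (fun ξ : Sph n => f ξ) (qball ζ r) ≤ K * r ^ (α / (1 + n / p)) := by
  obtain ⟨M, hM, hscale⟩ := exists_scale n hα hC hB
  obtain ⟨V, hV, hvar⟩ := exists_variance_bound n hα hα1 hC hB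
  obtain ⟨c, hc, hσ⟩ := le_sigma_qball n
  have hVc : 0 < V / c := by positivity
  -- One summand for each case: radius above `1/8`, where the bound on `|f|` suffices; small central
  -- value; and large central value, where the variance bound applies.
  refine ⟨8 * (M + 2 * C) + 6 * C + (1 + V / c), by positivity, ?_⟩
  intro p f ω hp hf hH hint hle
  have hω : ‖f ω‖ ≤ M := by
    rcases (norm_nonneg (f ω)).eq_or_lt with h | h
    · rw [← h]; linarith
    · obtain ⟨R, hR0, hR1, -, -, hxR, -⟩ := hscale p (fun ξ => ‖f ξ‖) ω hp h hH hint hle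
      have := Real.rpow_le_one hR0.le hR1 hα.le
      exact hxR.trans (by nlinarith)
  have hbd := norm_le_of_holder (φ := fun ξ : Sph n => ‖f ξ‖) hα hα1 (by linarith) hω hH
  have hfi := hf.integrable hbd
  refine ⟨hfi, fun ζ r hr0 hmem => ?_⟩
  set β : ℝ := α / (1 + n / p) with hβ
  have hs : 1 ≤ 1 + (n : ℝ) / p := by
    have : 0 ≤ (n : ℝ) / p := by positivity
    linarith
  have hβ0 : 0 < β := by positivity
  have hβα : β ≤ α := div_le_self hα.le hs
  have hrβ : 0 ≤ r ^ β := by positivity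
  have hM8 : 0 ≤ M + 2 * C := by linarith
  rcases hr0.eq_or_lt with rfl | hr
  · refine (meanOsc_le _ _ 0).trans ?_
    -- A ball of radius 0 is null, and its inverse measure is 0 by convention.
    rw [sigma_qball_zero, inv_zero, zero_mul]
    positivity
  rcases lt_or_ge (1 / 8) r with hr8 | hr8
  · have h1 : 1 / 8 ≤ r ^ β := by
      rcases le_total r 1 with h | h
      · have := Real.rpow_le_rpow_of_exponent_ge hr h (show β ≤ 1 by linarith)
        rw [Real.rpow_one] at this
        linarith
      · have := Real.one_le_rpow h hβ0.le
        linarith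
    have h2 := meanOsc_le_of_norm_le (measurableSet_qball ζ r) hM8
      (f := fun ξ : Sph n => f ξ) fun z _ => hbd z
    have h3 : (M + 2 * C) * (1 / 8) ≤ (M + 2 * C) * r ^ β := mul_le_mul_of_nonneg_left h1 hM8
    have h4 : 0 ≤ (6 * C + (1 + V / c)) * r ^ β := by positivity
    linarith
  have hsub : qball ζ r ⊆ qball ω (4 * r) := by
    intro z (hz : qdist z ζ ≤ r)
    have h1 : qdist ω ζ ≤ r := hmem
    rw [qdist_comm] at h1
    have := qdist_triangle z ζ ω
    change qdist z ω ≤ 4 * r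
    linarith
  -- In the small case `|f| ≤ 2 C r ^ β + C (4 r) ^ α ≤ 6 C r ^ β` on the ball, so `a = 0` is good
  -- enough.
  rcases le_or_gt ‖f ω‖ (2 * C * r ^ β) with hsmall | hlarge
  · have h2 := meanOsc_le_of_norm_le (measurableSet_qball ζ r) (M := 6 * C * r ^ β) (by positivity)
      (f := fun ξ : Sph n => f ξ) fun z hz => by
        have hz' : qdist z ω ≤ 4 * r := hsub hz
        have h3 : qdist z ω ^ α ≤ 4 * r ^ β := by
          calc qdist z ω ^ α ≤ (4 * r) ^ α := Real.rpow_le_rpow (qdist_nonneg _ _) hz' hα.le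
            _ = 4 ^ α * r ^ α := Real.mul_rpow (by norm_num) hr0
            _ ≤ 4 ^ (1 : ℝ) * r ^ β := by
                have h4 := Real.rpow_le_rpow_of_exponent_le (show (1 : ℝ) ≤ 4 by norm_num) hα1.le
                have h5 := Real.rpow_le_rpow_of_exponent_ge hr (by linarith) hβα
                gcongr
            _ = 4 * r ^ β := by rw [Real.rpow_one]
        have h4 : C * qdist z ω ^ α ≤ C * (4 * r ^ β) := mul_le_mul_of_nonneg_left h3 (by linarith)
        linarith [(abs_le.mp (hH z)).2]
    have h4 : 0 ≤ (8 * (M + 2 * C) + (1 + V / c)) * r ^ β := by positivity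
    linarith
  · obtain ⟨a, ha⟩ := hvar p f ω hp hf hH hint hle r hr hr8 hlarge
    have h2 := meanOsc_le_of_sq hfi.1 hbd hsub hc (pow_pos hr n) (by positivity : 0 < r ^ β)
      (hσ ζ r hr (by linarith)) ha
    have h4 : 0 ≤ (8 * (M + 2 * C) + 6 * C) * r ^ β := by positivity
    linarith

end BallOuter

end

theorem mainTheorem2 (n : ℕ) [NeZero n] (α : ℝ) (hα0 : 0 < α) (hα1 : α < 1) (C₀ B : ℝ) :
    ∃ C : ℝ, 0 < C ∧
      ∀ (p q : ℝ), p.HolderConjugate q →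
      ∀ f : BallOuter.Cn n → ℂ, BallOuter.IsOuter f →
        (∀ t : BallOuter.Sph n,
          |‖f t‖ - ‖f (BallOuter.one n)‖| ≤ C₀ * BallOuter.qdist t (BallOuter.one n) ^ α) →
        MeasureTheory.Integrable (fun ξ : BallOuter.Sph n => |Real.log ‖f ξ‖| ^ p)
          (BallOuter.sigma n) →
        (∫ ξ : BallOuter.Sph n, |Real.log ‖f ξ‖| ^ p ∂(BallOuter.sigma n)) ≤ B →
        MeasureTheory.Integrable (fun ξ : BallOuter.Sph n => f ξ) (BallOuter.sigma n) ∧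
        α / (n + 1 - n / q) = α * p / (p + n) ∧
        ∀ (ζ : BallOuter.Sph n) (r : ℝ), 0 ≤ r → BallOuter.one n ∈ BallOuter.qball ζ r →
          BallOuter.meanOsc (fun ξ : BallOuter.Sph n => f ξ) (BallOuter.qball ζ r)
            ≤ C * r ^ (α / (n + 1 - n / q)) := by
  -- Enlarging `C₀` and `B` to at least 1 only weakens the hypotheses and gives the normalization
  -- required by the estimates.
  obtain ⟨K, hK, hmain⟩ := BallOuter.exists_meanOsc_bound n hα0 hα1 (le_max_right C₀ 1)
    (le_max_right B 1)
  refine ⟨K, hK, fun p q hpq f hf hH hint hle => ?_⟩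
  have hH' : ∀ ξ : BallOuter.Sph n, |‖f ξ‖ - ‖f (BallOuter.one n)‖| ≤
      max C₀ 1 * BallOuter.qdist ξ (BallOuter.one n) ^ α := fun ξ =>
    (hH ξ).trans (mul_le_mul_of_nonneg_right (le_max_left _ _)
      (Real.rpow_nonneg (BallOuter.qdist_nonneg _ _) _))
  obtain ⟨hfi, hosc⟩ := hmain p f (BallOuter.one n) hpq.lt hf hH' hint
    (hle.trans (le_max_left _ _))
  obtain ⟨e1, e2⟩ := BallOuter.exponent_eq (α := α) hpq n
  refine ⟨hfi, e2, fun ζ r hr hmem => ?_⟩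
  rw [e1]
  exact hosc ζ r hr hmem
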